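/- Let $M$ be a real $3\times3$ matrix and let $P$ be a projection fibered in Fourier space, $\widehat{Pf}(\xi)=P(\xi)\hat f(\xi)$, where $\xi\mapsto P(\xi)$ is a measurable family of orthogonal projections on $\mathbb C^3$. Put $A=\sqrt{-\Delta}$ on $\mathbb R^3$, let $\|\cdot\|$ be the norm of $(L^2)^3$, and write $\langle\lambda\rangle=(1+\lambda^2)^{1/2}$. For $0\le r<3/2$ let $\dot H^r$ be the space of vector-valued tempered distributions $f$ with $\hat f$ a measurable function and $\|A^rf\|<\infty$. For continuous $\zeta:I\to\mathbb R$, $\theta:I\to[0,\infty)$ let $\mathcal B_{\zeta,\theta,I}$ be the space of $v:I\to\dot H^{5/4}$ such that $e^{-\zeta(t)}t^{3/8}e^{\theta(t)A}A^{5/4}v(t)$ is bounded and continuous from $I$ to $(L^2)^3$, normed by the supremum over $I$ of the $L^2$-norm of this expression. Put $$B(u,v)(t)=-\int_0^t e^{-(t-s)A^2}P\,(Mu(s)\cdot\nabla)v(s)\,ds .$$ For $\lambda_0\ge0$, $T>0$ take $I=(0,T]$, $\lambda(t)=\lambda_0\sqrt{t/T}$, $\zeta=\lambda^2/4+\tfrac34\ln\langle\lambda\rangle$,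 $\theta=\lambda\sqrt t$. Then there are constants $C_1,C_3>0$ (not depending on $\lambda_0,T,u_0,u,v$) such that, for all $\lambda_0\ge0$ and $T>0$, in the norm $|\cdot|$ of $\mathcal B_{\zeta,\theta,I}$, $$|e^{-(\cdot)A^2}u_0|\le C_1\|A^{1/2}u_0\|\quad(u_0\in\dot H^{1/2}),\qquad |B(u,v)|\le C_3\langle\lambda_0\rangle^2e^{\lambda_0^2/4}|u|\,|v|\quad(u,v\in\mathcal B_{\zeta,\theta,I}),$$ where it is part of the claim that the elements on the left belong to $\mathcal B_{\zeta,\theta,I}$. Fix any such $C_1,C_3>0$. Let $u_0\in\dot H^{1/2}$ with $C_4:=4C_1C_3\|A^{1/2}u_0\|<1$. If $u_0\ne0$ let $\bar\lambda>0$ solve $C_4\langle\bar\lambda\rangle^2e^{\bar\lambda^2/4}=1$; if $u_0=0$ let $\bar\lambda=\infty$. Let $X$ be the small global solution with data $u_0$: $X(t)=e^{-tA^2}u_0+B(X,X)(t)$ for $t>0$, with $X$ in the ball of radius $2R$ of $\mathcal B_{0,0,(0,\infty)}$, where $R\ge0$ is at least the norm of $e^{-(\cdot)A^2}u_0$ in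 that space and $4\gamma R<1$, $\gamma\ge0$ being a constant with $|B(u,v)|\le\gamma|u||v|$ on $\mathcal B_{0,0,(0,T]}$ for all $T>0$. For $\lambda_0\in(0,\bar\lambda)$, $t>0$ put $$J_r(t)=\|A^rX(t)\|^2,\qquad G_r(t)=\|A^re^{\lambda_0\sqrt t A}X(t)\|^2 .$$ These are finite for all $t>0$, $r\ge1/2$, and also for $r\ge0$ if $u_0\in L^2$. Moreover: 1. For all $\kappa>0$ and $\lambda_0>0$ there is $K=K(\kappa,\lambda_0)>0$ (not depending on $u_0$) such that whenever $\lambda_0<\bar\lambda$, the function $G_{1/2}$ is differentiable on $(0,\infty)$ and for all $t>0$ $$G_{1/2}'(t)\le-\kappa t^{-1}G_{1/2}(t)+Kt^{-1}J_{1/2}(t),\qquad G_{1/2}(t)\le Kt^{-\kappa}\int_0^ts^{\kappa-1}J_{1/2}(s)\,ds,$$ the integral being finite; if in addition $u_0\in L^2$, the same holds with $G_0,J_0$ in place of $G_{1/2},J_{1/2}$. 2. If $\sigma>-1/2$ and $J_{1/2}(t)=O(t^{-\sigma-1/2})$ as $t\to\infty$, then $J_r(t)=O(t^{-\sigma-r})$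 and $G_r(t)=O(t^{-\sigma-r})$ as $t\to\infty$ for all $r\ge1/2$. 3. If $u_0\in L^2$, $\sigma>-1/2$ and $J_0(t)=O(t^{-\sigma})$ as $t\to\infty$, then $J_r(t)=O(t^{-\sigma-r})$ and $G_r(t)=O(t^{-\sigma-r})$ as $t\to\infty$ for all $r\ge0$. 4. If $u_0\in L^2$ and $J_0(t)=O(1)$ as $t\to\infty$, then $G_0(t)=o(1)$ as $t\to\infty$. -/

import Mathlib

open MeasureTheory Filter Asymptotics FourierTransform LineDeriv
open scoped SchwartzMap ENNReal Topology

noncomputable section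

namespace NavierStokes

/-- Physical (or frequency) space `ℝ³`. -/
abbrev Space := EuclideanSpace ℝ (Fin 3)

/-- Values of vector fields. -/
abbrev Vec := EuclideanSpace ℂ (Fin 3)

/-- `(L²)³`, normed by `‖f‖² = ‖f₁‖² + ‖f₂‖² + ‖f₃‖²`. -/
abbrev VecL2 := Lp Vec 2 (volume : Measure Space)

/-- `(𝒮')³`. -/
abbrev VecDist := 𝓢'(Space, Vec)

/-- The tempered distribution `T` is the (measurable) function `f`. -/
def IsFun (T : VecDist) (f : Space → Vec) : Prop :=
  AEStronglyMeasurable f volume ∧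
    ∀ φ : 𝓢(Space, ℂ), Integrable (fun x => φ x • f x) volume ∧ T φ = ∫ x, φ x • f x

open Classical in
/-- The function (unique up to null sets) which the distribution `T` is, if there is one. -/
def toFun (T : VecDist) : Space → Vec :=
  if h : ∃ f, IsFun T f then h.choose else 0

open Classical in
/-- The class in `(L²)³` of a square integrable vector field. -/
def classL2 (g : Space → Vec) : VecL2 :=
  if h : MemLp g 2 volume then h.toLp g else 0

/-- The symbol of `A = √(-Δ)`. Mathlib's Fourier transform has the kernel `exp (-2πi x·ξ)`,
so this is `2π|ξ|`. -/
def symA (ξ : Space) : ℝ := 2 * Real.pi * ‖ξ‖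

/-- The Fourier transform of `A^r exp(θ A) T`, for `T` whose Fourier transform is a function. -/
def weightedHat (θ r : ℝ) (T : VecDist) : Space → Vec :=
  fun ξ => (symA ξ ^ r * Real.exp (θ * symA ξ)) • toFun (𝓕 T) ξ

/-- The Fourier transform of `T` is a measurable function and `A^r exp(θ A) T` is in `(L²)³`. -/
def InDom (θ r : ℝ) (T : VecDist) : Prop :=
  (∃ g, IsFun (𝓕 T) g) ∧ MemLp (weightedHat θ r T) 2 volume

/-- `A^r exp(θ A) T` as an element of `(L²)³`. -/
def expA (θ r : ℝ) (T : VecDist) : VecL2 := 𝓕⁻ (classL2 (weightedHat θ r T))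

/-- The homogeneous Sobolev space `(Ḣ^r)³`, `0 ≤ r < 3/2`. -/
def MemHdot (r : ℝ) (T : VecDist) : Prop := InDom 0 r T

/-- `‖A^r T‖`, the norm of `(Ḣ^r)³`. -/
def normHdot (r : ℝ) (T : VecDist) : ℝ := ‖expA 0 r T‖

/-- `T ∈ (L²)³`. -/
def MemL2 (T : VecDist) : Prop := ∃ f : VecL2, T = Lp.toTemperedDistribution f

/-- A measurable family of orthogonal projections in the fibers of Fourier space. -/
structure IsFiberedProjection (P : Space → Matrix (Fin 3) (Fin 3) ℂ) : Prop where
  measurable : ∀ i j, Measurable fun ξ => P ξ i j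
  isHermitian : ∀ ξ, (P ξ).IsHermitian
  idempotent : ∀ ξ, P ξ * P ξ = P ξ

/-- `exp(-t A²) T`. -/
def heat (t : ℝ) (T : VecDist) : VecDist :=
  TemperedDistribution.fourierMultiplierCLM Vec
    (fun ξ => ((Real.exp (-t * symA ξ ^ 2) : ℝ) : ℂ)) T

/-- `(M u · ∇) v = ∑ⱼ (M u)ⱼ ∂ⱼ v`, a pointwise product of functions. -/
def advect (M : Matrix (Fin 3) (Fin 3) ℝ) (u v : VecDist) : Space → Vec :=
  fun x => ∑ j, (∑ k, (M j k : ℂ) * toFun u x k) •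
    toFun (∂_{(EuclideanSpace.single j 1 : Space)} v) x

/-- `exp(-τ A²) P f` for `f ∈ (L²)³`. -/
def heatProj (P : Space → Matrix (Fin 3) (Fin 3) ℂ) (τ : ℝ) (f : VecL2) : VecL2 :=
  𝓕⁻ (classL2 fun ξ =>
    Real.exp (-τ * symA ξ ^ 2) • Matrix.toEuclideanLin (P ξ) ((𝓕 f : VecL2) ξ))

/-- `B(u,v)(t) = -∫₀ᵗ exp(-(t-s)A²) P (M u(s) · ∇) v(s) ds`, an integral in `(L²)³`. -/
def bil (P : Space → Matrix (Fin 3) (Fin 3) ℂ) (M : Matrix (Fin 3) (Fin 3) ℝ)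
    (u v : ℝ → VecDist) (t : ℝ) : VecDist :=
  Lp.toTemperedDistribution
    (-∫ s in (0 : ℝ)..t, heatProj P (t - s) (classL2 (advect M (u s) (v s))) : VecL2)

/-- `exp(-ζ(t)) t^{s₁} exp(θ(t)A) A^{s₂} v(t)`. -/
def scaled (ζ θ : ℝ → ℝ) (s₁ s₂ : ℝ) (v : ℝ → VecDist) (t : ℝ) : VecL2 :=
  (Real.exp (-ζ t) * t ^ s₁) • expA (θ t) s₂ (v t)

/-- Membership in the Banach space `ℬ_{ζ,θ,I,s₁,s₂}` of those `v : I → (Ḣ^{s₂})³` for which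
`exp(-ζ(t)) t^{s₁} exp(θ(t)A) A^{s₂} v(t)` is bounded and continuous from `I` to `(L²)³`. -/
structure MemB (ζ θ : ℝ → ℝ) (I : Set ℝ) (s₁ s₂ : ℝ) (v : ℝ → VecDist) : Prop where
  memHdot : ∀ t ∈ I, MemHdot s₂ (v t)
  inDom : ∀ t ∈ I, InDom (θ t) s₂ (v t)
  continuousOn : ContinuousOn (scaled ζ θ s₁ s₂ v) I
  bounded : BddAbove ((fun t => ‖scaled ζ θ s₁ s₂ v t‖) '' I)

/-- The norm of `ℬ_{ζ,θ,I,s₁,s₂}`. -/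
def normB (ζ θ : ℝ → ℝ) (I : Set ℝ) (s₁ s₂ : ℝ) (v : ℝ → VecDist) : ℝ :=
  sSup ((fun t => ‖scaled ζ θ s₁ s₂ v t‖) '' I)

/-- `λ(t) = λ₀ √(t/T)`. -/
def lam (lam0 T t : ℝ) : ℝ := lam0 * Real.sqrt (t / T)

/-- `ζ(t) = λ(t)²/4 + (3/4) ln ⟨λ(t)⟩`. -/
def zetaT (lam0 T t : ℝ) : ℝ :=
  lam lam0 T t ^ 2 / 4 + 3 / 4 * Real.log (Real.sqrt (1 + lam lam0 T t ^ 2))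

/-- `θ(t) = λ(t) √t`. -/
def thetaT (lam0 T t : ℝ) : ℝ := lam lam0 T t * Real.sqrt t

/-- `C₁` is admissible in `|exp(-(·)A²)u₀| ≤ C₁ ‖A^{1/2}u₀‖` for all `λ₀ ≥ 0`, `T > 0` and
`u₀ ∈ (Ḣ^{1/2})³`, the norm being that of `ℬ_{ζ,θ,]0,T],3/8,5/4}`. -/
def DataBound (C₁ : ℝ) : Prop :=
  ∀ lam0 T : ℝ, 0 ≤ lam0 → 0 < T → ∀ u₀ : VecDist, MemHdot (1 / 2) u₀ →
    MemB (zetaT lam0 T) (thetaT lam0 T) (Set.Ioc 0 T) (3 / 8) (5 / 4) (fun t => heat t u₀) ∧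
    normB (zetaT lam0 T) (thetaT lam0 T) (Set.Ioc 0 T) (3 / 8) (5 / 4) (fun t => heat t u₀) ≤
      C₁ * normHdot (1 / 2) u₀

/-- `C₃` is admissible in `|B(u,v)| ≤ C₃ ⟨λ₀⟩² exp(λ₀²/4) |u| |v|` for all `λ₀ ≥ 0`, `T > 0` and
`u, v ∈ ℬ_{ζ,θ,]0,T],3/8,5/4}`. -/
def BilinearBound (P : Space → Matrix (Fin 3) (Fin 3) ℂ) (M : Matrix (Fin 3) (Fin 3) ℝ)
    (C₃ : ℝ) : Prop :=
  ∀ lam0 T : ℝ, 0 ≤ lam0 → 0 < T → ∀ u v : ℝ → VecDist,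
    MemB (zetaT lam0 T) (thetaT lam0 T) (Set.Ioc 0 T) (3 / 8) (5 / 4) u →
    MemB (zetaT lam0 T) (thetaT lam0 T) (Set.Ioc 0 T) (3 / 8) (5 / 4) v →
    MemB (zetaT lam0 T) (thetaT lam0 T) (Set.Ioc 0 T) (3 / 8) (5 / 4) (bil P M u v) ∧
    normB (zetaT lam0 T) (thetaT lam0 T) (Set.Ioc 0 T) (3 / 8) (5 / 4) (bil P M u v) ≤
      C₃ * (1 + lam0 ^ 2) * Real.exp (lam0 ^ 2 / 4) *
        normB (zetaT lam0 T) (thetaT lam0 T) (Set.Ioc 0 T) (3 / 8) (5 / 4) u *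
        normB (zetaT lam0 T) (thetaT lam0 T) (Set.Ioc 0 T) (3 / 8) (5 / 4) v

/-- `γ` is a bounding constant of `B` on `ℬ_{I,3/8,5/4}` (no weights), independent of
`I = ]0,T]`. -/
def IsBoundingConst (P : Space → Matrix (Fin 3) (Fin 3) ℂ) (M : Matrix (Fin 3) (Fin 3) ℝ)
    (γ : ℝ) : Prop :=
  0 ≤ γ ∧ ∀ T : ℝ, 0 < T → ∀ u v : ℝ → VecDist,
    MemB 0 0 (Set.Ioc 0 T) (3 / 8) (5 / 4) u → MemB 0 0 (Set.Ioc 0 T) (3 / 8) (5 / 4) v →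
    normB 0 0 (Set.Ioc 0 T) (3 / 8) (5 / 4) (bil P M u v) ≤
      γ * normB 0 0 (Set.Ioc 0 T) (3 / 8) (5 / 4) u * normB 0 0 (Set.Ioc 0 T) (3 / 8) (5 / 4) v

/-- `X` is the small global solution with data `u₀`: with `Y(t) = exp(-tA²)u₀`, for some `R` with
`|Y| ≤ R` and `4γR < 1` it is the solution of `X = Y + B(X,X)` in the ball of radius `2R` of
`ℬ_{]0,∞[,3/8,5/4}`. -/
def IsSmallSolution (P : Space → Matrix (Fin 3) (Fin 3) ℂ) (M : Matrix (Fin 3) (Fin 3) ℝ)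
    (u₀ : VecDist) (X : ℝ → VecDist) : Prop :=
  ∃ γ R : ℝ, IsBoundingConst P M γ ∧ 0 ≤ R ∧
    normB 0 0 (Set.Ioi 0) (3 / 8) (5 / 4) (fun t => heat t u₀) ≤ R ∧ 4 * γ * R < 1 ∧
    MemB 0 0 (Set.Ioi 0) (3 / 8) (5 / 4) X ∧ normB 0 0 (Set.Ioi 0) (3 / 8) (5 / 4) X ≤ 2 * R ∧
    ∀ t, 0 < t → X t = heat t u₀ + bil P M X X t

/-- `λ̄ ∈ ]0,∞]` is the critical parameter for `c = C₄ = 4 C₁ C₃ ‖A^{1/2}u₀‖`: it solves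
`c ⟨λ̄⟩² exp(λ̄²/4) = 1`, and `λ̄ = ∞` if `c = 0`. -/
def IsCritical (c : ℝ) (lamBar : EReal) : Prop :=
  (c = 0 ∧ lamBar = ⊤) ∨
    (c ≠ 0 ∧ ∃ l : ℝ, 0 < l ∧ lamBar = (l : EReal) ∧ c * (1 + l ^ 2) * Real.exp (l ^ 2 / 4) = 1)

/-- `G_r(t) = ‖A^r exp(λ₀ √t A) X(t)‖²`. -/
def G (lam0 r : ℝ) (X : ℝ → VecDist) (t : ℝ) : ℝ := ‖expA (lam0 * Real.sqrt t) r (X t)‖ ^ 2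

/-- `J_r(t) = ‖A^r X(t)‖²`. -/
def J (r : ℝ) (X : ℝ → VecDist) (t : ℝ) : ℝ := ‖expA 0 r (X t)‖ ^ 2

/-- Under the smallness condition `C₄ = 4 C₁ C₃ ‖A^{1/2}u₀‖ < 1`, `X` is the small global solution
with data `u₀ ∈ (Ḣ^{1/2})³` and `λ₀ ∈ ]0,λ̄[`. -/
structure Setting (P : Space → Matrix (Fin 3) (Fin 3) ℂ) (M : Matrix (Fin 3) (Fin 3) ℝ)
    (C₁ C₃ : ℝ) (u₀ : VecDist) (X : ℝ → VecDist) (lamBar : EReal) (lam0 : ℝ) : Prop where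
  data : MemHdot (1 / 2) u₀
  small : 4 * C₁ * C₃ * normHdot (1 / 2) u₀ < 1
  solution : IsSmallSolution P M u₀ X
  critical : IsCritical (4 * C₁ * C₃ * normHdot (1 / 2) u₀) lamBar
  pos : 0 < lam0
  lt : (lam0 : EReal) < lamBar

/-- `G' ≤ -κ t⁻¹ G + K t⁻¹ J` on `]0,∞[`, and the integrated form
`G(t) ≤ K t^{-κ} ∫₀ᵗ s^{κ-1} J(s) ds`. -/
def DiffIneq (κ K : ℝ) (G J : ℝ → ℝ) : Prop :=
  ∀ t : ℝ, 0 < t →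
    (DifferentiableAt ℝ G t ∧ deriv G t ≤ -κ * t⁻¹ * G t + K * t⁻¹ * J t) ∧
    (IntervalIntegrable (fun s => s ^ (κ - 1) * J s) volume 0 t ∧
      G t ≤ K * t ^ (-κ) * ∫ s in (0 : ℝ)..t, s ^ (κ - 1) * J s)

end NavierStokes

end

/-! ### Functions, square integrable classes and their Fourier transforms. -/

noncomputable section

namespace NavierStokes

/-! ### Distributions which are functions -/

/-! Everything happens on the Fourier side, where the solution is the heat factor times the data
minus the Duhamel integral `duh` of the transformed forcing `forc`, and where A is multiplication by
`symA`.

The two bounds. For α + β = 3/2 with α, β < 3/2, the L² norm of a convolution is at most C times the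
product of the L² norms weighted by |ξ|^α and |ξ|^β (`lintegral_convolution_sq_le`). The triangle
inequality makes exp(θ|ξ|) submultiplicative, so the exponential weight passes through the
nonlinearity (`eLpNorm_nl_le`). The function θ(t) = λ₀t/√T = μt is linear in time. Hence the weight
at time t is the weight at time s times exp(μ(t-s)|ξ|), and the heat factor over t - s absorbs the
latter at the price exp(μ²(t-s)/4), found by completing the square (`rpow_mul_exp_le`). The time
integrals left over are beta integrals.

Analyticity. If λ₀ < λ̄, the Picard iterates stay in a fixed ball of the weighted space for every T
(`picard_bound`). In the unweighted space they converge to X by contraction (`tendsto_picard`), so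
by Fatou X inherits the weighted bound. Taken at the endpoint T = t, where θ = λ₀√t, this says that
A^{5/4} exp(λ₀√t A)X(t) is O(t^{-3/8}) (`solution_bound`). The structure `Regular` records the
consequences, with a constant that depends on the data only through the smallness condition.

Differential inequality. Since λ₀ may be enlarged to some l < λ̄, the surplus weight exp((l-λ₀)√t A)
pays for any number of derivatives, and W = A^r exp(λ₀√t A)X is differentiable in time
(`Regular.hasDerivAt_hatW`). In G' the linear part contributes λ₀y - 2y² with y = √t|ξ|, up to the
factor t⁻¹. The scale invariant bound A^{7/4}X = O(t^{-5/8}) and Young's inequality bound the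
nonlinear part by c(y^{3/2} + 1). The sum is at most -κ + K exp(-2λ₀y): the negative square wins at
high frequency, and at low frequency the exponential is bounded below. As exp(-2λ₀y) removes the
weight from |W|², this is the claimed inequality (`exists_poly_le`, `exists_deriv_bound`). The
integrating factor t^κ gives the integrated form (`diffIneq_of`).

Decay. With κ larger than the rate, the integrated form carries decay of J to G (`DiffIneq.isBigO`).
Using it with the larger weight l and trading the surplus for powers of A gives all higher r
(`Setting.isBigO`). If J₀ is only bounded, this makes the forcing O(t^{-5/4}) in L², hence
integrable in time. Then X(t) tends to 0 in L² by dominated convergence, and averaging carries this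
over to G₀ (`Setting.tendsto_G_zero`). -/

theorem IsFun.locallyIntegrable {T : VecDist} {f : Space → Vec} (h : IsFun T f) :
    LocallyIntegrable f volume := by
  intro x
  let b : ContDiffBump x := ⟨1, 2, one_pos, one_lt_two⟩
  have hg₁ : HasCompactSupport (Complex.ofRealCLM ∘ b) := b.hasCompactSupport.comp_left rfl
  have hg₂ : ContDiff ℝ ((⊤ : ℕ∞) : WithTop ℕ∞) (Complex.ofRealCLM ∘ b) :=
    Complex.ofRealCLM.contDiff.comp b.contDiff
  refine ⟨Metric.closedBall x 1, Metric.closedBall_mem_nhds x one_pos, ?_⟩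
  refine ((h.2 (hg₁.toSchwartzMap hg₂)).1.integrableOn (s := Metric.closedBall x 1)).congr_fun
    (fun y hy => ?_) measurableSet_closedBall
  have : b y = 1 := b.one_of_mem_closedBall hy
  simp [this]

theorem IsFun.ae_eq {T : VecDist} {f g : Space → Vec} (hf : IsFun T f) (hg : IsFun T g) :
    f =ᵐ[volume] g := by
  refine ae_eq_of_integral_contDiff_smul_eq hf.locallyIntegrable hg.locallyIntegrable ?_
  intro φ hφ hc
  have hg₁ : HasCompactSupport (Complex.ofRealCLM ∘ φ) := hc.comp_left rfl
  have hg₂ : ContDiff ℝ ((⊤ : ℕ∞) : WithTop ℕ∞) (Complex.ofRealCLM ∘ φ) := by fun_prop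
  have := ((hf.2 (hg₁.toSchwartzMap hg₂)).2).symm.trans (hg.2 (hg₁.toSchwartzMap hg₂)).2
  simpa using this

theorem IsFun.toFun_ae_eq {T : VecDist} {f : Space → Vec} (h : IsFun T f) :
    toFun T =ᵐ[volume] f := by
  have hex : ∃ f, IsFun T f := ⟨f, h⟩
  rw [toFun, dif_pos hex]
  exact hex.choose_spec.ae_eq h

theorem isFun_toFun {T : VecDist} (h : ∃ f, IsFun T f) : IsFun T (toFun T) := by
  rw [toFun, dif_pos h]
  exact h.choose_spec

theorem IsFun.congr {T : VecDist} {f g : Space → Vec} (h : IsFun T f) (hfg : f =ᵐ[volume] g) :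
    IsFun T g := by
  have (φ : 𝓢(Space, ℂ)) : (fun x => φ x • f x) =ᵐ[volume] fun x => φ x • g x := by
    filter_upwards [hfg] with x hx using by rw [hx]
  exact ⟨h.1.congr hfg, fun φ => ⟨(h.2 φ).1.congr (this φ),
    (h.2 φ).2.trans (integral_congr_ae (this φ))⟩⟩

theorem IsFun.add {T S : VecDist} {f g : Space → Vec} (hf : IsFun T f) (hg : IsFun S g) :
    IsFun (T + S) (fun x => f x + g x) := by
  refine ⟨hf.1.add hg.1, fun φ => ?_⟩
  simp only [smul_add]
  refine ⟨(hf.2 φ).1.add (hg.2 φ).1, ?_⟩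
  rw [integral_add (hf.2 φ).1 (hg.2 φ).1, ← (hf.2 φ).2, ← (hg.2 φ).2]
  rfl

theorem IsFun.const_smul {T : VecDist} {f : Space → Vec} (c : ℂ) (hf : IsFun T f) :
    IsFun (c • T) (fun x => c • f x) := by
  refine ⟨hf.1.const_smul c, fun φ => ?_⟩
  have (x : Space) : φ x • c • f x = c • φ x • f x := smul_comm _ _ _
  simp only [this]
  refine ⟨(hf.2 φ).1.smul c, ?_⟩
  rw [integral_smul, ← (hf.2 φ).2]
  rfl

theorem IsFun.sub {T S : VecDist} {f g : Space → Vec} (hf : IsFun T f) (hg : IsFun S g) :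
    IsFun (T - S) (fun x => f x - g x) := by
  have := hf.add (hg.const_smul (-1))
  have h1 : T + (-1 : ℂ) • S = T - S := by
    ext φ : 1
    change T φ + (-1 : ℂ) • S φ = T φ - S φ
    rw [neg_smul, one_smul, sub_eq_add_neg]
  rw [h1] at this
  simpa [sub_eq_add_neg] using this

theorem isFun_toTemperedDistribution (f : VecL2) : IsFun (Lp.toTemperedDistribution f) f := by
  refine ⟨Lp.aestronglyMeasurable f, fun φ => ⟨?_, by simp⟩⟩
  have h1 := (Lp.memLp f).smul (φ.memLp 2 volume) (r := 1)
  exact memLp_one_iff_integrable.1 h1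

theorem IsFun.smulLeft {T : VecDist} {f : Space → Vec} {m : Space → ℂ}
    (hm : m.HasTemperateGrowth) (hf : IsFun T f) :
    IsFun (TemperedDistribution.smulLeftCLM Vec m T) (fun x => m x • f x) := by
  refine ⟨hm.1.continuous.aestronglyMeasurable.smul hf.1, fun φ => ?_⟩
  have h := hf.2 (SchwartzMap.smulLeftCLM ℂ m φ)
  have (x : Space) : (SchwartzMap.smulLeftCLM ℂ m φ) x • f x = φ x • m x • f x := by
    rw [SchwartzMap.smulLeftCLM_apply_apply hm, smul_smul, smul_eq_mul, mul_comm]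
  simp only [this] at h
  exact ⟨h.1, by rw [TemperedDistribution.smulLeftCLM_apply_apply]; exact h.2⟩

/-! ### Square integrable classes -/

theorem classL2_of_memLp {g : Space → Vec} (h : MemLp g 2 volume) : classL2 g = h.toLp g :=
  dif_pos h

theorem coeFn_classL2 {g : Space → Vec} (h : MemLp g 2 volume) : classL2 g =ᵐ[volume] g := by
  rw [classL2_of_memLp h]
  exact h.coeFn_toLp

theorem classL2_congr {f g : Space → Vec} (h : f =ᵐ[volume] g) : classL2 f = classL2 g := by
  by_cases hf : MemLp f 2 volume
  · rw [classL2_of_memLp hf, classL2_of_memLp ((memLp_congr_ae h).1 hf), MemLp.toLp_eq_toLp_iff]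
    exact h
  · rw [classL2, classL2, dif_neg hf, dif_neg (fun hg => hf ((memLp_congr_ae h).2 hg))]

theorem classL2_coeFn (f : VecL2) : classL2 f = f := by
  rw [classL2_of_memLp (Lp.memLp f), Lp.toLp_coeFn]

theorem eq_classL2 {f : VecL2} {g : Space → Vec} (h : f =ᵐ[volume] g) : f = classL2 g := by
  rw [← classL2_coeFn f, classL2_congr h]

theorem norm_classL2 {g : Space → Vec} (h : MemLp g 2 volume) :
    ‖classL2 g‖ = (eLpNorm g 2 volume).toReal := by
  rw [classL2_of_memLp h, Lp.norm_toLp]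

theorem enorm_classL2 {g : Space → Vec} (h : MemLp g 2 volume) :
    ‖classL2 g‖ₑ = eLpNorm g 2 volume := by
  rw [classL2_of_memLp h, Lp.enorm_toLp]

theorem classL2_add {f g : Space → Vec} (hf : MemLp f 2 volume) (hg : MemLp g 2 volume) :
    classL2 (fun x => f x + g x) = classL2 f + classL2 g := by
  rw [classL2_of_memLp hf, classL2_of_memLp hg, ← MemLp.toLp_add hf hg,
    ← classL2_of_memLp (hf.add hg)]
  rfl

theorem classL2_sub {f g : Space → Vec} (hf : MemLp f 2 volume) (hg : MemLp g 2 volume) :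
    classL2 (fun x => f x - g x) = classL2 f - classL2 g := by
  rw [classL2_of_memLp hf, classL2_of_memLp hg, ← MemLp.toLp_sub hf hg,
    ← classL2_of_memLp (hf.sub hg)]
  rfl

theorem classL2_smul {f : Space → Vec} (c : ℝ) (hf : MemLp f 2 volume) :
    classL2 (fun x => c • f x) = c • classL2 f := by
  rw [classL2_of_memLp hf, ← MemLp.toLp_const_smul c hf, ← classL2_of_memLp (hf.const_smul c)]
  rfl

/-! ### Fourier transforms of distributions and functions -/

theorem isFun_of_memLp_two {f : Space → Vec} (hf : MemLp f 2 volume) :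
    IsFun (Lp.toTemperedDistribution (classL2 f)) f :=
  (isFun_toTemperedDistribution _).congr (coeFn_classL2 hf)

/-- The Fourier transform of `T` as a function. -/
def hat (T : VecDist) : Space → Vec := toFun (𝓕 T)

/-- Fubini for the Fourier kernel, applied to the reflection of g to pass from the transform to its
inverse. It identifies the distributional inverse transform of an integrable function. -/
theorem integral_fourierInv_smul {φ : 𝓢(Space, ℂ)} {g : Space → Vec} (hg : Integrable g volume) :
    ∫ ξ, (𝓕⁻ φ) ξ • g ξ = ∫ x, φ x • 𝓕⁻ g x := by
  have h := VectorFourier.integral_fourierIntegral_smul_eq_flip (L := innerₗ Space)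
      (μ := (volume : Measure Space)) (ν := (volume : Measure Space))
      Real.continuous_fourierChar continuous_inner φ.integrable (hg.comp_neg)
  have h1 : ∀ ξ, VectorFourier.fourierIntegral Real.fourierChar volume (innerₗ Space) φ ξ =
    𝓕 (φ : Space → ℂ) ξ := fun ξ => rfl
  have h2 : ∀ x, VectorFourier.fourierIntegral Real.fourierChar volume (innerₗ Space).flip
      (fun ξ => g (-ξ)) x = 𝓕⁻ g x := by
    intro x
    rw [Real.fourierInv_eq_fourier_comp_neg, flip_innerₗ]
    rfl
  simp only [h1, h2] at h
  rw [← h, ← integral_neg_eq_self]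
  refine integral_congr_ae (ae_of_all _ fun ξ => ?_)
  simp only
  rw [SchwartzMap.fourierInv_coe, Real.fourierInv_eq_fourier_neg, neg_neg]

theorem continuous_fourierInv {g : Space → Vec} (hg : Integrable g volume) :
    Continuous (𝓕⁻ g) := by
  rw [Real.fourierInv_eq_fourier_comp_neg]
  exact VectorFourier.fourierIntegral_continuous Real.continuous_fourierChar
    (by exact continuous_inner) hg.comp_neg

theorem norm_fourierInv_le {g : Space → Vec} (x : Space) : ‖𝓕⁻ g x‖ ≤ ∫ ξ, ‖g ξ‖ := by
  rw [Real.fourierInv_eq]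
  refine (norm_integral_le_integral_norm _).trans (le_of_eq ?_)
  simp

/-- Elements of a homogeneous Sobolev space need not be square integrable, and their transforms need
not be integrable. Cutting the transform into low and high frequencies gives one piece of each kind.
The pieces are inverted separately, so the distribution is again a function. -/
theorem isFun_of_fourier_eq_add {T : VecDist} {f g : Space → Vec} (hf : Integrable f volume)
    (hg : MemLp g 2 volume) (h : IsFun (𝓕 T) (fun ξ => f ξ + g ξ)) :
    IsFun T (fun x => 𝓕⁻ f x + (𝓕⁻ (classL2 g) : VecL2) x) := by
  have hG := isFun_toTemperedDistribution (𝓕⁻ (classL2 g))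
  have hi (φ : 𝓢(Space, ℂ)) : Integrable (fun x => φ x • 𝓕⁻ f x) volume := by
    refine (φ.integrable (μ := volume)).smul_bdd (∫ ξ, ‖f ξ‖)
      (continuous_fourierInv hf).aestronglyMeasurable (ae_of_all _ fun x => ?_)
    exact norm_fourierInv_le x
  refine ⟨(continuous_fourierInv hf).aestronglyMeasurable.add hG.1, fun φ => ?_⟩
  simp only [smul_add]
  refine ⟨(hi φ).add (hG.2 φ).1, ?_⟩
  rw [integral_add (hi φ) (hG.2 φ).1, ← (hG.2 φ).2,
    ← Lp.fourierInv_toTemperedDistribution_eq, TemperedDistribution.fourierInv_apply,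
    ← integral_fourierInv_smul hf]
  have h1 : T φ = 𝓕 T (𝓕⁻ φ) := by
    rw [TemperedDistribution.fourier_apply, FourierTransform.fourier_fourierInv_eq]
  have hg2 := ((isFun_of_memLp_two hg).2 (𝓕⁻ φ))
  have hf2 : Integrable (fun x => (𝓕⁻ φ) x • f x) volume := by
    refine hf.bdd_smul ((SchwartzMap.seminorm ℝ 0 0) (𝓕⁻ φ))
      (𝓕⁻ φ).continuous.aestronglyMeasurable (ae_of_all _ fun x => ?_)
    exact SchwartzMap.norm_le_seminorm ℝ (𝓕⁻ φ) x
  rw [h1, (h.2 (𝓕⁻ φ)).2, hg2.2, ← integral_add hf2 hg2.1]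
  simp only [smul_add]

/-- The Plancherel inverse and the integral inverse represent the same tempered distribution. -/
theorem fourierInv_classL2_ae_eq {h : Space → Vec} (h1 : Integrable h volume)
    (h2 : MemLp h 2 volume) : (𝓕⁻ (classL2 h) : VecL2) =ᵐ[volume] 𝓕⁻ h := by
  have h3 := isFun_toTemperedDistribution (𝓕⁻ (classL2 h))
  rw [← Lp.fourierInv_toTemperedDistribution_eq] at h3
  refine h3.ae_eq ?_
  have h4 : IsFun (𝓕 (𝓕⁻ (Lp.toTemperedDistribution (classL2 h)))) (fun ξ => h ξ + (0 : Space → Vec) ξ) := by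
    rw [FourierTransform.fourier_fourierInv_eq]
    simpa using isFun_of_memLp_two h2
  have h5 := isFun_of_fourier_eq_add h1 MemLp.zero h4
  refine h5.congr ?_
  have h6 : classL2 (0 : Space → Vec) = 0 := by
    rw [classL2_of_memLp MemLp.zero]; rfl
  have h7 : (𝓕⁻ (0 : VecL2)) = 0 := by
    have := (Lp.fourierTransformₗᵢ Space Vec).symm.map_zero
    exact this
  rw [h6, h7]
  filter_upwards [Lp.coeFn_zero Vec 2 (volume : Measure Space)] with x hx
  rw [hx]; simp

theorem norm_fourierInv (f : VecL2) : ‖(𝓕⁻ f : VecL2)‖ = ‖f‖ :=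
  (Lp.fourierTransformₗᵢ Space Vec).symm.norm_map f

end NavierStokes

/-! ### Bounded Fourier multipliers on L² and frequency truncation. -/

namespace NavierStokes

/-! ### Dominated convergence and bounded multipliers in `L²` -/

theorem norm_classL2_sq {g : Space → Vec} (h : MemLp g 2 volume) :
    ‖classL2 g‖ ^ 2 = ∫ ξ, ‖g ξ‖ ^ 2 := by
  have h1 : ‖classL2 g‖ ^ 2 = inner ℝ (classL2 g) (classL2 g) := by
    rw [real_inner_self_eq_norm_sq]
  rw [h1, L2.inner_def]
  refine integral_congr_ae ?_
  filter_upwards [coeFn_classL2 h] with ξ hξ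
  rw [hξ, real_inner_self_eq_norm_sq]

theorem tendsto_classL2_of_dominated {ι : Type*} {l : Filter ι} [l.IsCountablyGenerated]
    {F : ι → Space → Vec} {f : Space → Vec} {b : Space → ℝ}
    (hF : ∀ᶠ i in l, AEStronglyMeasurable (F i) volume) (hf : AEStronglyMeasurable f volume)
    (hFb : ∀ᶠ i in l, ∀ᵐ ξ, ‖F i ξ‖ ≤ b ξ) (hfb : ∀ᵐ ξ, ‖f ξ‖ ≤ b ξ) (hb : MemLp b 2 volume)
    (hlim : ∀ᵐ ξ, Tendsto (fun i => F i ξ) l (𝓝 (f ξ))) :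
    Tendsto (fun i => classL2 (F i)) l (𝓝 (classL2 f)) := by
  have hfm : MemLp f 2 volume := hb.mono' hf hfb
  rw [tendsto_iff_norm_sub_tendsto_zero]
  have key : Tendsto (fun i => ∫ ξ, ‖F i ξ - f ξ‖ ^ 2) l (𝓝 (∫ _ : Space, (0 : ℝ))) := by
    refine tendsto_integral_filter_of_dominated_convergence (fun ξ => 4 * b ξ ^ 2) ?_ ?_ ?_ ?_
    · filter_upwards [hF] with i hi using ((hi.sub hf).norm.pow 2)
    · filter_upwards [hFb] with i hi
      filter_upwards [hi, hfb] with ξ h1 h2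
      rw [Real.norm_of_nonneg (by positivity)]
      have h3 : ‖F i ξ - f ξ‖ ≤ 2 * b ξ := (norm_sub_le _ _).trans (by linarith)
      nlinarith [norm_nonneg (F i ξ - f ξ)]
    · exact (hb.integrable_sq).const_mul 4
    · filter_upwards [hlim] with ξ hξ
      have : Tendsto (fun i => ‖F i ξ - f ξ‖ ^ 2) l (𝓝 (‖f ξ - f ξ‖ ^ 2)) :=
        ((hξ.sub_const _).norm.pow 2)
      simpa using this
  rw [integral_zero] at key
  have h2 : Tendsto (fun i => Real.sqrt (∫ ξ, ‖F i ξ - f ξ‖ ^ 2)) l (𝓝 0) := by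
    simpa [Function.comp_def] using (Real.continuous_sqrt.tendsto 0).comp key
  refine h2.congr' ?_
  filter_upwards [hF, hFb] with i h3 h4
  have h5 : MemLp (F i) 2 volume := hb.mono' h3 h4
  have h6 : MemLp (fun ξ => F i ξ - f ξ) 2 volume := h5.sub hfm
  rw [← classL2_sub h5 hfm, ← norm_classL2_sq h6, Real.sqrt_sq (norm_nonneg _)]

/-- Bounded measurable multipliers. -/
def IsMul (m : Space → ℝ) : Prop := Measurable m ∧ ∃ C, ∀ ξ, |m ξ| ≤ C

theorem IsMul.memLp {m : Space → ℝ} (h : IsMul m) {f : Space → Vec} (hf : MemLp f 2 volume) :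
    MemLp (fun ξ => m ξ • f ξ) 2 volume := by
  obtain ⟨hm, C, hC⟩ := h
  exact hf.smul (memLp_top_of_bound hm.aestronglyMeasurable C (ae_of_all _ hC)) (r := 2)

theorem eLpNorm_smul_le {m : Space → ℝ} {C : ℝ} (hC : ∀ ξ, |m ξ| ≤ C) (f : Space → Vec) :
    eLpNorm (fun ξ => m ξ • f ξ) 2 volume ≤ ENNReal.ofReal C * eLpNorm f 2 volume := by
  refine eLpNorm_le_mul_eLpNorm_of_ae_le_mul (ae_of_all _ fun ξ => ?_) 2
  rw [norm_smul]
  exact mul_le_mul_of_nonneg_right (hC ξ) (norm_nonneg _)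

theorem norm_classL2_smul_le {m : Space → ℝ} {C : ℝ} (hm : Measurable m) (hC : ∀ ξ, |m ξ| ≤ C)
    (f : VecL2) : ‖classL2 (fun ξ => m ξ • f ξ)‖ ≤ C * ‖f‖ := by
  have h0 : 0 ≤ C := (abs_nonneg _).trans (hC 0)
  rw [norm_classL2 (IsMul.memLp ⟨hm, C, hC⟩ (Lp.memLp f)), Lp.norm_def]
  rw [← ENNReal.toReal_ofReal h0, ← ENNReal.toReal_mul]
  exact ENNReal.toReal_mono (ENNReal.mul_ne_top ENNReal.ofReal_ne_top (Lp.memLp f).2.ne)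
    (eLpNorm_smul_le hC f)

open Classical in
/-- Multiplication with a bounded measurable function. -/
def mulCLM (m : Space → ℝ) : VecL2 →L[ℝ] VecL2 :=
  if h : IsMul m then
    LinearMap.mkContinuous
      { toFun := fun f => classL2 (fun ξ => m ξ • f ξ)
        map_add' := fun f g => by
          rw [← classL2_add (h.memLp (Lp.memLp f)) (h.memLp (Lp.memLp g))]
          refine classL2_congr ?_
          filter_upwards [Lp.coeFn_add f g] with ξ hξ
          rw [hξ, Pi.add_apply, smul_add]
        map_smul' := fun c f => by
          rw [RingHom.id_apply, ← classL2_smul c (h.memLp (Lp.memLp f))]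
          refine classL2_congr ?_
          filter_upwards [Lp.coeFn_smul c f] with ξ hξ
          rw [hξ, Pi.smul_apply, smul_comm] }
      h.2.choose (fun f => norm_classL2_smul_le h.1 h.2.choose_spec f)
  else 0

theorem mulCLM_apply {m : Space → ℝ} (h : IsMul m) (f : VecL2) :
    mulCLM m f = classL2 (fun ξ => m ξ • f ξ) := by
  rw [mulCLM, dif_pos h]
  rfl

theorem coeFn_mulCLM {m : Space → ℝ} (h : IsMul m) (f : VecL2) :
    mulCLM m f =ᵐ[volume] fun ξ => m ξ • f ξ := by
  rw [mulCLM_apply h]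
  exact coeFn_classL2 (h.memLp (Lp.memLp f))

theorem norm_mulCLM_apply_le {m : Space → ℝ} {C : ℝ} (hm : Measurable m) (hC : ∀ ξ, |m ξ| ≤ C)
    (f : VecL2) : ‖mulCLM m f‖ ≤ C * ‖f‖ := by
  rw [mulCLM_apply ⟨hm, C, hC⟩]
  exact norm_classL2_smul_le hm hC f

theorem IsMul.mul {m n : Space → ℝ} (hm : IsMul m) (hn : IsMul n) :
    IsMul (fun ξ => m ξ * n ξ) := by
  obtain ⟨hm, C, hC⟩ := hm
  obtain ⟨hn, D, hD⟩ := hn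
  refine ⟨hm.mul hn, C * D, fun ξ => ?_⟩
  rw [abs_mul]
  exact mul_le_mul (hC ξ) (hD ξ) (abs_nonneg _) ((abs_nonneg _).trans (hC ξ))

theorem mulCLM_mulCLM {m n : Space → ℝ} (hm : IsMul m) (hn : IsMul n) (f : VecL2) :
    mulCLM m (mulCLM n f) = mulCLM (fun ξ => m ξ * n ξ) f := by
  rw [mulCLM_apply hm, mulCLM_apply (hm.mul hn)]
  refine classL2_congr ?_
  filter_upwards [coeFn_mulCLM hn f] with ξ hξ
  rw [hξ, smul_smul]

theorem tendsto_mulCLM_const {ι : Type*} {l : Filter ι} [l.IsCountablyGenerated]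
    {m : ι → Space → ℝ} {m₀ : Space → ℝ} {C : ℝ} (hm : ∀ᶠ i in l, Measurable (m i))
    (hm₀ : Measurable m₀) (hC : ∀ᶠ i in l, ∀ ξ, |m i ξ| ≤ C) (hC₀ : ∀ ξ, |m₀ ξ| ≤ C)
    (hlim : ∀ ξ, Tendsto (fun i => m i ξ) l (𝓝 (m₀ ξ))) (f : VecL2) :
    Tendsto (fun i => mulCLM (m i) f) l (𝓝 (mulCLM m₀ f)) := by
  have h : Tendsto (fun i => classL2 (fun ξ => m i ξ • f ξ)) l
      (𝓝 (classL2 (fun ξ => m₀ ξ • f ξ))) := by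
    refine tendsto_classL2_of_dominated (b := fun ξ => C * ‖f ξ‖) ?_ ?_ ?_ ?_ ?_ ?_
    · filter_upwards [hm] with i hi using hi.aestronglyMeasurable.smul (Lp.aestronglyMeasurable f)
    · exact hm₀.aestronglyMeasurable.smul (Lp.aestronglyMeasurable f)
    · filter_upwards [hC] with i hi
      refine ae_of_all _ fun ξ => ?_
      rw [norm_smul]
      exact mul_le_mul_of_nonneg_right (hi ξ) (norm_nonneg _)
    · refine ae_of_all _ fun ξ => ?_
      rw [norm_smul]
      exact mul_le_mul_of_nonneg_right (hC₀ ξ) (norm_nonneg _)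
    · exact (Lp.memLp f).norm.const_mul C
    · exact ae_of_all _ fun ξ => (hlim ξ).smul_const _
  rw [mulCLM_apply ⟨hm₀, C, hC₀⟩]
  refine h.congr' ?_
  filter_upwards [hm, hC] with i h1 h2
  rw [mulCLM_apply ⟨h1, C, h2⟩]

/-- Pointwise convergence of multipliers gives strong convergence only, not convergence in norm. The
uniform bound on the multipliers lets the vector vary as well. -/
theorem tendsto_mulCLM {ι : Type*} {l : Filter ι} [l.IsCountablyGenerated]
    {m : ι → Space → ℝ} {m₀ : Space → ℝ} {C : ℝ} (hm : ∀ᶠ i in l, Measurable (m i))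
    (hm₀ : Measurable m₀) (hC : ∀ᶠ i in l, ∀ ξ, |m i ξ| ≤ C) (hC₀ : ∀ ξ, |m₀ ξ| ≤ C)
    (hlim : ∀ ξ, Tendsto (fun i => m i ξ) l (𝓝 (m₀ ξ))) {f : ι → VecL2} {f₀ : VecL2}
    (hf : Tendsto f l (𝓝 f₀)) :
    Tendsto (fun i => mulCLM (m i) (f i)) l (𝓝 (mulCLM m₀ f₀)) := by
  have h1 : Tendsto (fun i => mulCLM (m i) (f i - f₀)) l (𝓝 0) := by
    have h2 : Tendsto (fun i => C * ‖f i - f₀‖) l (𝓝 0) := by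
      simpa using (tendsto_iff_norm_sub_tendsto_zero.1 hf).const_mul C
    refine squeeze_zero_norm' ?_ h2
    filter_upwards [hm, hC] with i h3 h4 using norm_mulCLM_apply_le h3 h4 _
  have h3 := h1.add (tendsto_mulCLM_const hm hm₀ hC hC₀ hlim f₀)
  simpa using h3

/-- The product rule: the difference quotient splits into the slope of m acting on V(t) and m(s)
acting on the slope of V. By the mean value inequality the slopes of m are bounded uniformly in the
frequency, so dominated convergence applies to the first part. -/
theorem hasDerivAt_mulCLM {m : ℝ → Space → ℝ} {m' : ℝ → Space → ℝ} {t : ℝ} {C : ℝ}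
    (hm : ∀ s, Measurable (m s)) (hm' : ∀ s, Measurable (m' s))
    (hC : ∀ᶠ s in 𝓝 t, ∀ ξ, |m s ξ| ≤ C) (hC' : ∀ᶠ s in 𝓝 t, ∀ ξ, |m' s ξ| ≤ C)
    (hd : ∀ᶠ s in 𝓝 t, ∀ ξ, HasDerivAt (fun s => m s ξ) (m' s ξ) s)
    {V : ℝ → VecL2} {V' : VecL2} (hV : HasDerivAt V V' t) :
    HasDerivAt (fun s => mulCLM (m s) (V s)) (mulCLM (m' t) (V t) + mulCLM (m t) V') t := by
  rw [hasDerivAt_iff_tendsto_slope]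
  obtain ⟨ε, hε, hball⟩ := Metric.eventually_nhds_iff_ball.1 (hC'.and hd)
  have hCt := hC.self_of_nhds
  have hCt' := hC'.self_of_nhds
  have hle : 𝓝[≠] t ≤ 𝓝 t := nhdsWithin_le_nhds
  have hslope : ∀ᶠ s in 𝓝[≠] t, ∀ ξ, |slope (fun s => m s ξ) t s| ≤ C := by
    have h1 : ∀ᶠ s in 𝓝[≠] t, s ∈ Metric.ball t ε := hle (Metric.ball_mem_nhds t hε)
    filter_upwards [h1, self_mem_nhdsWithin] with s hs hne ξ
    have h2 := (convex_ball t ε).norm_image_sub_le_of_norm_hasDerivWithin_le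
      (f := fun s => m s ξ) (f' := fun s => m' s ξ) (C := C) (x := t) (y := s)
      (fun x hx => ((hball x hx).2 ξ).hasDerivWithinAt) (fun x hx => (hball x hx).1 ξ)
      (Metric.mem_ball_self hε) hs
    rw [slope_def_field, abs_div]
    have h3 : 0 < |s - t| := abs_pos.2 (sub_ne_zero.2 hne)
    rw [div_le_iff₀ h3]
    exact h2
  have hA : Tendsto (fun s => mulCLM (fun ξ => slope (fun s => m s ξ) t s) (V t)) (𝓝[≠] t)
      (𝓝 (mulCLM (m' t) (V t))) := by
    refine tendsto_mulCLM_const (C := C) ?_ (hm' t) hslope hCt' ?_ _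
    · refine Eventually.of_forall fun s => ?_
      simp only [slope_def_field]
      exact ((hm s).sub (hm t)).div_const _
    · intro ξ
      exact hasDerivAt_iff_tendsto_slope.1 ((hd.self_of_nhds) ξ)
  have hB : Tendsto (fun s => mulCLM (m s) (slope V t s)) (𝓝[≠] t) (𝓝 (mulCLM (m t) V')) := by
    refine tendsto_mulCLM (C := C) (Eventually.of_forall hm) (hm t) (hle hC) hCt ?_
      (hasDerivAt_iff_tendsto_slope.1 hV)
    intro ξ
    exact ((hd.self_of_nhds ξ).continuousAt.tendsto).mono_left hle
  refine (hA.add hB).congr' ?_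
  filter_upwards [hslope, hle hC] with s hs1 hs2
  have hIs : IsMul (m s) := ⟨hm s, C, hs2⟩
  have hIt : IsMul (m t) := ⟨hm t, C, hCt⟩
  have hsub : MemLp (fun ξ => m s ξ • V t ξ - m t ξ • V t ξ) 2 volume :=
    (hIs.memLp (Lp.memLp _)).sub (hIt.memLp (Lp.memLp _))
  have h1 : mulCLM (fun ξ => slope (fun s => m s ξ) t s) (V t) =
      (s - t)⁻¹ • (mulCLM (m s) (V t) - mulCLM (m t) (V t)) := by
    rw [mulCLM_apply hIs, mulCLM_apply hIt,
      ← classL2_sub (hIs.memLp (Lp.memLp _)) (hIt.memLp (Lp.memLp _)),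
      ← classL2_smul _ hsub, mulCLM_apply]
    · congr 1
      ext1 ξ
      rw [slope_def_module, smul_eq_mul, mul_smul, sub_smul]
    · refine ⟨?_, C, hs1⟩
      simp only [slope_def_field]
      exact ((hm s).sub (hm t)).div_const _
  rw [h1, slope_def_module, slope_def_module, map_smul, map_sub, ← smul_add]
  congr 1
  abel

/-! ### Frequency cut-offs -/

theorem symA_nonneg (ξ : Space) : 0 ≤ symA ξ := by unfold symA; positivity

theorem continuous_symA : Continuous symA := by unfold symA; fun_prop

theorem measurable_symA : Measurable symA := continuous_symA.measurable

/-- The frequency cut-off to `symA ξ ≤ n`. -/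
def chi (n : ℕ) (ξ : Space) : ℝ := Set.indicator {ξ | symA ξ ≤ n} 1 ξ

theorem measurable_chi (n : ℕ) : Measurable (chi n) :=
  measurable_one.indicator (measurableSet_le measurable_symA measurable_const)

theorem chi_of_le {n : ℕ} {ξ : Space} (h : symA ξ ≤ n) : chi n ξ = 1 :=
  Set.indicator_of_mem (s := {ξ | symA ξ ≤ n}) h _

theorem chi_of_lt {n : ℕ} {ξ : Space} (h : n < symA ξ) : chi n ξ = 0 :=
  Set.indicator_of_notMem (s := {ξ | symA ξ ≤ n}) (not_le.2 h) _

theorem chi_eq_or (n : ℕ) (ξ : Space) : (symA ξ ≤ n ∧ chi n ξ = 1) ∨ (n < symA ξ ∧ chi n ξ = 0) := by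
  rcases le_or_gt (symA ξ) n with h | h
  · exact Or.inl ⟨h, chi_of_le h⟩
  · exact Or.inr ⟨h, chi_of_lt h⟩

theorem abs_chi_le (n : ℕ) (ξ : Space) : |chi n ξ| ≤ 1 := by
  rcases chi_eq_or n ξ with h | h <;> simp [h.2]

theorem isMul_chi (n : ℕ) : IsMul (chi n) := ⟨measurable_chi n, 1, abs_chi_le n⟩

theorem tendsto_chi (ξ : Space) : Tendsto (fun n : ℕ => chi n ξ) atTop (𝓝 1) := by
  refine tendsto_const_nhds.congr' ?_
  filter_upwards [eventually_ge_atTop ⌈symA ξ⌉₊] with n hn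
  exact (chi_of_le ((Nat.le_ceil _).trans (by exact_mod_cast hn))).symm

theorem tendsto_mulCLM_chi (f : VecL2) : Tendsto (fun n => mulCLM (chi n) f) atTop (𝓝 f) := by
  have h := tendsto_mulCLM_const (l := atTop) (m := chi) (m₀ := fun _ => 1) (C := 1)
    (Eventually.of_forall measurable_chi) measurable_const (Eventually.of_forall abs_chi_le)
    (by simp) tendsto_chi f
  rwa [mulCLM_apply ⟨measurable_const, 1, by simp⟩, show (fun ξ => (1 : ℝ) • f ξ) = f by
    ext1 ξ; rw [one_smul], classL2_coeFn] at h

/-- Fatou's lemma. It reduces estimates with unbounded weights to bounded frequencies, where the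
weights are bounded operators. -/
theorem eLpNorm_le_of_chi {g : Space → Vec} (hg : AEStronglyMeasurable g volume) {B : ℝ≥0∞}
    (h : ∀ n, eLpNorm (fun ξ => chi n ξ • g ξ) 2 volume ≤ B) : eLpNorm g 2 volume ≤ B := by
  have h1 := Lp.eLpNorm_lim_le_liminf_eLpNorm (p := 2) (μ := (volume : Measure Space))
    (f := fun n ξ => chi n ξ • g ξ)
    (fun n => (measurable_chi n).aestronglyMeasurable.smul hg) g
    (ae_of_all _ fun ξ => by simpa using (tendsto_chi ξ).smul_const (g ξ))
  refine h1.trans ?_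
  refine (liminf_le_liminf (Eventually.of_forall h)).trans ?_
  simp

/-- Measurable multipliers which are bounded on bounded frequencies. -/
def IsLocMul (m : Space → ℝ) : Prop := Measurable m ∧ ∀ n : ℕ, ∃ C, ∀ ξ, symA ξ ≤ n → |m ξ| ≤ C

theorem IsLocMul.isMul {m : Space → ℝ} (h : IsLocMul m) (n : ℕ) :
    IsMul (fun ξ => chi n ξ * m ξ) := by
  obtain ⟨C, hC⟩ := h.2 n
  refine ⟨(measurable_chi n).mul h.1, max C 0, fun ξ => ?_⟩
  rcases chi_eq_or n ξ with h | h
  · simp only [h.2, one_mul]; exact (hC ξ h.1).trans (le_max_left _ _)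
  · simp [h.2]

theorem eq_of_chi {f g : VecL2} (h : ∀ n, mulCLM (chi n) f = mulCLM (chi n) g) : f = g :=
  tendsto_nhds_unique (tendsto_mulCLM_chi f) (by simpa only [h] using tendsto_mulCLM_chi g)

theorem mulCLM_chi_mul {m : Space → ℝ} (hm : IsLocMul m) {f : VecL2}
    (h : MemLp (fun ξ => m ξ • f ξ) 2 volume) (n : ℕ) :
    mulCLM (chi n) (classL2 (fun ξ => m ξ • f ξ)) = mulCLM (fun ξ => chi n ξ * m ξ) f := by
  rw [mulCLM_apply (isMul_chi n), mulCLM_apply (hm.isMul n)]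
  refine classL2_congr ?_
  filter_upwards [coeFn_classL2 h] with ξ hξ
  rw [hξ, smul_smul]

/-! ### Multipliers and Bochner integrals -/

/-- An unbounded multiplier cannot be pulled through a Bochner integral directly. Its truncation by
`chi n` is a bounded operator and can; the truncation is removed by Fatou. -/
theorem eLpNorm_smul_intervalIntegral_le {m : Space → ℝ} (hm : IsLocMul m) {h : ℝ → VecL2}
    {a b : ℝ} (hab : a ≤ b) (hh : IntervalIntegrable h volume a b) {k : ℝ → ℝ}
    (hk : IntervalIntegrable k volume a b) (hk0 : ∀ s ∈ Set.Ioo a b, 0 ≤ k s)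
    (hb : ∀ s ∈ Set.Ioo a b, eLpNorm (fun ξ => m ξ • h s ξ) 2 volume ≤ ENNReal.ofReal (k s)) :
    eLpNorm (fun ξ => m ξ • (∫ s in a..b, h s : VecL2) ξ) 2 volume ≤
      ENNReal.ofReal (∫ s in a..b, k s) := by
  refine eLpNorm_le_of_chi (hm.1.aestronglyMeasurable.smul (Lp.aestronglyMeasurable _)) fun n => ?_
  have h1 : eLpNorm (fun ξ => chi n ξ • m ξ • (∫ s in a..b, h s : VecL2) ξ) 2 volume =
      ‖mulCLM (fun ξ => chi n ξ * m ξ) (∫ s in a..b, h s)‖ₑ := by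
    rw [mulCLM_apply (hm.isMul n), enorm_classL2 ((hm.isMul n).memLp (Lp.memLp _))]
    simp only [smul_smul]
  refine h1.trans_le ?_
  rw [← ContinuousLinearMap.intervalIntegral_comp_comm _ hh, ← ofReal_norm]
  refine ENNReal.ofReal_le_ofReal ?_
  refine intervalIntegral.norm_integral_le_of_norm_le hab ?_ hk
  -- The endpoint s = b is discarded because in the Duhamel integral no smoothing is left there.
  have h2 : ∀ᵐ s : ℝ, s ≠ b := by simp [ae_iff]
  filter_upwards [h2] with s hsb hs
  have hs' : s ∈ Set.Ioo a b := ⟨hs.1, lt_of_le_of_ne hs.2 hsb⟩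
  have h3 : ‖mulCLM (fun ξ => chi n ξ * m ξ) (h s)‖ₑ ≤ ENNReal.ofReal (k s) := by
    rw [mulCLM_apply (hm.isMul n), enorm_classL2 ((hm.isMul n).memLp (Lp.memLp _))]
    refine le_trans ?_ (hb s hs')
    refine eLpNorm_mono fun ξ => ?_
    rw [norm_smul, norm_smul, norm_mul]
    have := abs_chi_le n ξ
    rw [Real.norm_eq_abs]
    nlinarith [mul_nonneg (norm_nonneg (m ξ)) (norm_nonneg (h s ξ))]
  rw [← ofReal_norm] at h3
  exact (ENNReal.ofReal_le_ofReal_iff (hk0 s hs')).1 h3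

theorem classL2_smul_intervalIntegral {m : Space → ℝ} (hm : IsLocMul m) {h : ℝ → VecL2}
    {a b : ℝ} (hab : a ≤ b) (hh : IntervalIntegrable h volume a b)
    (hmh : IntervalIntegrable (fun s => classL2 (fun ξ => m ξ • h s ξ)) volume a b)
    (hL : ∀ s ∈ Set.Ioo a b, MemLp (fun ξ => m ξ • h s ξ) 2 volume)
    (hM : MemLp (fun ξ => m ξ • (∫ s in a..b, h s : VecL2) ξ) 2 volume) :
    classL2 (fun ξ => m ξ • (∫ s in a..b, h s : VecL2) ξ) =
      ∫ s in a..b, classL2 (fun ξ => m ξ • h s ξ) := by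
  refine eq_of_chi fun n => ?_
  rw [mulCLM_chi_mul hm hM, ← ContinuousLinearMap.intervalIntegral_comp_comm _ hh,
    ← ContinuousLinearMap.intervalIntegral_comp_comm _ hmh]
  refine intervalIntegral.integral_congr_ae ?_
  have h2 : ∀ᵐ s : ℝ, s ≠ b := by simp [ae_iff]
  filter_upwards [h2] with s hsb hs
  rw [Set.uIoc_of_le hab] at hs
  rw [mulCLM_chi_mul hm (hL s ⟨hs.1, lt_of_le_of_ne hs.2 hsb⟩)]

end NavierStokes

/-! ### The bilinear estimate and the Fourier transform of the nonlinearity. -/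

namespace NavierStokes

/-! ### A bilinear convolution estimate with power weights -/

theorem finrank_space : Module.finrank ℝ Space = 3 := by simp [Space]

/-- Polar coordinates in dimension three reduce this to the integral of y^{2-a} over [0, ρ]. -/
theorem lintegral_enorm_rpow_ball_le {a : ℝ} (ha : a < 3) {ρ : ℝ} (hρ : 0 ≤ ρ) :
    ∫⁻ η : Space, Set.indicator {η | ‖η‖ ≤ ρ} (fun η => ‖η‖ₑ ^ (-a)) η ≤
      ENNReal.ofReal (3 * volume.real (Metric.ball (0 : Space) 1) / (3 - a)) *
        ENNReal.ofReal ρ ^ (3 - a) := by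
  set φ : ℝ → ℝ := Set.indicator (Set.Iic ρ) (fun y => y ^ (-a)) with hφ
  have e1 (y : ℝ) (hy : 0 < y) : y ^ (Module.finrank ℝ Space - 1) • φ y =
      Set.indicator (Set.Iic ρ) (fun y => y ^ (2 - a)) y := by
    rw [finrank_space, hφ]
    by_cases h : y ≤ ρ
    · rw [Set.indicator_of_mem (Set.mem_Iic.2 h), Set.indicator_of_mem (Set.mem_Iic.2 h),
        smul_eq_mul, ← Real.rpow_natCast, ← Real.rpow_add hy]
      norm_num; ring_nf
    · rw [Set.indicator_of_notMem (by simpa using h), Set.indicator_of_notMem (by simpa using h),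
        smul_zero]
  have hII : IntervalIntegrable (fun y : ℝ => y ^ (2 - a)) volume 0 ρ :=
    intervalIntegral.intervalIntegrable_rpow' (by linarith)
  have h2 : IntegrableOn (fun y => y ^ (Module.finrank ℝ Space - 1) • φ y) (Set.Ioi 0) := by
    refine IntegrableOn.congr_fun (f := Set.indicator (Set.Iic ρ) (fun y => y ^ (2 - a))) ?_
      (fun y hy => (e1 y hy).symm) measurableSet_Ioi
    rw [IntegrableOn, integrable_indicator_iff measurableSet_Iic, IntegrableOn,
      Measure.restrict_restrict measurableSet_Iic, Set.inter_comm, Set.Ioi_inter_Iic]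
    exact (intervalIntegrable_iff_integrableOn_Ioc_of_le hρ).1 hII
  have h3 : Integrable (fun η : Space => φ ‖η‖) volume :=
    (integrable_fun_norm_addHaar volume).2 h2
  have h4 : ∫ η : Space, φ ‖η‖ =
      3 * volume.real (Metric.ball (0 : Space) 1) / (3 - a) * ρ ^ (3 - a) := by
    rw [integral_fun_norm_addHaar volume φ, setIntegral_congr_fun measurableSet_Ioi
      (fun y hy => e1 y hy), setIntegral_indicator measurableSet_Iic, Set.Ioi_inter_Iic,
      ← intervalIntegral.integral_of_le hρ, integral_rpow (Or.inl (by linarith)), finrank_space,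
      Real.zero_rpow (by linarith)]
    rw [nsmul_eq_mul, smul_eq_mul, show 2 - a + 1 = 3 - a by ring]
    push_cast
    ring
  have h5 : 0 ≤ᵐ[volume] fun η : Space => φ ‖η‖ := by
    refine ae_of_all _ fun η => ?_
    exact Set.indicator_apply_nonneg (fun _ => Real.rpow_nonneg (norm_nonneg η) _)
  have h6 : ∫⁻ η : Space, Set.indicator {η | ‖η‖ ≤ ρ} (fun η => ‖η‖ₑ ^ (-a)) η =
      ∫⁻ η : Space, ENNReal.ofReal (φ ‖η‖) := by
    refine lintegral_congr_ae ?_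
    have h0 : ∀ᵐ η : Space, η ≠ 0 := by simp [ae_iff]
    filter_upwards [h0] with η hη
    by_cases h : ‖η‖ ≤ ρ
    · rw [Set.indicator_of_mem (show η ∈ {η | ‖η‖ ≤ ρ} from h), hφ,
        Set.indicator_of_mem (Set.mem_Iic.2 h), ← ofReal_norm,
        ENNReal.ofReal_rpow_of_pos (norm_pos_iff.2 hη)]
    · rw [Set.indicator_of_notMem (by simpa using h), hφ,
        Set.indicator_of_notMem (by simpa using h), ENNReal.ofReal_zero]
  rw [h6, ← ofReal_integral_eq_lintegral_ofReal h3 h5, h4, ENNReal.ofReal_mul (by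
    have : 0 < 3 - a := by linarith
    positivity), ENNReal.ofReal_rpow_of_nonneg hρ (by linarith)]

theorem lintegral_mul_sq_le {f g : Space → ℝ≥0∞} (hf : AEMeasurable f volume)
    (hg : AEMeasurable g volume) :
    (∫⁻ η, f η * g η) ^ 2 ≤ (∫⁻ η, f η ^ 2) * ∫⁻ η, g η ^ 2 := by
  have h := ENNReal.lintegral_mul_le_Lp_mul_Lq volume Real.HolderConjugate.two_two hf hg
  have h2 := pow_le_pow_left' h 2
  rw [mul_pow, ← ENNReal.rpow_natCast, ← ENNReal.rpow_natCast, ← ENNReal.rpow_natCast,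
    ← ENNReal.rpow_mul, ← ENNReal.rpow_mul] at h2
  simpa using h2

theorem enorm_rpow_cancel {η : Space} (hη : η ≠ 0) (a : ℝ) (c : ℝ≥0∞) :
    ‖η‖ₑ ^ (-a) * (‖η‖ₑ ^ a * c) = c := by
  rw [← mul_assoc, ← ENNReal.rpow_add _ _ (by simpa using hη) (by simp), neg_add_cancel,
    ENNReal.rpow_zero, one_mul]

theorem ae_ne_zero : ∀ᵐ η : Space, η ≠ 0 := by simp [ae_iff]

/-- Cauchy–Schwarz in η puts |η|^α on f and |η|^{-α} on g. After integrating in ξ and exchanging the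
order, what multiplies g(ζ)² is the integral of |η|^{-2α} over |η| ≤ |ζ|. It converges because 2α <
3 and equals a constant times |ζ|^{3-2α} = |ζ|^{2β}. -/
theorem half_convolution_le {α β : ℝ} (hα : α < 3 / 2) (hαβ : α + β = 3 / 2)
    {f g : Space → ℝ≥0∞} (hf : Measurable f) (hg : Measurable g) :
    ∫⁻ ξ, (∫⁻ η, Set.indicator {η | ‖η‖ ≤ ‖ξ - η‖} (fun η => f η * g (ξ - η)) η) ^ 2 ≤
      ENNReal.ofReal (3 * volume.real (Metric.ball (0 : Space) 1) / (3 - 2 * α)) *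
        (∫⁻ η, (‖η‖ₑ ^ α * f η) ^ 2) * ∫⁻ η, (‖η‖ₑ ^ β * g η) ^ 2 := by
  set c := ENNReal.ofReal (3 * volume.real (Metric.ball (0 : Space) 1) / (3 - 2 * α))
  -- The second Cauchy–Schwarz factor in the variables ζ = ξ - η and η, in which the constraint
  -- reads |η| ≤ |ζ|.
  let D : Space → Space → ℝ≥0∞ := fun ζ η =>
    Set.indicator {p : Space × Space | ‖p.2‖ ≤ ‖p.1‖} (fun p => ‖p.2‖ₑ ^ (-α) * g p.1) (ζ, η)
  have hDm : Measurable (Function.uncurry D) := by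
    refine Measurable.indicator (by fun_prop) ?_
    exact measurableSet_le (by fun_prop) (by fun_prop)
  have h1 (ξ : Space) :
      (∫⁻ η, Set.indicator {η | ‖η‖ ≤ ‖ξ - η‖} (fun η => f η * g (ξ - η)) η) ^ 2 ≤
      (∫⁻ η, (‖η‖ₑ ^ α * f η) ^ 2) * ∫⁻ η, D (ξ - η) η ^ 2 := by
    have h2 : ∫⁻ η, Set.indicator {η | ‖η‖ ≤ ‖ξ - η‖} (fun η => f η * g (ξ - η)) η =
        ∫⁻ η, (‖η‖ₑ ^ α * f η) * D (ξ - η) η := by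
      refine lintegral_congr_ae ?_
      filter_upwards [ae_ne_zero] with η hη
      by_cases h : ‖η‖ ≤ ‖ξ - η‖
      · have h3 : D (ξ - η) η = ‖η‖ₑ ^ (-α) * g (ξ - η) := Set.indicator_of_mem (by exact h) _
        rw [Set.indicator_of_mem (by exact h), h3]
        nth_rewrite 1 [← enorm_rpow_cancel hη α (f η)]
        ring
      · have h3 : D (ξ - η) η = 0 := Set.indicator_of_notMem (by exact h) _
        rw [Set.indicator_of_notMem (by exact h), h3, mul_zero]
    rw [h2]
    refine lintegral_mul_sq_le (by fun_prop) ?_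
    exact (hDm.comp (by fun_prop : Measurable fun η : Space => (ξ - η, η))).aemeasurable
  have hDm2 : Measurable fun p : Space × Space => D (p.1 - p.2) p.2 ^ 2 :=
    (hDm.comp (by fun_prop : Measurable fun p : Space × Space => (p.1 - p.2, p.2))).pow_const 2
  have h4 : ∫⁻ ξ, ∫⁻ η, D (ξ - η) η ^ 2 ≤ c * ∫⁻ η, (‖η‖ₑ ^ β * g η) ^ 2 := by
    rw [lintegral_lintegral_swap hDm2.aemeasurable]
    have h5 : ∀ η, ∫⁻ ξ, D (ξ - η) η ^ 2 = ∫⁻ ζ, D ζ η ^ 2 := fun η =>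
      lintegral_sub_right_eq_self (fun ζ => D ζ η ^ 2) η
    simp only [h5]
    rw [lintegral_lintegral_swap
      (by exact ((hDm.comp measurable_swap).pow_const 2).aemeasurable),
      ← lintegral_const_mul _ (by fun_prop)]
    refine lintegral_mono fun ζ => ?_
    have h6 : ∀ η, D ζ η ^ 2 = g ζ ^ 2 *
        Set.indicator {η | ‖η‖ ≤ ‖ζ‖} (fun η => ‖η‖ₑ ^ (-(2 * α))) η := by
      intro η
      by_cases h : ‖η‖ ≤ ‖ζ‖
      · have h3 : D ζ η = ‖η‖ₑ ^ (-α) * g ζ := Set.indicator_of_mem (by exact h) _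
        rw [h3, Set.indicator_of_mem (by exact h), mul_pow, mul_comm,
          ← ENNReal.rpow_natCast (‖η‖ₑ ^ (-α)), ← ENNReal.rpow_mul]
        simp only [Nat.cast_ofNat]
        rw [show -α * 2 = -(2 * α) by ring]
      · have h3 : D ζ η = 0 := Set.indicator_of_notMem (by exact h) _
        rw [h3, Set.indicator_of_notMem (by exact h), mul_zero, zero_pow two_ne_zero]
    simp only [h6]
    rw [lintegral_const_mul]
    · refine (mul_le_mul' le_rfl (lintegral_enorm_rpow_ball_le (a := 2 * α) (by linarith)
        (norm_nonneg ζ))).trans (le_of_eq ?_)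
      have h7 : (‖ζ‖ₑ ^ β * g ζ) ^ 2 = ‖ζ‖ₑ ^ (3 - 2 * α) * g ζ ^ 2 := by
        rw [mul_pow, ← ENNReal.rpow_natCast, ← ENNReal.rpow_mul]
        simp only [Nat.cast_ofNat]
        rw [show β * 2 = 3 - 2 * α by linarith]
      rw [h7, ofReal_norm]
      ring
    · refine Measurable.indicator (by fun_prop) ?_
      exact measurableSet_le (by fun_prop) (by fun_prop)
  calc _ ≤ ∫⁻ ξ, (∫⁻ η, (‖η‖ₑ ^ α * f η) ^ 2) * ∫⁻ η, D (ξ - η) η ^ 2 := lintegral_mono h1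
    _ = (∫⁻ η, (‖η‖ₑ ^ α * f η) ^ 2) * ∫⁻ ξ, ∫⁻ η, D (ξ - η) η ^ 2 := by
      rw [lintegral_const_mul _ hDm2.lintegral_prod_right']
    _ ≤ (∫⁻ η, (‖η‖ₑ ^ α * f η) ^ 2) * (c * ∫⁻ η, (‖η‖ₑ ^ β * g η) ^ 2) := by gcongr
    _ = _ := by ring

/-- One of the two arguments η and ξ - η has the smaller norm. The substitution η ↦ ξ - η exchanges
the two regions together with the roles of f, α and g, β. -/
theorem lintegral_convolution_sq_le_of_measurable {α β : ℝ} (hα : α < 3 / 2) (hβ : β < 3 / 2)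
    (hαβ : α + β = 3 / 2) : ∃ C : ℝ, 0 ≤ C ∧ ∀ f g : Space → ℝ≥0∞, Measurable f → Measurable g →
    ∫⁻ ξ, (∫⁻ η, f η * g (ξ - η)) ^ 2 ≤
      ENNReal.ofReal C ^ 2 * ((∫⁻ η, (‖η‖ₑ ^ α * f η) ^ 2) * ∫⁻ η, (‖η‖ₑ ^ β * g η) ^ 2) := by
  set v := 3 * volume.real (Metric.ball (0 : Space) 1)
  have hv : 0 ≤ v := by positivity
  have h1 : 0 < 3 - 2 * α := by linarith
  have h2 : 0 < 3 - 2 * β := by linarith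
  refine ⟨Real.sqrt (2 * (v / (3 - 2 * α) + v / (3 - 2 * β))), Real.sqrt_nonneg _,
    fun f g hf hg => ?_⟩
  rw [← ENNReal.ofReal_pow (Real.sqrt_nonneg _), Real.sq_sqrt (by positivity),
    ENNReal.ofReal_mul (by norm_num), ENNReal.ofReal_add (by positivity) (by positivity)]
  set I1 : Space → ℝ≥0∞ := fun ξ =>
    ∫⁻ η, Set.indicator {η | ‖η‖ ≤ ‖ξ - η‖} (fun η => f η * g (ξ - η)) η
  set I2 : Space → ℝ≥0∞ := fun ξ =>
    ∫⁻ η, Set.indicator {η | ‖η‖ ≤ ‖ξ - η‖} (fun η => g η * f (ξ - η)) η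
  have hm (f g : Space → ℝ≥0∞) (hf : Measurable f) (hg : Measurable g) :
      Measurable fun ξ => ∫⁻ η, Set.indicator {η | ‖η‖ ≤ ‖ξ - η‖} (fun η => f η * g (ξ - η)) η := by
    have : Measurable fun p : Space × Space => Set.indicator {p : Space × Space |
        ‖p.2‖ ≤ ‖p.1 - p.2‖} (fun p => f p.2 * g (p.1 - p.2)) p := by
      refine Measurable.indicator (by fun_prop) ?_
      exact measurableSet_le (by fun_prop) (by fun_prop)
    exact this.lintegral_prod_right'
  have h3 (ξ : Space) : ∫⁻ η, f η * g (ξ - η) ≤ I1 ξ + I2 ξ := by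
    have h4 : I2 ξ = ∫⁻ η, Set.indicator {η | ‖ξ - η‖ ≤ ‖η‖} (fun η => f η * g (ξ - η)) η := by
      rw [← lintegral_sub_left_eq_self _ ξ]
      refine lintegral_congr fun η => ?_
      simp only [Set.indicator, Set.mem_ofPred_eq, sub_sub_cancel, mul_comm]
    rw [h4, ← lintegral_add_left]
    · refine lintegral_mono fun η => ?_
      rcases le_total ‖η‖ ‖ξ - η‖ with h | h
      · rw [Set.indicator_of_mem (by exact h)]
        exact le_self_add
      · refine le_trans ?_ le_add_self
        rw [Set.indicator_of_mem (by exact h)]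
    · refine Measurable.indicator (by fun_prop) ?_
      exact measurableSet_le (by fun_prop) (by fun_prop)
  calc _ ≤ ∫⁻ ξ, (2 * I1 ξ ^ 2 + 2 * I2 ξ ^ 2) := by
        refine lintegral_mono fun ξ => (pow_le_pow_left' (h3 ξ) 2).trans ?_
        have h5 := ENNReal.rpow_add_le_mul_rpow_add_rpow (I1 ξ) (I2 ξ) (p := 2) (by norm_num)
        rw [show (2 : ℝ) - 1 = 1 by norm_num, ENNReal.rpow_one] at h5
        rw [← mul_add]
        exact_mod_cast h5
    _ = 2 * (∫⁻ ξ, I1 ξ ^ 2) + 2 * ∫⁻ ξ, I2 ξ ^ 2 := by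
        rw [lintegral_add_left (((hm f g hf hg).pow_const 2).const_mul 2),
          lintegral_const_mul _ ((hm f g hf hg).pow_const 2),
          lintegral_const_mul _ ((hm g f hg hf).pow_const 2)]
    _ ≤ _ := by
        refine (add_le_add (mul_le_mul' le_rfl (half_convolution_le hα hαβ hf hg))
          (mul_le_mul' le_rfl (half_convolution_le hβ ((add_comm _ _).trans hαβ) hg hf))).trans
          (le_of_eq ?_)
        rw [ENNReal.ofReal_ofNat]
        ring

theorem lintegral_convolution_sq_le {α β : ℝ} (hα : α < 3 / 2) (hβ : β < 3 / 2)
    (hαβ : α + β = 3 / 2) : ∃ C : ℝ, 0 ≤ C ∧ ∀ f g : Space → ℝ≥0∞, AEMeasurable f volume →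
    AEMeasurable g volume → ∫⁻ ξ, (∫⁻ η, f η * g (ξ - η)) ^ 2 ≤
      ENNReal.ofReal C ^ 2 * ((∫⁻ η, (‖η‖ₑ ^ α * f η) ^ 2) * ∫⁻ η, (‖η‖ₑ ^ β * g η) ^ 2) := by
  obtain ⟨C, hC, h⟩ := lintegral_convolution_sq_le_of_measurable hα hβ hαβ
  refine ⟨C, hC, fun f g hf hg => ?_⟩
  have h1 (ξ : Space) : ∫⁻ η, f η * g (ξ - η) = ∫⁻ η, hf.mk f η * hg.mk g (ξ - η) := by
    refine lintegral_congr_ae ?_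
    have h2 : ∀ᵐ η, g (ξ - η) = hg.mk g (ξ - η) :=
      (Measure.measurePreserving_sub_left volume ξ).quasiMeasurePreserving.ae hg.ae_eq_mk
    filter_upwards [hf.ae_eq_mk, h2] with η h3 h4
    rw [h3, h4]
  have h2 : ∫⁻ η, (‖η‖ₑ ^ α * f η) ^ 2 = ∫⁻ η, (‖η‖ₑ ^ α * hf.mk f η) ^ 2 :=
    lintegral_congr_ae (by filter_upwards [hf.ae_eq_mk] with η h using by rw [h])
  have h3 : ∫⁻ η, (‖η‖ₑ ^ β * g η) ^ 2 = ∫⁻ η, (‖η‖ₑ ^ β * hg.mk g η) ^ 2 :=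
    lintegral_congr_ae (by filter_upwards [hg.ae_eq_mk] with η h using by rw [h])
  simp only [h1, h2, h3]
  exact h _ _ hf.measurable_mk hg.measurable_mk

end NavierStokes

namespace NavierStokes

/-! ### Products of functions whose Fourier transforms are in weighted `L²` spaces -/

/-- Cauchy–Schwarz against |ξ|^{-α}, which is square integrable near the origin exactly when α <
3/2. -/
theorem chi_smul_integrable {α : ℝ} (hα : α < 3 / 2) {f : Space → Vec}
    (hf : AEStronglyMeasurable f volume) (hfα : ∫⁻ η, (‖η‖ₑ ^ α * ‖f η‖ₑ) ^ 2 < ∞) (n : ℕ) :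
    Integrable (fun ξ => chi n ξ • f ξ) volume := by
  refine ⟨(measurable_chi n).aestronglyMeasurable.smul hf, ?_⟩
  set k : Space → ℝ≥0∞ := Set.indicator {η | ‖η‖ ≤ n} (fun η => ‖η‖ₑ ^ (-α))
  have hk : Measurable k := by
    refine Measurable.indicator (by fun_prop) ?_
    exact measurableSet_le (by fun_prop) (by fun_prop)
  have h1 : ∫⁻ ξ, ‖chi n ξ • f ξ‖ₑ ≤ ∫⁻ ξ, (‖ξ‖ₑ ^ α * ‖f ξ‖ₑ) * k ξ := by
    refine lintegral_mono_ae ?_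
    filter_upwards [ae_ne_zero] with ξ hξ
    rcases chi_eq_or n ξ with h | h
    · have h2 : ‖ξ‖ ≤ n := by
        refine le_trans ?_ h.1
        unfold symA
        have := Real.pi_gt_three
        nlinarith [norm_nonneg ξ]
      have h3 : k ξ = ‖ξ‖ₑ ^ (-α) := Set.indicator_of_mem (by exact h2) _
      rw [h.2, one_smul, h3, mul_comm, enorm_rpow_cancel hξ]
    · simp [h.2]
  have h2 : ∫⁻ ξ, k ξ ^ 2 < ∞ := by
    have h3 : ∀ η, k η ^ 2 = Set.indicator {η : Space | ‖η‖ ≤ n} (fun η => ‖η‖ₑ ^ (-(2 * α))) η := by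
      intro η
      by_cases h : ‖η‖ ≤ n
      · have h3 : k η = ‖η‖ₑ ^ (-α) := Set.indicator_of_mem (by exact h) _
        rw [h3, Set.indicator_of_mem (by exact h), ← ENNReal.rpow_natCast, ← ENNReal.rpow_mul]
        simp only [Nat.cast_ofNat]
        rw [show -α * 2 = -(2 * α) by ring]
      · have h3 : k η = 0 := Set.indicator_of_notMem (by exact h) _
        rw [h3, Set.indicator_of_notMem (by exact h), zero_pow two_ne_zero]
    simp only [h3]
    refine (lintegral_enorm_rpow_ball_le (by linarith) (Nat.cast_nonneg n)).trans_lt ?_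
    exact ENNReal.mul_lt_top ENNReal.ofReal_lt_top
      (ENNReal.rpow_lt_top_of_nonneg (by linarith) ENNReal.ofReal_ne_top)
  have h3 := lintegral_mul_sq_le (f := fun ξ => ‖ξ‖ₑ ^ α * ‖f ξ‖ₑ) (g := k)
    ((by fun_prop : Measurable fun ξ : Space => ‖ξ‖ₑ ^ α).aemeasurable.mul hf.enorm)
    hk.aemeasurable
  have h4 := h3.trans_lt (ENNReal.mul_lt_top hfα h2)
  refine h1.trans_lt ?_
  exact (ENNReal.pow_lt_top_iff.1 h4).resolve_right two_ne_zero

theorem memLp_weight {α : ℝ} {f : Space → Vec} (hα : 0 < α)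
    (hf : AEStronglyMeasurable f volume) (hfα : ∫⁻ η, (‖η‖ₑ ^ α * ‖f η‖ₑ) ^ 2 < ∞) :
    MemLp (fun ξ => ‖ξ‖ ^ α * ‖f ξ‖) 2 volume := by
  refine ⟨(by fun_prop : Measurable fun ξ : Space => ‖ξ‖ ^ α).aestronglyMeasurable.mul hf.norm, ?_⟩
  rw [eLpNorm_lt_top_iff_lintegral_rpow_enorm_lt_top two_ne_zero ENNReal.ofNat_ne_top]
  refine lt_of_le_of_lt (lintegral_mono fun ξ => ?_) hfα
  rw [enorm_mul, enorm_norm, ← ofReal_norm, ← ofReal_norm ξ, Real.norm_of_nonneg (by positivity),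
    ENNReal.ofReal_rpow_of_nonneg (norm_nonneg _) hα.le]
  norm_num

/-- The threshold 7 exceeds 2π, so beyond the cut-off ‖ξ‖ ≥ 1 and the weight is at least 1. -/
theorem norm_tail_le {α : ℝ} (hα : 0 < α) {f : Space → Vec} {n : ℕ} (hn : 7 ≤ n) (ξ : Space) :
    ‖f ξ - chi n ξ • f ξ‖ ≤ ‖ξ‖ ^ α * ‖f ξ‖ := by
  rcases chi_eq_or n ξ with h | h
  · rw [h.2, one_smul, sub_self, norm_zero]; positivity
  · rw [h.2, zero_smul, sub_zero]
    refine le_mul_of_one_le_left (norm_nonneg _) (Real.one_le_rpow ?_ hα.le)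
    have h1 : (7 : ℝ) ≤ n := by exact_mod_cast hn
    have h2 := h.1
    unfold symA at h2
    have := Real.pi_lt_d2
    nlinarith [norm_nonneg ξ, Real.pi_gt_three]

theorem memLp_tail {α : ℝ} {f : Space → Vec} (hα : 0 < α)
    (hf : AEStronglyMeasurable f volume) (hfα : ∫⁻ η, (‖η‖ₑ ^ α * ‖f η‖ₑ) ^ 2 < ∞)
    {n : ℕ} (hn : 7 ≤ n) : MemLp (fun ξ => f ξ - chi n ξ • f ξ) 2 volume :=
  (memLp_weight hα hf hfα).mono' (hf.sub ((measurable_chi n).aestronglyMeasurable.smul hf))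
    (ae_of_all _ (norm_tail_le hα hn))

theorem exists_subseq_ae_tendsto {F : ℕ → VecL2} {f : VecL2} (h : Tendsto F atTop (𝓝 f)) :
    ∃ ns : ℕ → ℕ, StrictMono ns ∧ ∀ᵐ x, Tendsto (fun i => F (ns i) x) atTop (𝓝 (f x)) :=
  (tendstoInMeasure_of_tendsto_Lp h).exists_seq_tendsto_ae

/-- The high frequency tails tend to 0 in L², hence almost everywhere along a subsequence. Starting
from an arbitrary sequence `φ` allows successive extractions for several functions. -/
theorem exists_subseq_fourierInv_tendsto {α : ℝ} (hα : 0 < α) (hα' : α < 3 / 2) {T : VecDist}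
    {f : Space → Vec} (hT : IsFun (𝓕 T) f) (hfα : ∫⁻ η, (‖η‖ₑ ^ α * ‖f η‖ₑ) ^ 2 < ∞)
    {φ : ℕ → ℕ} (hφ : Tendsto φ atTop atTop) :
    ∃ ns : ℕ → ℕ, StrictMono ns ∧ ∀ᵐ x, Tendsto
      (fun i => 𝓕⁻ (fun ξ => chi (φ (ns i)) ξ • f ξ) x) atTop (𝓝 (toFun T x)) := by
  have h0 : Tendsto (fun n => classL2 (fun ξ => f ξ - chi n ξ • f ξ)) atTop
      (𝓝 (classL2 fun _ => 0)) := by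
    refine tendsto_classL2_of_dominated (b := fun ξ => ‖ξ‖ ^ α * ‖f ξ‖)
      (Eventually.of_forall fun n => ?_) aestronglyMeasurable_const ?_ ?_
      (memLp_weight hα hT.1 hfα) ?_
    · exact hT.1.sub ((measurable_chi n).aestronglyMeasurable.smul hT.1)
    · filter_upwards [eventually_ge_atTop 7] with n hn using ae_of_all _ (norm_tail_le hα hn)
    · exact ae_of_all _ fun ξ => by rw [norm_zero]; positivity
    · refine ae_of_all _ fun ξ => ?_
      simpa using ((tendsto_chi ξ).smul_const (f ξ)).const_sub (f ξ)
  have hz : classL2 (fun _ : Space => (0 : Vec)) = 0 := by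
    rw [classL2_of_memLp (MemLp.zero' (ε := Vec))]; rfl
  have hz' : (𝓕⁻ (0 : VecL2)) = 0 := (Lp.fourierTransformₗᵢ Space Vec).symm.map_zero
  have h1 : Tendsto (fun n => (𝓕⁻ (classL2 (fun ξ => f ξ - chi n ξ • f ξ)) : VecL2)) atTop
      (𝓝 0) := by
    rw [hz] at h0
    have := ((Lp.fourierTransformₗᵢ Space Vec).symm.continuous.tendsto 0).comp h0
    rw [map_zero] at this
    exact this
  obtain ⟨ns, hns, hlim⟩ := exists_subseq_ae_tendsto (h1.comp hφ)
  refine ⟨ns, hns, ?_⟩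
  have h2 : ∀ n, 7 ≤ n → ∀ᵐ x, toFun T x = 𝓕⁻ (fun ξ => chi n ξ • f ξ) x +
      (𝓕⁻ (classL2 (fun ξ => f ξ - chi n ξ • f ξ)) : VecL2) x := fun n hn =>
    (isFun_of_fourier_eq_add (chi_smul_integrable hα' hT.1 hfα n) (memLp_tail hα hT.1 hfα hn)
      (by simpa using hT)).toFun_ae_eq
  have h3 : ∀ᵐ x, ∀ n, 7 ≤ n → toFun T x = 𝓕⁻ (fun ξ => chi n ξ • f ξ) x +
      (𝓕⁻ (classL2 (fun ξ => f ξ - chi n ξ • f ξ)) : VecL2) x := by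
    rw [ae_all_iff]; intro n
    by_cases hn : 7 ≤ n
    · filter_upwards [h2 n hn] with x hx using fun _ => hx
    · exact ae_of_all _ fun x h => absurd h hn
  filter_upwards [h3, hlim, Lp.coeFn_zero Vec 2 (volume : Measure Space)] with x hx hl hz
  rw [hz] at hl
  have h4 := hl.const_sub (toFun T x)
  simp only [Pi.zero_apply, sub_zero] at h4
  refine h4.congr' ?_
  have h5 : ∀ᶠ i in atTop, 7 ≤ φ (ns i) :=
    (hφ.comp hns.tendsto_atTop).eventually_ge_atTop 7
  filter_upwards [h5] with i hi
  rw [hx _ hi]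
  simp

theorem fourierInv_bilin_convolution (B : Vec →L[ℂ] Vec →L[ℂ] Vec) {f g : Space → Vec}
    (hf : Integrable f volume) (hg : Integrable g volume) (x : Space) :
    𝓕⁻ (convolution f g B volume) x = B (𝓕⁻ f x) (𝓕⁻ g x) := by
  simp only [Real.fourierInv_eq_fourier_neg]
  exact Real.fourier_bilin_convolution_eq B hf hg (-x)

theorem aemeasurable_enorm_convolution {f g : Space → Vec} (hf : AEStronglyMeasurable f volume)
    (hg : AEStronglyMeasurable g volume) :
    AEMeasurable (fun ξ => ∫⁻ η, ‖f η‖ₑ * ‖g (ξ - η)‖ₑ) volume := by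
  have h : AEMeasurable (fun p : Space × Space => ‖f p.2‖ₑ * ‖g (p.1 - p.2)‖ₑ)
      (volume.prod volume) := by
    refine AEMeasurable.mul (M := ℝ≥0∞) ?_ ?_
    · exact hf.enorm.comp_quasiMeasurePreserving Measure.quasiMeasurePreserving_snd
    · exact hg.enorm.comp_quasiMeasurePreserving (quasiMeasurePreserving_sub volume volume)
  exact h.lintegral_prod_right'

theorem enorm_convolution_le (B : Vec →L[ℂ] Vec →L[ℂ] Vec) (f g : Space → Vec) (ξ : Space) :
    ‖convolution f g B volume ξ‖ₑ ≤ ‖B‖ₑ * ∫⁻ η, ‖f η‖ₑ * ‖g (ξ - η)‖ₑ := by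
  refine (enorm_integral_le_lintegral_enorm _).trans ?_
  rw [← lintegral_const_mul' _ _ (by simp)]
  refine lintegral_mono fun η => ?_
  rw [← mul_assoc]
  exact (ContinuousLinearMap.le_opENorm _ _).trans
    (mul_le_mul' (ContinuousLinearMap.le_opENorm _ _) le_rfl)

theorem tendsto_bilin (B : Vec →L[ℂ] Vec →L[ℂ] Vec) {ι : Type*} {l : Filter ι} {u v : ι → Vec}
    {a b : Vec} (hu : Tendsto u l (𝓝 a)) (hv : Tendsto v l (𝓝 b)) :
    Tendsto (fun i => B (u i) (v i)) l (𝓝 (B a b)) := by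
  have h1 : Tendsto (fun i => B (u i)) l (𝓝 (B a)) := (B.continuous.tendsto a).comp hu
  exact (isBoundedBilinearMap_apply.continuous.tendsto (B a, b)).comp (h1.prodMk_nhds hv)

/-- For truncated transforms, which are integrable, this is the classical convolution theorem. As
the truncation is removed, the convolutions converge in L², dominated by the convolution of the
norms, which the bilinear estimate puts in L². The products converge almost everywhere along a
subsequence, and the two limits must agree. -/
theorem product_fourier {α β : ℝ} (hα : α < 3 / 2) (hβ : β < 3 / 2) (hαβ : α + β = 3 / 2)
    (B : Vec →L[ℂ] Vec →L[ℂ] Vec) {T S : VecDist} {f g : Space → Vec} (hT : IsFun (𝓕 T) f)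
    (hS : IsFun (𝓕 S) g) (hf : ∫⁻ η, (‖η‖ₑ ^ α * ‖f η‖ₑ) ^ 2 < ∞)
    (hg : ∫⁻ η, (‖η‖ₑ ^ β * ‖g η‖ₑ) ^ 2 < ∞) :
    MemLp (convolution f g B volume) 2 volume ∧
      (fun x => B (toFun T x) (toFun S x)) =ᵐ[volume]
        (𝓕⁻ (classL2 (convolution f g B volume)) : VecL2) := by
  obtain ⟨C, hC, hconv⟩ := lintegral_convolution_sq_le hα hβ hαβ
  set c : Space → ℝ≥0∞ := fun ξ => ∫⁻ η, ‖f η‖ₑ * ‖g (ξ - η)‖ₑ with hc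
  have hcm : AEMeasurable c volume := aemeasurable_enorm_convolution hT.1 hS.1
  have hc2 : ∫⁻ ξ, c ξ ^ 2 < ∞ := (hconv _ _ hT.1.enorm hS.1.enorm).trans_lt
    (ENNReal.mul_lt_top (ENNReal.pow_lt_top ENNReal.ofReal_lt_top) (ENNReal.mul_lt_top hf hg))
  have hcfin : ∀ᵐ ξ, c ξ < ∞ := by
    filter_upwards [ae_lt_top' (hcm.pow_const 2) hc2.ne] with ξ hξ
    exact (ENNReal.pow_lt_top_iff.1 hξ).resolve_right two_ne_zero
  set b : Space → ℝ := fun ξ => ‖B‖ * (c ξ).toReal with hb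
  have hbL : MemLp b 2 volume := by
    refine MemLp.const_mul ⟨hcm.ennreal_toReal.aestronglyMeasurable, ?_⟩ _
    rw [eLpNorm_lt_top_iff_lintegral_rpow_enorm_lt_top two_ne_zero ENNReal.ofNat_ne_top]
    refine lt_of_le_of_lt (lintegral_mono_ae ?_) hc2
    filter_upwards [hcfin] with ξ hξ
    rw [← ofReal_norm, Real.norm_of_nonneg ENNReal.toReal_nonneg, ENNReal.ofReal_toReal hξ.ne]
    norm_num
  let fn : ℕ → Space → Vec := fun n ξ => chi n ξ • f ξ
  let gn : ℕ → Space → Vec := fun n ξ => chi n ξ • g ξ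
  have hfn (n : ℕ) : Integrable (fn n) volume := chi_smul_integrable hα hT.1 hf n
  have hgn (n : ℕ) : Integrable (gn n) volume := chi_smul_integrable hβ hS.1 hg n
  let h : Space → Vec := convolution f g B volume
  let hn : ℕ → Space → Vec := fun n => convolution (fn n) (gn n) B volume
  have hhn (n : ℕ) : Integrable (hn n) volume := (hfn n).integrable_convolution B (hgn n)
  have hchi (n : ℕ) (u : Space → Vec) (η : Space) : ‖chi n η • u η‖ₑ ≤ ‖u η‖ₑ := by
    rcases chi_eq_or n η with h | h <;> simp [h.2]
  have hhb (n : ℕ) : ∀ᵐ ξ, ‖hn n ξ‖ ≤ b ξ := by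
    filter_upwards [hcfin] with ξ hξ
    have h1 : ‖hn n ξ‖ₑ ≤ ‖B‖ₑ * c ξ := (enorm_convolution_le B _ _ ξ).trans
      (mul_le_mul' le_rfl (lintegral_mono fun η => mul_le_mul' (hchi n f η) (hchi n g (ξ - η))))
    have h2 := ENNReal.toReal_mono (ENNReal.mul_ne_top (by simp) hξ.ne) h1
    simpa [hb] using h2
  have hlim : ∀ᵐ ξ, Tendsto (fun n => hn n ξ) atTop (𝓝 (h ξ)) := by
    filter_upwards [hcfin] with ξ hξ
    have hm (u v : Space → Vec) (hu : AEStronglyMeasurable u volume)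
        (hv : AEStronglyMeasurable v volume) :
        AEStronglyMeasurable (fun η => B (u η) (v (ξ - η))) volume := by
      have hv' : AEStronglyMeasurable (fun η => v (ξ - η)) volume :=
        hv.comp_measurePreserving (Measure.measurePreserving_sub_left volume ξ)
      exact B.aestronglyMeasurable_comp₂ hu hv'
    refine tendsto_integral_of_dominated_convergence
      (fun η => ‖B‖ * (‖f η‖ * ‖g (ξ - η)‖)) (fun n => hm _ _ (hfn n).1 (hgn n).1) ?_ ?_ ?_
    · refine Integrable.const_mul ⟨?_, ?_⟩ _
      · exact hT.1.norm.mul (hS.1.norm.comp_measurePreserving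
          (Measure.measurePreserving_sub_left volume ξ))
      · refine lt_of_le_of_lt (le_of_eq ?_) hξ
        refine lintegral_congr fun η => ?_
        rw [enorm_mul, enorm_norm, enorm_norm]
    · intro n
      refine ae_of_all _ fun η => ?_
      refine (B.le_opNorm₂ _ _).trans ?_
      rw [mul_assoc]
      have hc' (u : Space → Vec) (η : Space) : ‖chi n η • u η‖ ≤ ‖u η‖ := by
        rcases chi_eq_or n η with h | h <;> simp [h.2]
      exact mul_le_mul_of_nonneg_left (mul_le_mul (hc' f η) (hc' g _) (norm_nonneg _)
        (norm_nonneg _)) (ContinuousLinearMap.opNorm_nonneg B)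
    · refine ae_of_all _ fun η => ?_
      have h1 : Tendsto (fun n => fn n η) atTop (𝓝 (f η)) := by
        simpa using (tendsto_chi η).smul_const (f η)
      have h2 : Tendsto (fun n => gn n (ξ - η)) atTop (𝓝 (g (ξ - η))) := by
        simpa using (tendsto_chi (ξ - η)).smul_const (g (ξ - η))
      exact tendsto_bilin B h1 h2
  have hhm : AEStronglyMeasurable h volume :=
    aestronglyMeasurable_of_tendsto_ae atTop (fun n => (hhn n).1) hlim
  have hhb' : ∀ᵐ ξ, ‖h ξ‖ ≤ b ξ := by
    have h1 : ∀ᵐ ξ, ∀ n, ‖hn n ξ‖ ≤ b ξ := ae_all_iff.2 hhb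
    filter_upwards [h1, hlim] with ξ h2 h3
    exact le_of_tendsto h3.norm (Eventually.of_forall h2)
  refine ⟨hbL.mono' hhm hhb', ?_⟩
  have hL : Tendsto (fun n => classL2 (hn n)) atTop (𝓝 (classL2 h)) :=
    tendsto_classL2_of_dominated (Eventually.of_forall fun n => (hhn n).1) hhm
      (Eventually.of_forall hhb) hhb' hbL hlim
  have hL' : Tendsto (fun n => (𝓕⁻ (classL2 (hn n)) : VecL2)) atTop (𝓝 (𝓕⁻ (classL2 h))) :=
    ((Lp.fourierTransformₗᵢ Space Vec).symm.continuous.tendsto _).comp hL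
  -- Three nested extractions give one subsequence along which the product and both factors converge
  -- almost everywhere.
  obtain ⟨n1, hn1, hl1⟩ := exists_subseq_ae_tendsto hL'
  obtain ⟨n2, hn2, hl2⟩ := exists_subseq_fourierInv_tendsto (by linarith) hα hT hf
    hn1.tendsto_atTop
  obtain ⟨n3, hn3, hl3⟩ := exists_subseq_fourierInv_tendsto (by linarith) hβ hS hg
    (hn1.tendsto_atTop.comp hn2.tendsto_atTop)
  have hpt : ∀ᵐ x, ∀ n, (𝓕⁻ (classL2 (hn n)) : VecL2) x = B (𝓕⁻ (fn n) x) (𝓕⁻ (gn n) x) := by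
    rw [ae_all_iff]; intro n
    filter_upwards [fourierInv_classL2_ae_eq (hhn n) (hbL.mono' (hhn n).1 (hhb n))] with x hx
    rw [hx, fourierInv_bilin_convolution B (hfn n) (hgn n)]
  filter_upwards [hl1, hl2, hl3, hpt] with x h1 h2 h3 h4
  refine tendsto_nhds_unique ?_ (h1.comp (hn2.tendsto_atTop.comp hn3.tendsto_atTop))
  have h5 := tendsto_bilin B (h2.comp hn3.tendsto_atTop) h3
  refine h5.congr fun i => ?_
  simp only [Function.comp_apply, h4]
  rfl

end NavierStokes

namespace NavierStokes

/-! ### Weights -/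

/-- The symbol of `A^r exp(θ A)`. -/
def wt (θ r : ℝ) (ξ : Space) : ℝ := symA ξ ^ r * Real.exp (θ * symA ξ)

theorem wt_nonneg (θ r : ℝ) (ξ : Space) : 0 ≤ wt θ r ξ :=
  mul_nonneg (Real.rpow_nonneg (symA_nonneg ξ) _) (Real.exp_pos _).le

theorem measurable_wt (θ r : ℝ) : Measurable (wt θ r) := by
  unfold wt
  have := measurable_symA
  fun_prop

theorem weightedHat_eq (θ r : ℝ) (T : VecDist) :
    weightedHat θ r T = fun ξ => wt θ r ξ • hat T ξ := rfl

theorem isLocMul_wt (θ : ℝ) {r : ℝ} (hr : 0 ≤ r) : IsLocMul (wt θ r) := by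
  refine ⟨measurable_wt θ r, fun n => ⟨(n : ℝ) ^ r * Real.exp (|θ| * n), fun ξ hξ => ?_⟩⟩
  rw [abs_of_nonneg (wt_nonneg _ _ _)]
  refine mul_le_mul (Real.rpow_le_rpow (symA_nonneg ξ) hξ hr) (Real.exp_le_exp.2 ?_)
    (Real.exp_pos _).le (Real.rpow_nonneg (Nat.cast_nonneg n) r)
  exact mul_le_mul (le_abs_self θ) hξ (symA_nonneg ξ) (abs_nonneg _)

theorem eLpNorm_two_sq {E : Type*} [NormedAddCommGroup E] (f : Space → E) :
    eLpNorm f 2 volume ^ 2 = ∫⁻ ξ, ‖f ξ‖ₑ ^ 2 := by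
  have := eLpNorm_nnreal_pow_eq_lintegral (μ := (volume : Measure Space)) (f := f) (p := 2)
    two_ne_zero
  simpa using this

theorem InDom.isFun {θ r : ℝ} {T : VecDist} (h : InDom θ r T) : IsFun (𝓕 T) (hat T) :=
  isFun_toFun h.1

theorem norm_expA {θ r : ℝ} {T : VecDist} (h : InDom θ r T) :
    ‖expA θ r T‖ = (eLpNorm (fun ξ => wt θ r ξ • hat T ξ) 2 volume).toReal := by
  rw [expA, norm_fourierInv, norm_classL2 h.2]
  rfl

theorem eLpNorm_weighted {θ r : ℝ} {T : VecDist} (h : InDom θ r T) :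
    eLpNorm (fun ξ => wt θ r ξ • hat T ξ) 2 volume = ENNReal.ofReal ‖expA θ r T‖ := by
  rw [norm_expA h, ENNReal.ofReal_toReal]
  exact h.2.2.ne

/-! ### The nonlinearity in Fourier space -/

/-- The bilinear map `(a, b) ↦ (M a)ⱼ b`. -/
def advCLM (M : Matrix (Fin 3) (Fin 3) ℝ) (j : Fin 3) : Vec →L[ℂ] Vec →L[ℂ] Vec :=
  (ContinuousLinearMap.lsmul ℂ ℂ : ℂ →L[ℂ] Vec →L[ℂ] Vec).comp
    (∑ k, (M j k : ℂ) • (EuclideanSpace.proj k : Vec →L[ℂ] ℂ))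

theorem advCLM_apply (M : Matrix (Fin 3) (Fin 3) ℝ) (j : Fin 3) (a b : Vec) :
    advCLM M j a b = (∑ k, (M j k : ℂ) * a k) • b := by
  simp [advCLM, Finset.sum_smul]

/-- The Fourier transform of `∂ⱼ v`, as a function of that of `v`. -/
def dHat (j : Fin 3) (g : Space → Vec) (ξ : Space) : Vec :=
  (2 * Real.pi * Complex.I : ℂ) •
    (((inner ℝ ξ (EuclideanSpace.single j 1 : Space) : ℝ) : ℂ) • g ξ)

theorem isFun_fourier_lineDeriv {T : VecDist} {f : Space → Vec} (h : IsFun (𝓕 T) f) (j : Fin 3) :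
    IsFun (𝓕 (∂_{(EuclideanSpace.single j 1 : Space)} T)) (dHat j f) := by
  rw [TemperedDistribution.fourier_lineDerivOp_eq]
  exact (h.smulLeft (by fun_prop)).const_smul _

theorem enorm_dHat_le (j : Fin 3) (g : Space → Vec) (ξ : Space) :
    ‖dHat j g ξ‖ₑ ≤ ENNReal.ofReal (symA ξ) * ‖g ξ‖ₑ := by
  rw [← ofReal_norm, ← ofReal_norm (g ξ), ← ENNReal.ofReal_mul (symA_nonneg ξ)]
  refine ENNReal.ofReal_le_ofReal ?_
  have h1 : |inner ℝ ξ (EuclideanSpace.single j 1 : Space)| ≤ ‖ξ‖ := by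
    have := abs_real_inner_le_norm ξ (EuclideanSpace.single j 1 : Space)
    simpa using this
  have h2 : ‖dHat j g ξ‖ = 2 * Real.pi * |inner ℝ ξ (EuclideanSpace.single j 1 : Space)| * ‖g ξ‖ := by
    rw [dHat, norm_smul, norm_smul, Complex.norm_real, Real.norm_eq_abs]
    simp [abs_of_pos Real.pi_pos, mul_assoc]
  rw [h2, symA]
  have := Real.pi_pos
  gcongr

/-- The Fourier transform of `(M u · ∇) v`, as a function of those of `u` and `v`. -/
def nl (M : Matrix (Fin 3) (Fin 3) ℝ) (f g : Space → Vec) (ξ : Space) : Vec :=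
  ∑ j, convolution f (dHat j g) (advCLM M j) volume ξ

theorem enorm_nl_le (M : Matrix (Fin 3) (Fin 3) ℝ) (f g : Space → Vec) (ξ : Space) :
    ‖nl M f g ξ‖ₑ ≤ (∑ j, ‖advCLM M j‖ₑ) *
      ∫⁻ η, ‖f η‖ₑ * (ENNReal.ofReal (symA (ξ - η)) * ‖g (ξ - η)‖ₑ) := by
  rw [Finset.sum_mul]
  refine (enorm_sum_le _ _).trans (Finset.sum_le_sum fun j _ => ?_)
  refine (enorm_convolution_le _ _ _ ξ).trans (mul_le_mul' le_rfl (lintegral_mono fun η => ?_))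
  exact mul_le_mul' le_rfl (enorm_dHat_le j g _)

theorem norm_le_symA (ξ : Space) : ‖ξ‖ ≤ symA ξ := by
  unfold symA
  nlinarith [Real.pi_gt_three, norm_nonneg ξ]

theorem symA_le_add (ξ η : Space) : symA ξ ≤ symA η + symA (ξ - η) := by
  unfold symA
  rw [← mul_add]
  refine mul_le_mul_of_nonneg_left ?_ (by positivity)
  calc ‖ξ‖ = ‖η + (ξ - η)‖ := by simp
    _ ≤ _ := norm_add_le _ _

theorem enorm_wt_smul (θ r : ℝ) (ξ : Space) (v : Vec) :
    ‖wt θ r ξ • v‖ₑ = ENNReal.ofReal (symA ξ ^ r) * ENNReal.ofReal (Real.exp (θ * symA ξ)) * ‖v‖ₑ := by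
  rw [enorm_smul, ← ofReal_norm, Real.norm_of_nonneg (wt_nonneg _ _ _), wt,
    ENNReal.ofReal_mul (Real.rpow_nonneg (symA_nonneg ξ) _)]

theorem enorm_rpow_le_symA {α : ℝ} (hα : 0 ≤ α) (ξ : Space) :
    ‖ξ‖ₑ ^ α ≤ ENNReal.ofReal (symA ξ ^ α) := by
  rw [← ofReal_norm, ENNReal.ofReal_rpow_of_nonneg (norm_nonneg _) hα]
  exact ENNReal.ofReal_le_ofReal (Real.rpow_le_rpow (norm_nonneg _) (norm_le_symA ξ) hα)

theorem symA_pos {ξ : Space} (h : ξ ≠ 0) : 0 < symA ξ :=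
  (norm_pos_iff.2 h).trans_le (norm_le_symA ξ)

/-- For θ ≥ 0 the triangle inequality gives exp(θ|ξ|) ≤ exp(θ|η|) exp(θ|ξ-η|), so each factor of the
convolution receives its own exponential weight. The derivative accounts for the extra power in 1 +
β. -/
theorem eLpNorm_nl_le (M : Matrix (Fin 3) (Fin 3) ℝ) {α β : ℝ} (hα : α < 3 / 2) (hβ : β < 3 / 2)
    (hαβ : α + β = 3 / 2) : ∃ C : ℝ, 0 ≤ C ∧ ∀ θ : ℝ, 0 ≤ θ → ∀ f g : Space → Vec,
    AEStronglyMeasurable f volume → AEStronglyMeasurable g volume →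
    eLpNorm (fun ξ => wt θ 0 ξ • nl M f g ξ) 2 volume ≤ ENNReal.ofReal C *
      (eLpNorm (fun ξ => wt θ α ξ • f ξ) 2 volume *
        eLpNorm (fun ξ => wt θ (1 + β) ξ • g ξ) 2 volume) := by
  obtain ⟨C, hC, hconv⟩ := lintegral_convolution_sq_le hα hβ hαβ
  set K : ℝ≥0∞ := ∑ j, ‖advCLM M j‖ₑ with hK
  have hKtop : K ≠ ∞ := ENNReal.sum_ne_top.2 fun j _ => by simp
  refine ⟨K.toReal * C, by positivity, fun θ hθ f g hf hg => ?_⟩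
  let e : Space → ℝ≥0∞ := fun ξ => ENNReal.ofReal (Real.exp (θ * symA ξ))
  have hem : Measurable e := by
    have := measurable_symA
    fun_prop
  have hsm : Measurable fun ξ => ENNReal.ofReal (symA ξ) := by
    have := measurable_symA
    fun_prop
  let F : Space → ℝ≥0∞ := fun ξ => e ξ * ‖f ξ‖ₑ
  let H : Space → ℝ≥0∞ := fun ξ => e ξ * (ENNReal.ofReal (symA ξ) * ‖g ξ‖ₑ)
  have hF : AEMeasurable F volume := hem.aemeasurable.mul hf.enorm
  have hH : AEMeasurable H volume := hem.aemeasurable.mul (hsm.aemeasurable.mul hg.enorm)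
  have h1 (ξ : Space) : ‖wt θ 0 ξ • nl M f g ξ‖ₑ ≤ K * ∫⁻ η, F η * H (ξ - η) := by
    rw [enorm_wt_smul, Real.rpow_zero, ENNReal.ofReal_one, one_mul]
    calc e ξ * ‖nl M f g ξ‖ₑ ≤ e ξ * (K *
          ∫⁻ η, ‖f η‖ₑ * (ENNReal.ofReal (symA (ξ - η)) * ‖g (ξ - η)‖ₑ)) :=
          mul_le_mul' le_rfl (enorm_nl_le M f g ξ)
      _ = K * ∫⁻ η, e ξ * (‖f η‖ₑ * (ENNReal.ofReal (symA (ξ - η)) * ‖g (ξ - η)‖ₑ)) := by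
          rw [lintegral_const_mul' _ _ ENNReal.ofReal_ne_top]; ring
      _ ≤ _ := by
          refine mul_le_mul' le_rfl (lintegral_mono fun η => ?_)
          have h2 : e ξ ≤ e η * e (ξ - η) := by
            rw [← ENNReal.ofReal_mul (Real.exp_pos _).le, ← Real.exp_add, ← mul_add]
            exact ENNReal.ofReal_le_ofReal (Real.exp_le_exp.2
              (mul_le_mul_of_nonneg_left (symA_le_add ξ η) hθ))
          refine (mul_le_mul' h2 le_rfl).trans (le_of_eq ?_)
          simp only [F, H]
          ring
  have h2 : eLpNorm (fun ξ => wt θ 0 ξ • nl M f g ξ) 2 volume ^ 2 ≤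
      (ENNReal.ofReal (K.toReal * C) * (eLpNorm (fun ξ => wt θ α ξ • f ξ) 2 volume *
        eLpNorm (fun ξ => wt θ (1 + β) ξ • g ξ) 2 volume)) ^ 2 := by
    rw [ENNReal.ofReal_mul ENNReal.toReal_nonneg, ENNReal.ofReal_toReal hKtop, mul_pow, mul_pow,
      mul_pow, eLpNorm_two_sq, eLpNorm_two_sq, eLpNorm_two_sq]
    calc ∫⁻ ξ, ‖wt θ 0 ξ • nl M f g ξ‖ₑ ^ 2
        ≤ ∫⁻ ξ, K ^ 2 * (∫⁻ η, F η * H (ξ - η)) ^ 2 := by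
          refine lintegral_mono fun ξ => ?_
          rw [← mul_pow]
          exact pow_le_pow_left' (h1 ξ) 2
      _ = K ^ 2 * ∫⁻ ξ, (∫⁻ η, F η * H (ξ - η)) ^ 2 :=
          lintegral_const_mul' _ _ (ENNReal.pow_ne_top hKtop)
      _ ≤ K ^ 2 * (ENNReal.ofReal C ^ 2 * ((∫⁻ η, (‖η‖ₑ ^ α * F η) ^ 2) *
            ∫⁻ η, (‖η‖ₑ ^ β * H η) ^ 2)) := mul_le_mul' le_rfl (hconv F H hF hH)
      _ ≤ K ^ 2 * ENNReal.ofReal C ^ 2 * ((∫⁻ ξ, ‖wt θ α ξ • f ξ‖ₑ ^ 2) *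
            ∫⁻ ξ, ‖wt θ (1 + β) ξ • g ξ‖ₑ ^ 2) := by
          rw [← mul_assoc]
          refine mul_le_mul' le_rfl (mul_le_mul' ?_ ?_)
          · refine lintegral_mono fun η => pow_le_pow_left' ?_ 2
            rw [enorm_wt_smul, mul_assoc]
            exact mul_le_mul' (enorm_rpow_le_symA (by linarith) η) le_rfl
          · refine lintegral_mono_ae ?_
            filter_upwards [ae_ne_zero] with η hη
            refine pow_le_pow_left' ?_ 2
            rw [enorm_wt_smul, Real.rpow_add (symA_pos hη), Real.rpow_one,
              ENNReal.ofReal_mul (symA_nonneg η)]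
            calc ‖η‖ₑ ^ β * H η ≤ ENNReal.ofReal (symA η ^ β) * H η :=
                  mul_le_mul' (enorm_rpow_le_symA (by linarith) η) le_rfl
              _ = _ := by simp only [H, e]; ring
  exact (ENNReal.pow_le_pow_left_iff two_ne_zero).1 h2

theorem lintegral_lt_top_of_memLp {α : ℝ} (hα : 0 ≤ α) {f : Space → Vec}
    (h : MemLp (fun ξ => wt 0 α ξ • f ξ) 2 volume) : ∫⁻ η, (‖η‖ₑ ^ α * ‖f η‖ₑ) ^ 2 < ∞ := by
  have h1 := ENNReal.pow_lt_top (n := 2) h.2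
  rw [eLpNorm_two_sq] at h1
  refine lt_of_le_of_lt (lintegral_mono fun η => pow_le_pow_left' ?_ 2) h1
  rw [enorm_wt_smul]
  simpa using mul_le_mul' (enorm_rpow_le_symA hα η) le_rfl

theorem lintegral_dHat_lt_top {β : ℝ} (hβ : 0 ≤ β) (j : Fin 3) {g : Space → Vec}
    (h : MemLp (fun ξ => wt 0 (1 + β) ξ • g ξ) 2 volume) :
    ∫⁻ η, (‖η‖ₑ ^ β * ‖dHat j g η‖ₑ) ^ 2 < ∞ := by
  have h1 := ENNReal.pow_lt_top (n := 2) h.2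
  rw [eLpNorm_two_sq] at h1
  refine lt_of_le_of_lt (lintegral_mono_ae ?_) h1
  filter_upwards [ae_ne_zero] with η hη
  refine pow_le_pow_left' ?_ 2
  rw [enorm_wt_smul, Real.rpow_add (symA_pos hη), Real.rpow_one,
    ENNReal.ofReal_mul (symA_nonneg η)]
  calc ‖η‖ₑ ^ β * ‖dHat j g η‖ₑ ≤ ENNReal.ofReal (symA η ^ β) *
        (ENNReal.ofReal (symA η) * ‖g η‖ₑ) :=
        mul_le_mul' (enorm_rpow_le_symA hβ η) (enorm_dHat_le j g η)
    _ = _ := by simp; ring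

/-- The exponents are α = 5/4 for u and β = 1/4 for the derivative of v, which uses exactly 5/4
powers on both. -/
theorem fourier_classL2_advect (M : Matrix (Fin 3) (Fin 3) ℝ) {u v : VecDist}
    (hu : MemHdot (5 / 4) u) (hv : MemHdot (5 / 4) v) :
    MemLp (nl M (hat u) (hat v)) 2 volume ∧ MemLp (advect M u v) 2 volume ∧
      (𝓕 (classL2 (advect M u v)) : VecL2) = classL2 (nl M (hat u) (hat v)) := by
  have hv' : MemLp (fun ξ => wt 0 (1 + 1 / 4) ξ • hat v ξ) 2 volume := by
    have := hv.2
    rw [weightedHat_eq] at this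
    norm_num at this ⊢
    exact this
  have key (j : Fin 3) := product_fourier (α := 5 / 4) (β := 1 / 4) (by norm_num) (by norm_num)
    (by norm_num) (advCLM M j) hu.isFun (isFun_fourier_lineDeriv hv.isFun j)
    (lintegral_lt_top_of_memLp (by norm_num) hu.2) (lintegral_dHat_lt_top (by norm_num) j hv')
  have h1 : MemLp (nl M (hat u) (hat v)) 2 volume := memLp_finsetSum _ fun j _ => (key j).1
  have h2 : classL2 (nl M (hat u) (hat v)) =
      ∑ j, classL2 (convolution (hat u) (dHat j (hat v)) (advCLM M j) volume) := by
    simp only [Fin.sum_univ_three]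
    have h01 : MemLp (fun x => convolution (hat u) (dHat 0 (hat v)) (advCLM M 0) volume x +
        convolution (hat u) (dHat 1 (hat v)) (advCLM M 1) volume x) 2 volume :=
      (key 0).1.add (key 1).1
    rw [← classL2_add (key 0).1 (key 1).1, ← classL2_add h01 (key 2).1]
    congr 1
    ext1 ξ
    simp [nl, Fin.sum_univ_three]
  have h3 : (𝓕⁻ (classL2 (nl M (hat u) (hat v))) : VecL2) =ᵐ[volume] advect M u v := by
    have h4 : (𝓕⁻ (classL2 (nl M (hat u) (hat v))) : VecL2) = ∑ j,
        (𝓕⁻ (classL2 (convolution (hat u) (dHat j (hat v)) (advCLM M j) volume)) : VecL2) := by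
      rw [h2]
      exact map_sum (Lp.fourierTransformₗᵢ Space Vec).symm _ _
    rw [h4, Fin.sum_univ_three]
    filter_upwards [(key 0).2, (key 1).2, (key 2).2, Lp.coeFn_add
      ((𝓕⁻ (classL2 (convolution (hat u) (dHat 0 (hat v)) (advCLM M 0) volume)) : VecL2) +
       (𝓕⁻ (classL2 (convolution (hat u) (dHat 1 (hat v)) (advCLM M 1) volume)) : VecL2))
       (𝓕⁻ (classL2 (convolution (hat u) (dHat 2 (hat v)) (advCLM M 2) volume)) : VecL2),
      Lp.coeFn_add
      (𝓕⁻ (classL2 (convolution (hat u) (dHat 0 (hat v)) (advCLM M 0) volume)) : VecL2)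
       (𝓕⁻ (classL2 (convolution (hat u) (dHat 1 (hat v)) (advCLM M 1) volume)) : VecL2)]
      with x k0 k1 k2 k3 k4
    rw [k3, Pi.add_apply, k4, Pi.add_apply, ← k0, ← k1, ← k2, advect, Fin.sum_univ_three]
    simp only [advCLM_apply]
  refine ⟨h1, (memLp_congr_ae h3).1 (Lp.memLp _), ?_⟩
  rw [← eq_classL2 h3, FourierTransform.fourier_fourierInv_eq]

end NavierStokes

/-! ### Projection, heat semigroup, and the Duhamel formula in Fourier space. -/

namespace NavierStokes

/-! ### The fibered projection -/

theorem norm_toEuclideanLin_le {P : Matrix (Fin 3) (Fin 3) ℂ} (hP : P.IsHermitian)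
    (hi : P * P = P) (v : Vec) : ‖Matrix.toEuclideanLin P v‖ ≤ ‖v‖ := by
  have hs := Matrix.isSymmetric_toEuclideanLin_iff.2 hP
  have h2 : Matrix.toEuclideanLin P (Matrix.toEuclideanLin P v) = Matrix.toEuclideanLin P v := by
    simp [Matrix.toEuclideanLin, Matrix.toLpLin_apply, hi]
  have h1 : ‖Matrix.toEuclideanLin P v‖ ^ 2 ≤ ‖v‖ * ‖Matrix.toEuclideanLin P v‖ := by
    have : inner ℂ (Matrix.toEuclideanLin P v) (Matrix.toEuclideanLin P v) =
        inner ℂ v (Matrix.toEuclideanLin P v) := by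
      rw [hs, h2]
    have h3 := norm_inner_le_norm (𝕜 := ℂ) v (Matrix.toEuclideanLin P v)
    rw [← this, inner_self_eq_norm_sq_to_K] at h3
    simpa using h3
  by_contra! h
  nlinarith [norm_nonneg v]

variable {P : Space → Matrix (Fin 3) (Fin 3) ℂ}

theorem IsFiberedProjection.aestronglyMeasurable (hP : IsFiberedProjection P) {f : Space → Vec}
    (hf : AEStronglyMeasurable f volume) :
    AEStronglyMeasurable (fun ξ => Matrix.toEuclideanLin (P ξ) (f ξ)) volume := by
  have h : (fun ξ => Matrix.toEuclideanLin (P ξ) (f ξ)) = fun ξ => ∑ i, ∑ k,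
      (P ξ i k * f ξ k) • (EuclideanSpace.single i 1 : Vec) := by
    ext ξ i
    fin_cases i <;> simp [Matrix.toEuclideanLin, Matrix.toLpLin_apply, Matrix.mulVec, dotProduct,
      Fin.sum_univ_three]
  rw [h]
  refine Finset.aestronglyMeasurable_fun_sum _ fun i _ => ?_
  refine Finset.aestronglyMeasurable_fun_sum _ fun k _ => ?_
  refine AEStronglyMeasurable.smul_const ?_ _
  refine (hP.measurable i k).aestronglyMeasurable.mul ?_
  exact (EuclideanSpace.proj k : Vec →L[ℂ] ℂ).continuous.comp_aestronglyMeasurable hf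

theorem IsFiberedProjection.norm_le (hP : IsFiberedProjection P) (ξ : Space) (v : Vec) :
    ‖Matrix.toEuclideanLin (P ξ) v‖ ≤ ‖v‖ :=
  norm_toEuclideanLin_le (hP.isHermitian ξ) (hP.idempotent ξ) v

theorem IsFiberedProjection.memLp (hP : IsFiberedProjection P) {f : Space → Vec}
    (hf : MemLp f 2 volume) : MemLp (fun ξ => Matrix.toEuclideanLin (P ξ) (f ξ)) 2 volume :=
  hf.mono (hP.aestronglyMeasurable hf.1) (ae_of_all _ fun ξ => hP.norm_le ξ _)

/-- The projection `P`, in Fourier space. -/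
def projL2 (P : Space → Matrix (Fin 3) (Fin 3) ℂ) (f : VecL2) : VecL2 :=
  classL2 (fun ξ => Matrix.toEuclideanLin (P ξ) (f ξ))

theorem coeFn_projL2 (hP : IsFiberedProjection P) (f : VecL2) :
    projL2 P f =ᵐ[volume] fun ξ => Matrix.toEuclideanLin (P ξ) (f ξ) :=
  coeFn_classL2 (hP.memLp (Lp.memLp f))

theorem projL2_sub (hP : IsFiberedProjection P) (f g : VecL2) :
    projL2 P (f - g) = projL2 P f - projL2 P g := by
  rw [projL2, projL2, projL2, ← classL2_sub (hP.memLp (Lp.memLp f)) (hP.memLp (Lp.memLp g))]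
  refine classL2_congr ?_
  filter_upwards [Lp.coeFn_sub f g] with ξ hξ
  rw [hξ, Pi.sub_apply, map_sub]

/-! ### The heat semigroup -/

/-- The symbol of `exp(-τ A²)`. -/
def hk (τ : ℝ) (ξ : Space) : ℝ := Real.exp (-τ * symA ξ ^ 2)

theorem hk_pos (τ : ℝ) (ξ : Space) : 0 < hk τ ξ := Real.exp_pos _

theorem measurable_hk (τ : ℝ) : Measurable (hk τ) := by
  unfold hk
  have := measurable_symA
  fun_prop

theorem abs_hk_le {τ : ℝ} (hτ : 0 ≤ τ) (ξ : Space) : |hk τ ξ| ≤ 1 := by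
  rw [abs_of_pos (hk_pos τ ξ), hk, Real.exp_le_one_iff]
  have := mul_nonneg hτ (sq_nonneg (symA ξ))
  linarith

theorem isMul_hk {τ : ℝ} (hτ : 0 ≤ τ) : IsMul (hk τ) := ⟨measurable_hk τ, 1, abs_hk_le hτ⟩

theorem hasTemperateGrowth_hk {t : ℝ} (ht : 0 ≤ t) :
    (fun ξ : Space => ((Real.exp (-t * symA ξ ^ 2) : ℝ) : ℂ)).HasTemperateGrowth := by
  have hf : (fun ξ : Space => t * symA ξ ^ 2).HasTemperateGrowth := by
    have h := (Function.hasTemperateGrowth_norm_sq (H := Space))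
    have : (fun ξ : Space => t * symA ξ ^ 2) = fun ξ => (t * (2 * Real.pi) ^ 2) * ‖ξ‖ ^ 2 := by
      ext ξ; unfold symA; ring
    rw [this]
    exact (Function.HasTemperateGrowth.const _).mul h
  have h2 : ((fun y : ℝ => Real.exp (-y)) ∘ fun ξ : Space => t * symA ξ ^ 2).HasTemperateGrowth := by
    have hexp : ContDiff ℝ ((⊤ : ℕ∞) : WithTop ℕ∞) fun y : ℝ => Real.exp (-y) :=
      Real.contDiff_exp.comp contDiff_neg
    -- All derivatives of exp(-y) are bounded by 1 on the half line y ≥ 0 but grow exponentially for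
    -- y < 0. The composition is therefore taken on `Set.Ici 0`, which contains the values t|A|²
    -- since t ≥ 0.
    refine Function.HasTemperateGrowth.comp' (t := Set.Ici 0) ?_ (uniqueDiffOn_Ici 0)
      hexp.contDiffOn ?_ hf
    · rintro _ ⟨ξ, rfl⟩
      exact mul_nonneg ht (sq_nonneg _)
    · intro N
      refine ⟨0, 1, zero_le_one, fun n _ x hx => ?_⟩
      rw [iteratedFDerivWithin_eq_iteratedFDeriv (uniqueDiffOn_Ici 0)
        (hexp.of_le (by exact_mod_cast le_top)).contDiffAt hx,
        norm_iteratedFDeriv_eq_norm_iteratedDeriv]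
      have := congrFun (iteratedDeriv_exp_const_mul n (-1)) x
      simp only [neg_mul, one_mul] at this
      rw [this]
      simpa using hx
  have h3 := Function.HasTemperateGrowth.comp
    (by fun_prop : Function.HasTemperateGrowth Complex.ofReal) h2
  convert h3 using 2
  simp

theorem isFun_fourier_heat {T : VecDist} {f : Space → Vec} (h : IsFun (𝓕 T) f) {t : ℝ}
    (ht : 0 ≤ t) : IsFun (𝓕 (heat t T)) (fun ξ => hk t ξ • f ξ) := by
  rw [heat, TemperedDistribution.fourierMultiplierCLM_apply,
    FourierTransform.fourier_fourierInv_eq]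
  exact h.smulLeft (hasTemperateGrowth_hk ht)

theorem hat_heat {T : VecDist} (h : ∃ f, IsFun (𝓕 T) f) {t : ℝ} (ht : 0 ≤ t) :
    hat (heat t T) =ᵐ[volume] fun ξ => hk t ξ • hat T ξ :=
  (isFun_fourier_heat (isFun_toFun h) ht).toFun_ae_eq

/-! ### Forcing and Duhamel terms -/

/-- The Fourier transform of `P (M u · ∇) v`. -/
def forc (P : Space → Matrix (Fin 3) (Fin 3) ℂ) (M : Matrix (Fin 3) (Fin 3) ℝ) (u v : VecDist) :
    VecL2 := projL2 P (𝓕 (classL2 (advect M u v)))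

/-- The Duhamel integral with forcing `F`, in Fourier space. -/
def duh (F : ℝ → VecL2) (t : ℝ) : VecL2 := ∫ s in (0 : ℝ)..t, mulCLM (hk (t - s)) (F s)

variable {M : Matrix (Fin 3) (Fin 3) ℝ}

theorem heatProj_eq (hP : IsFiberedProjection P) {τ : ℝ} (hτ : 0 ≤ τ) (f : VecL2) :
    heatProj P τ f = 𝓕⁻ (mulCLM (hk τ) (projL2 P (𝓕 f))) := by
  rw [heatProj, mulCLM_apply (isMul_hk hτ)]
  congr 1
  refine classL2_congr ?_
  filter_upwards [coeFn_projL2 hP (𝓕 f)] with ξ hξ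
  rw [hξ]
  rfl

theorem bil_eq (hP : IsFiberedProjection P) (u v : ℝ → VecDist) {t : ℝ} (ht : 0 ≤ t) :
    bil P M u v t =
      Lp.toTemperedDistribution (𝓕⁻ (-duh (fun s => forc P M (u s) (v s)) t) : VecL2) := by
  have h : ∫ s in (0 : ℝ)..t, heatProj P (t - s) (classL2 (advect M (u s) (v s))) =
      (𝓕⁻ (duh (fun s => forc P M (u s) (v s)) t) : VecL2) := by
    have h1 : ∫ s in (0 : ℝ)..t, heatProj P (t - s) (classL2 (advect M (u s) (v s))) =
        ∫ s in (0 : ℝ)..t, (Lp.fourierTransformₗᵢ Space Vec).symm.toContinuousLinearEquiv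
          (mulCLM (hk (t - s)) (forc P M (u s) (v s))) := by
      refine intervalIntegral.integral_congr fun s hs => ?_
      rw [Set.uIcc_of_le ht] at hs
      exact heatProj_eq hP (sub_nonneg.2 hs.2) _
    rw [h1, intervalIntegral.integral_of_le ht, ContinuousLinearEquiv.integral_comp_comm,
      ← intervalIntegral.integral_of_le ht]
    rfl
  rw [bil, h]
  congr 1
  exact (map_neg (Lp.fourierTransformₗᵢ Space Vec).symm _).symm

theorem isFun_fourier_bil (hP : IsFiberedProjection P) (u v : ℝ → VecDist) {t : ℝ} (ht : 0 ≤ t) :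
    IsFun (𝓕 (bil P M u v t)) (fun ξ => -(duh (fun s => forc P M (u s) (v s)) t) ξ) := by
  rw [bil_eq hP u v ht, Lp.fourier_toTemperedDistribution_eq,
    FourierTransform.fourier_fourierInv_eq]
  exact (isFun_toTemperedDistribution _).congr (Lp.coeFn_neg _)

theorem hat_bil (hP : IsFiberedProjection P) (u v : ℝ → VecDist) {t : ℝ} (ht : 0 ≤ t) :
    hat (bil P M u v t) =ᵐ[volume] fun ξ => -(duh (fun s => forc P M (u s) (v s)) t) ξ :=
  (isFun_fourier_bil hP u v ht).toFun_ae_eq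

/-- The regularity 5/4 only serves to identify the transform of the product. The estimate itself
holds for every admissible pair of exponents, possibly with an infinite right-hand side; the pairs
(5/4, 1/4) and (3/4, 3/4) are needed. -/
theorem eLpNorm_forc_le (hP : IsFiberedProjection P) (M : Matrix (Fin 3) (Fin 3) ℝ) {α β : ℝ}
    (hα : α < 3 / 2) (hβ : β < 3 / 2) (hαβ : α + β = 3 / 2) : ∃ C : ℝ, 0 ≤ C ∧ ∀ θ : ℝ, 0 ≤ θ →
    ∀ u v : VecDist, MemHdot (5 / 4) u → MemHdot (5 / 4) v →
    eLpNorm (fun ξ => wt θ 0 ξ • forc P M u v ξ) 2 volume ≤ ENNReal.ofReal C *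
      (eLpNorm (fun ξ => wt θ α ξ • hat u ξ) 2 volume *
        eLpNorm (fun ξ => wt θ (1 + β) ξ • hat v ξ) 2 volume) := by
  obtain ⟨C, hC, h⟩ := eLpNorm_nl_le M hα hβ hαβ
  refine ⟨C, hC, fun θ hθ u v hu hv => ?_⟩
  obtain ⟨h1, -, h3⟩ := fourier_classL2_advect M hu hv
  refine le_trans ?_ (h θ hθ _ _ hu.isFun.1 hv.isFun.1)
  refine eLpNorm_mono_ae ?_
  have h4 : forc P M u v = projL2 P (classL2 (nl M (hat u) (hat v))) := by rw [forc, h3]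
  rw [h4]
  filter_upwards [coeFn_projL2 hP (classL2 (nl M (hat u) (hat v))), coeFn_classL2 h1] with ξ h5 h6
  rw [h5, h6, norm_smul, norm_smul]
  exact mul_le_mul_of_nonneg_left (hP.norm_le ξ _) (norm_nonneg _)

theorem MemHdot.isFun {u : VecDist} (hu : MemHdot (5 / 4) u) : IsFun u (toFun u) := by
  have h1 := lintegral_lt_top_of_memLp (by norm_num) hu.2
  have hf := InDom.isFun hu
  exact isFun_toFun ⟨_, isFun_of_fourier_eq_add (chi_smul_integrable (by norm_num) hf.1 h1 7)
    (memLp_tail (by norm_num) hf.1 h1 le_rfl) (by simpa using hf)⟩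

theorem MemHdot.isFun_lineDeriv {u : VecDist} (hu : MemHdot (5 / 4) u) (j : Fin 3) :
    IsFun (∂_{(EuclideanSpace.single j 1 : Space)} u)
      (toFun (∂_{(EuclideanSpace.single j 1 : Space)} u)) := by
  have hf := InDom.isFun hu
  have hu' : MemLp (fun ξ => wt 0 (1 + 1 / 4) ξ • hat u ξ) 2 volume := by
    have := hu.2
    rw [weightedHat_eq] at this
    norm_num at this ⊢
    exact this
  have h1 := lintegral_dHat_lt_top (β := 1 / 4) (by norm_num) j hu'
  have h2 := isFun_fourier_lineDeriv hf j
  exact isFun_toFun ⟨_, isFun_of_fourier_eq_add (chi_smul_integrable (by norm_num) h2.1 h1 7)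
    (memLp_tail (by norm_num) h2.1 h1 le_rfl) (by simpa using h2)⟩

theorem fourier_sub_dist (u w : VecDist) : 𝓕 (u - w) = 𝓕 u - 𝓕 w :=
  map_sub (FourierTransform.fourierCLM ℂ VecDist) u w

theorem fourier_add_dist (u w : VecDist) : 𝓕 (u + w) = 𝓕 u + 𝓕 w :=
  map_add (FourierTransform.fourierCLM ℂ VecDist) u w

theorem hat_sub {u w : VecDist} (hu : ∃ f, IsFun (𝓕 u) f) (hw : ∃ f, IsFun (𝓕 w) f) :
    hat (u - w) =ᵐ[volume] fun ξ => hat u ξ - hat w ξ := by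
  have := (isFun_toFun hu).sub (isFun_toFun hw)
  rw [← fourier_sub_dist] at this
  exact this.toFun_ae_eq

theorem hat_add {u w : VecDist} (hu : ∃ f, IsFun (𝓕 u) f) (hw : ∃ f, IsFun (𝓕 w) f) :
    hat (u + w) =ᵐ[volume] fun ξ => hat u ξ + hat w ξ := by
  have := (isFun_toFun hu).add (isFun_toFun hw)
  rw [← fourier_add_dist] at this
  exact this.toFun_ae_eq

theorem InDom.sub {θ r : ℝ} {u w : VecDist} (hu : InDom θ r u) (hw : InDom θ r w) :
    InDom θ r (u - w) := by
  have h := hu.isFun.sub hw.isFun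
  rw [← fourier_sub_dist] at h
  refine ⟨⟨_, h⟩, ?_⟩
  refine (memLp_congr_ae ?_).1 (hu.2.sub hw.2)
  filter_upwards [hat_sub hu.1 hw.1] with ξ hξ
  simp only [weightedHat_eq, Pi.sub_apply, hξ, smul_sub]

theorem InDom.add {θ r : ℝ} {u w : VecDist} (hu : InDom θ r u) (hw : InDom θ r w) :
    InDom θ r (u + w) := by
  have h := hu.isFun.add hw.isFun
  rw [← fourier_add_dist] at h
  refine ⟨⟨_, h⟩, ?_⟩
  refine (memLp_congr_ae ?_).1 (hu.2.add hw.2)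
  filter_upwards [hat_add hu.1 hw.1] with ξ hξ
  simp only [weightedHat_eq, Pi.add_apply, hξ, smul_add]

theorem expA_sub {θ r : ℝ} {u w : VecDist} (hu : InDom θ r u) (hw : InDom θ r w) :
    expA θ r (u - w) = expA θ r u - expA θ r w := by
  rw [expA, expA, expA]
  have h : classL2 (weightedHat θ r (u - w)) =
      classL2 (weightedHat θ r u) - classL2 (weightedHat θ r w) := by
    rw [← classL2_sub hu.2 hw.2]
    refine classL2_congr ?_
    filter_upwards [hat_sub hu.1 hw.1] with ξ hξ
    simp only [weightedHat_eq, hξ, smul_sub]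
  rw [h]
  exact map_sub (Lp.fourierTransformₗᵢ Space Vec).symm _ _

theorem expA_add {θ r : ℝ} {u w : VecDist} (hu : InDom θ r u) (hw : InDom θ r w) :
    expA θ r (u + w) = expA θ r u + expA θ r w := by
  rw [expA, expA, expA]
  have h : classL2 (weightedHat θ r (u + w)) =
      classL2 (weightedHat θ r u) + classL2 (weightedHat θ r w) := by
    rw [← classL2_add hu.2 hw.2]
    refine classL2_congr ?_
    filter_upwards [hat_add hu.1 hw.1] with ξ hξ
    simp only [weightedHat_eq, hξ, smul_add]
  rw [h]
  exact map_add (Lp.fourierTransformₗᵢ Space Vec).symm _ _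

theorem fourier_sub_L2 (f g : VecL2) : (𝓕 (f - g) : VecL2) = 𝓕 f - 𝓕 g :=
  map_sub (Lp.fourierTransformₗᵢ Space Vec) f g

theorem forc_sub_left (hP : IsFiberedProjection P) {u w v : VecDist} (hu : MemHdot (5 / 4) u)
    (hw : MemHdot (5 / 4) w) (hv : MemHdot (5 / 4) v) :
    forc P M (u - w) v = forc P M u v - forc P M w v := by
  rw [forc, forc, forc, ← projL2_sub hP, ← fourier_sub_L2,
    ← classL2_sub (fourier_classL2_advect M hu hv).2.1 (fourier_classL2_advect M hw hv).2.1]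
  congr 2
  refine classL2_congr ?_
  filter_upwards [(hu.isFun.sub hw.isFun).toFun_ae_eq] with x hx
  simp only [advect, hx]
  rw [← Finset.sum_sub_distrib]
  refine Finset.sum_congr rfl fun j _ => ?_
  rw [← sub_smul, ← Finset.sum_sub_distrib]
  congr 1
  refine Finset.sum_congr rfl fun k _ => ?_
  rw [PiLp.sub_apply, mul_sub]

theorem lineDeriv_sub_dist (u w : VecDist) (m : Space) : ∂_{m} (u - w) = ∂_{m} u - ∂_{m} w :=
  map_sub (LineDeriv.lineDerivOpCLM ℂ VecDist m) u w

theorem forc_sub_right (hP : IsFiberedProjection P) {u v w : VecDist} (hu : MemHdot (5 / 4) u)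
    (hv : MemHdot (5 / 4) v) (hw : MemHdot (5 / 4) w) :
    forc P M u (v - w) = forc P M u v - forc P M u w := by
  rw [forc, forc, forc, ← projL2_sub hP, ← fourier_sub_L2,
    ← classL2_sub (fourier_classL2_advect M hu hv).2.1 (fourier_classL2_advect M hu hw).2.1]
  congr 2
  refine classL2_congr ?_
  have h : ∀ j : Fin 3, ∀ᵐ x, toFun (∂_{(EuclideanSpace.single j 1 : Space)} (v - w)) x =
      toFun (∂_{(EuclideanSpace.single j 1 : Space)} v) x -
      toFun (∂_{(EuclideanSpace.single j 1 : Space)} w) x := fun j => by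
    rw [lineDeriv_sub_dist]
    exact ((hv.isFun_lineDeriv j).sub (hw.isFun_lineDeriv j)).toFun_ae_eq
  filter_upwards [ae_all_iff.2 h] with x hx
  simp only [advect, hx]
  rw [← Finset.sum_sub_distrib]
  refine Finset.sum_congr rfl fun j _ => ?_
  rw [smul_sub]

end NavierStokes

/-! ### Smoothing estimates with exponential weights linear in time. -/

namespace NavierStokes

/-! ### Pointwise estimates for the weighted heat kernel -/

/-- With z = y - ν/2 the exponent is ν²/4 - z². Moreover y ≤ (1+|z|)⟨ν⟩ and (1+|z|)^a ≤ exp(a|z|),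
and a|z| - z² ≤ a²/4. -/
theorem rpow_mul_exp_le_aux {a y ν : ℝ} (ha : 0 ≤ a) (hy : 0 ≤ y) :
    y ^ a * Real.exp (ν * y - y ^ 2) ≤
      Real.exp (a ^ 2 / 4) * (1 + ν ^ 2) ^ (a / 2) * Real.exp (ν ^ 2 / 4) := by
  set z := y - ν / 2 with hz
  have h1 : y ≤ (1 + |z|) * Real.sqrt (1 + ν ^ 2) := by
    have h2 : 1 ≤ Real.sqrt (1 + ν ^ 2) := Real.one_le_sqrt.2 (by nlinarith)
    have h3 : ν ≤ Real.sqrt (1 + ν ^ 2) := Real.le_sqrt_of_sq_le (by nlinarith)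
    have h4 : z ≤ |z| := le_abs_self z
    nlinarith [abs_nonneg z]
  have h2 : y ^ a ≤ Real.exp (a * |z|) * (1 + ν ^ 2) ^ (a / 2) := by
    calc y ^ a ≤ ((1 + |z|) * Real.sqrt (1 + ν ^ 2)) ^ a := Real.rpow_le_rpow hy h1 ha
      _ = (1 + |z|) ^ a * (1 + ν ^ 2) ^ (a / 2) := by
          rw [Real.mul_rpow (by positivity) (by positivity), Real.sqrt_eq_rpow,
            ← Real.rpow_mul (by positivity)]
          ring_nf
      _ ≤ Real.exp |z| ^ a * (1 + ν ^ 2) ^ (a / 2) := by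
          gcongr
          linarith [Real.add_one_le_exp |z|]
      _ = _ := by rw [← Real.exp_mul, mul_comm a]
  calc y ^ a * Real.exp (ν * y - y ^ 2)
      ≤ (Real.exp (a * |z|) * (1 + ν ^ 2) ^ (a / 2)) * Real.exp (ν * y - y ^ 2) := by gcongr
    _ = (1 + ν ^ 2) ^ (a / 2) * Real.exp (a * |z| - |z| ^ 2 + ν ^ 2 / 4) := by
        rw [mul_comm (Real.exp _), mul_assoc, ← Real.exp_add]
        congr 2
        rw [sq_abs, hz]; ring
    _ ≤ (1 + ν ^ 2) ^ (a / 2) * Real.exp (a ^ 2 / 4 + ν ^ 2 / 4) := by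
        gcongr
        nlinarith [sq_nonneg (|z| - a / 2)]
    _ = _ := by rw [Real.exp_add]; ring

/-- Parabolic scaling y = √τ x, ν = μ√τ. -/
theorem rpow_mul_exp_le {a τ μ x : ℝ} (ha : 0 ≤ a) (hτ : 0 < τ) (hx : 0 ≤ x) :
    x ^ a * Real.exp (μ * τ * x - τ * x ^ 2) ≤ Real.exp (a ^ 2 / 4) * τ ^ (-(a / 2)) *
      ((1 + μ ^ 2 * τ) ^ (a / 2) * Real.exp (μ ^ 2 * τ / 4)) := by
  have h := rpow_mul_exp_le_aux (ν := μ * Real.sqrt τ) ha (mul_nonneg (Real.sqrt_nonneg τ) hx)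
  have hs : Real.sqrt τ ^ 2 = τ := Real.sq_sqrt hτ.le
  have e1 : μ * Real.sqrt τ * (Real.sqrt τ * x) - (Real.sqrt τ * x) ^ 2 =
      μ * τ * x - τ * x ^ 2 := by
    rw [mul_pow, hs]; linear_combination (μ * x) * hs
  have e2 : (μ * Real.sqrt τ) ^ 2 = μ ^ 2 * τ := by rw [mul_pow, hs]
  have e3 : (Real.sqrt τ * x) ^ a = τ ^ (a / 2) * x ^ a := by
    rw [Real.mul_rpow (Real.sqrt_nonneg _) hx, Real.sqrt_eq_rpow, ← Real.rpow_mul hτ.le]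
    ring_nf
  rw [e1, e2, e3] at h
  have h2 : τ ^ (-(a / 2)) * τ ^ (a / 2) = 1 := by
    rw [← Real.rpow_add hτ]; simp
  have h3 : 0 < τ ^ (-(a / 2)) := Real.rpow_pos_of_pos hτ _
  calc x ^ a * Real.exp (μ * τ * x - τ * x ^ 2)
      = τ ^ (-(a / 2)) * (τ ^ (a / 2) * x ^ a * Real.exp (μ * τ * x - τ * x ^ 2)) := by
        rw [← mul_assoc, ← mul_assoc, h2, one_mul]
    _ ≤ τ ^ (-(a / 2)) * (Real.exp (a ^ 2 / 4) * (1 + μ ^ 2 * τ) ^ (a / 2) *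
          Real.exp (μ ^ 2 * τ / 4)) := by gcongr
    _ = _ := by ring

/-! ### Time integrals -/

/-- The singularities sit at opposite ends: on each half of [0, 1] one of the two factors is at most
2. -/
theorem intervalIntegrable_beta {a : ℝ} (ha : 0 ≤ a) (ha1 : a < 1) :
    IntervalIntegrable (fun σ : ℝ => (1 - σ) ^ (-a) * σ ^ (-(3 / 4) : ℝ)) volume 0 1 := by
  have h1 : IntervalIntegrable (fun σ : ℝ => σ ^ (-(3 / 4) : ℝ)) volume 0 1 :=
    intervalIntegral.intervalIntegrable_rpow' (by norm_num)
  have h2 : IntervalIntegrable (fun σ : ℝ => (1 - σ) ^ (-a)) volume 0 1 := by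
    have := (intervalIntegral.intervalIntegrable_rpow' (a := 0) (b := 1) (r := -a)
      (by linarith)).comp_sub_left 1
    simpa using this.symm
  have h3 := (h1.add h2).const_mul 2
  refine h3.mono_fun' ?_ ?_
  · exact (Measurable.aestronglyMeasurable (by fun_prop))
  · rw [Set.uIoc_of_le zero_le_one]
    have hne : ∀ᵐ s ∂(volume.restrict (Set.Ioc (0 : ℝ) 1)), s ≠ 1 := by
      refine ae_restrict_of_ae ?_
      simp [ae_iff]
    filter_upwards [ae_restrict_mem measurableSet_Ioc, hne] with σ hσ h1
    have hσ0 : 0 < σ := hσ.1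
    have hσ1 : 0 < 1 - σ := sub_pos.2 (lt_of_le_of_ne hσ.2 h1)
    have hp : 0 < (1 - σ) ^ (-a) := Real.rpow_pos_of_pos hσ1 _
    have hq : 0 < σ ^ (-(3 / 4) : ℝ) := Real.rpow_pos_of_pos hσ0 _
    rw [Real.norm_of_nonneg (by positivity)]
    have key (y c : ℝ) (hy : 1 / 2 ≤ y) (hc0 : 0 ≤ c) (hc : c ≤ 1) : y ^ (-c) ≤ 2 := by
      have h5 : (1 / 2 : ℝ) ^ (-c) = 2 ^ c := by
        rw [one_div, Real.inv_rpow (by norm_num), Real.rpow_neg (by norm_num), inv_inv]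
      calc y ^ (-c) ≤ (1 / 2 : ℝ) ^ (-c) :=
            Real.rpow_le_rpow_of_nonpos (by norm_num) hy (by linarith)
        _ = 2 ^ c := h5
        _ ≤ 2 ^ (1 : ℝ) := Real.rpow_le_rpow_of_exponent_le (by norm_num) hc
        _ = 2 := Real.rpow_one 2
    rcases le_total (1 / 2) σ with h | h
    · have := key σ (3 / 4) h (by norm_num) (by norm_num)
      nlinarith
    · have := key (1 - σ) a (by linarith) ha ha1.le
      nlinarith

/-- The value of a beta integral. -/
def betaC (a : ℝ) : ℝ := ∫ σ in (0 : ℝ)..1, (1 - σ) ^ (-a) * σ ^ (-(3 / 4) : ℝ)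

theorem betaC_nonneg (a : ℝ) : 0 ≤ betaC a := by
  refine intervalIntegral.integral_nonneg zero_le_one fun σ hσ => ?_
  exact mul_nonneg (Real.rpow_nonneg (sub_nonneg.2 hσ.2) _) (Real.rpow_nonneg hσ.1 _)

theorem beta_scale {a t : ℝ} (ht : 0 < t) {σ : ℝ} (h0 : 0 ≤ σ) (h1 : σ ≤ 1) :
    (t - t * σ) ^ (-a) * (t * σ) ^ (-(3 / 4) : ℝ) =
      t ^ (-a - 3 / 4) * ((1 - σ) ^ (-a) * σ ^ (-(3 / 4) : ℝ)) := by
  rw [show t - t * σ = t * (1 - σ) by ring, Real.mul_rpow ht.le (sub_nonneg.2 h1),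
    Real.mul_rpow ht.le h0, sub_eq_add_neg (-a), Real.rpow_add ht]
  ring

theorem intervalIntegrable_beta_scaled {a t : ℝ} (ha : 0 ≤ a) (ha1 : a < 1) (ht : 0 < t) :
    IntervalIntegrable (fun s : ℝ => (t - s) ^ (-a) * s ^ (-(3 / 4) : ℝ)) volume 0 t := by
  have h := ((intervalIntegrable_beta ha ha1).const_mul (t ^ (-a - 3 / 4))).comp_mul_left
    (c := t⁻¹)
  rw [zero_div, one_div, inv_inv] at h
  refine h.congr ?_
  rw [Set.uIoc_of_le ht.le]
  intro s hs
  have h1 := beta_scale (a := a) ht (σ := t⁻¹ * s) (mul_nonneg (inv_nonneg.2 ht.le) hs.1.le)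
    (by rw [inv_mul_le_iff₀ ht]; simpa using hs.2)
  rw [mul_inv_cancel_left₀ ht.ne'] at h1
  exact h1.symm

theorem integral_beta_scaled {a t : ℝ} (ht : 0 < t) :
    ∫ s in (0 : ℝ)..t, (t - s) ^ (-a) * s ^ (-(3 / 4) : ℝ) = t ^ (1 / 4 - a) * betaC a := by
  have h := intervalIntegral.integral_comp_mul_left
    (fun s : ℝ => (t - s) ^ (-a) * s ^ (-(3 / 4) : ℝ)) ht.ne' (a := 0) (b := 1)
  rw [mul_zero, mul_one] at h
  have h2 : ∫ s in (0 : ℝ)..t, (t - s) ^ (-a) * s ^ (-(3 / 4) : ℝ) =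
      t * ∫ σ in (0 : ℝ)..1, (t - t * σ) ^ (-a) * (t * σ) ^ (-(3 / 4) : ℝ) := by
    rw [h, smul_eq_mul, mul_inv_cancel_left₀ ht.ne']
  have h3 : ∫ σ in (0 : ℝ)..1, (t - t * σ) ^ (-a) * (t * σ) ^ (-(3 / 4) : ℝ) =
      ∫ σ in (0 : ℝ)..1, t ^ (-a - 3 / 4) * ((1 - σ) ^ (-a) * σ ^ (-(3 / 4) : ℝ)) := by
    refine intervalIntegral.integral_congr fun σ hσ => ?_
    rw [Set.uIcc_of_le zero_le_one] at hσ
    exact beta_scale ht hσ.1 hσ.2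
  rw [h2, h3, intervalIntegral.integral_const_mul, ← mul_assoc, betaC]
  congr 1
  rw [show (1 / 4 - a) = 1 + (-a - 3 / 4) by ring, Real.rpow_add ht, Real.rpow_one]

/-! ### Weighted estimates of Duhamel terms -/

/-- This is where linearity of the weight in time is used: μt = μ(t-s) + μs. The first part is left
to the heat factor and the second is the weight of the forcing at time s. -/
theorem wt_mul_hk_eq (μ r t s : ℝ) (ξ : Space) : wt (μ * t) r ξ * hk (t - s) ξ =
    (symA ξ ^ r * Real.exp (μ * (t - s) * symA ξ - (t - s) * symA ξ ^ 2)) * wt (μ * s) 0 ξ := by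
  have h : Real.exp (μ * t * symA ξ) * Real.exp (-(t - s) * symA ξ ^ 2) =
      Real.exp (μ * (t - s) * symA ξ - (t - s) * symA ξ ^ 2) * Real.exp (μ * s * symA ξ) := by
    rw [← Real.exp_add, ← Real.exp_add]
    congr 1
    ring
  simp only [wt, hk, Real.rpow_zero, one_mul]
  linear_combination symA ξ ^ r * h

/-- The Gaussian beats the exponential; the bound is `rpow_mul_exp_le` with slope |θ|/τ. -/
theorem isMul_wt_mul_hk (θ : ℝ) {r τ : ℝ} (hr : 0 ≤ r) (hτ : 0 < τ) :
    IsMul (fun ξ => wt θ r ξ * hk τ ξ) := by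
  refine ⟨(measurable_wt θ r).mul (measurable_hk τ), Real.exp (r ^ 2 / 4) * τ ^ (-(r / 2)) *
    ((1 + (|θ| / τ) ^ 2 * τ) ^ (r / 2) * Real.exp ((|θ| / τ) ^ 2 * τ / 4)), fun ξ => ?_⟩
  rw [abs_of_nonneg (mul_nonneg (wt_nonneg _ _ _) (hk_pos _ _).le)]
  refine le_trans ?_ (rpow_mul_exp_le (μ := |θ| / τ) hr hτ (symA_nonneg ξ))
  rw [wt, hk, mul_assoc, ← Real.exp_add]
  gcongr
  · exact Real.rpow_nonneg (symA_nonneg ξ) _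
  · rw [div_mul_cancel₀ _ hτ.ne']
    nlinarith [le_abs_self θ, symA_nonneg ξ]

theorem eLpNorm_wt_hk_le {μ r t s : ℝ} (hr : 0 ≤ r) (hst : s < t) (f : Space → Vec) :
    eLpNorm (fun ξ => wt (μ * t) r ξ • hk (t - s) ξ • f ξ) 2 volume ≤
      ENNReal.ofReal (Real.exp (r ^ 2 / 4) * (t - s) ^ (-(r / 2)) *
        ((1 + μ ^ 2 * (t - s)) ^ (r / 2) * Real.exp (μ ^ 2 * (t - s) / 4))) *
      eLpNorm (fun ξ => wt (μ * s) 0 ξ • f ξ) 2 volume := by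
  refine eLpNorm_le_mul_eLpNorm_of_ae_le_mul (ae_of_all _ fun ξ => ?_) 2
  rw [smul_smul, wt_mul_hk_eq, mul_smul, norm_smul]
  refine mul_le_mul_of_nonneg_right ?_ (norm_nonneg _)
  have h := rpow_mul_exp_le (μ := μ) hr (sub_pos.2 hst) (symA_nonneg ξ)
  rw [Real.norm_of_nonneg]
  · exact h
  · exact mul_nonneg (Real.rpow_nonneg (symA_nonneg ξ) _) (Real.exp_pos _).le

theorem one_le_wt_zero {θ : ℝ} (hθ : 0 ≤ θ) (ξ : Space) : 1 ≤ wt θ 0 ξ := by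
  rw [wt, Real.rpow_zero, one_mul]
  exact Real.one_le_exp (mul_nonneg hθ (symA_nonneg ξ))

theorem norm_le_of_wt {θ : ℝ} (hθ : 0 ≤ θ) {f : VecL2} {b : ℝ} (hb : 0 ≤ b)
    (h : eLpNorm (fun ξ => wt θ 0 ξ • f ξ) 2 volume ≤ ENNReal.ofReal b) : ‖f‖ ≤ b := by
  rw [Lp.norm_def]
  refine ENNReal.toReal_le_of_le_ofReal hb (le_trans (eLpNorm_mono fun ξ => ?_) h)
  rw [norm_smul]
  refine le_mul_of_one_le_left (norm_nonneg _) ?_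
  exact (one_le_wt_zero hθ ξ).trans (le_abs_self _)

theorem continuousOn_duh_integrand {F : ℝ → VecL2} {t : ℝ} (hF : ContinuousOn F (Set.Ioc 0 t)) :
    ContinuousOn (fun s => mulCLM (hk (t - s)) (F s)) (Set.Ioc 0 t) := by
  intro s hs
  have hm : ∀ᶠ x in 𝓝[Set.Ioc 0 t] s, x ∈ Set.Ioc 0 t := self_mem_nhdsWithin
  refine tendsto_mulCLM (C := 1) (Eventually.of_forall fun s => measurable_hk _) (measurable_hk _)
    ?_ (abs_hk_le (sub_nonneg.2 hs.2)) ?_ (hF s hs)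
  · filter_upwards [hm] with x hx using abs_hk_le (sub_nonneg.2 hx.2)
  · intro ξ
    have : Continuous fun x : ℝ => hk (t - x) ξ := by unfold hk; fun_prop
    exact this.continuousAt.continuousWithinAt

theorem intervalIntegrable_of_bound {F : ℝ → VecL2} {t : ℝ} (ht : 0 ≤ t)
    (hF : ContinuousOn F (Set.Ioc 0 t)) {K : ℝ}
    (hb : ∀ s ∈ Set.Ioo 0 t, ‖F s‖ ≤ K * s ^ (-(3 / 4) : ℝ)) :
    IntervalIntegrable F volume 0 t := by
  have h1 : IntervalIntegrable (fun s : ℝ => K * s ^ (-(3 / 4) : ℝ)) volume 0 t :=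
    (intervalIntegral.intervalIntegrable_rpow' (by norm_num)).const_mul K
  refine h1.mono_fun' ?_ ?_
  · rw [Set.uIoc_of_le ht]
    exact hF.aestronglyMeasurable measurableSet_Ioc
  · rw [Set.uIoc_of_le ht]
    have hne : ∀ᵐ s ∂(volume.restrict (Set.Ioc (0 : ℝ) t)), s ≠ t := by
      refine ae_restrict_of_ae ?_
      simp [ae_iff]
    filter_upwards [ae_restrict_mem measurableSet_Ioc, hne] with s hs hst
    exact hb s ⟨hs.1, lt_of_le_of_ne hs.2 hst⟩

theorem intervalIntegrable_duh {F : ℝ → VecL2} {t : ℝ} (ht : 0 ≤ t)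
    (hF : ContinuousOn F (Set.Ioc 0 t)) {K : ℝ}
    (hb : ∀ s ∈ Set.Ioo 0 t, ‖F s‖ ≤ K * s ^ (-(3 / 4) : ℝ)) :
    IntervalIntegrable (fun s => mulCLM (hk (t - s)) (F s)) volume 0 t := by
  refine intervalIntegrable_of_bound ht (continuousOn_duh_integrand hF) (K := K) fun s hs => ?_
  refine (norm_mulCLM_apply_le (measurable_hk _) (abs_hk_le (sub_nonneg.2 hs.2.le)) _).trans ?_
  rw [one_mul]
  exact hb s hs

/-- Smoothing costs (t-s)^{-r/2}, integrable since r < 2, and the forcing costs s^{-3/4}, the square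
of the critical rate s^{-3/8}. `N` is allowed to depend on s so that the growth of the weights can
be balanced against the heat factor before taking the supremum `K`. -/
theorem eLpNorm_wt_duh_le {F : ℝ → VecL2} {t μ r K : ℝ} (ht : 0 < t) (hμ : 0 ≤ μ) (hr : 0 ≤ r)
    (hr2 : r < 2) (hF : ContinuousOn F (Set.Ioc 0 t)) {N : ℝ → ℝ} (hN : ∀ s ∈ Set.Ioo 0 t, 0 ≤ N s)
    (hb : ∀ s ∈ Set.Ioo 0 t, eLpNorm (fun ξ => wt (μ * s) 0 ξ • F s ξ) 2 volume ≤
      ENNReal.ofReal (N s * s ^ (-(3 / 4) : ℝ)))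
    (hK : ∀ s ∈ Set.Ioo 0 t, (1 + μ ^ 2 * (t - s)) ^ (r / 2) * Real.exp (μ ^ 2 * (t - s) / 4) *
      N s ≤ K) :
    eLpNorm (fun ξ => wt (μ * t) r ξ • duh F t ξ) 2 volume ≤
      ENNReal.ofReal (Real.exp (r ^ 2 / 4) * K * betaC (r / 2) * t ^ (1 / 4 - r / 2)) := by
  have hone (s : ℝ) (hs : s ∈ Set.Ioo 0 t) :
      1 ≤ (1 + μ ^ 2 * (t - s)) ^ (r / 2) * Real.exp (μ ^ 2 * (t - s) / 4) := by
    have h0 : 0 ≤ μ ^ 2 * (t - s) := mul_nonneg (sq_nonneg _) (sub_nonneg.2 hs.2.le)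
    exact one_le_mul_of_one_le_of_one_le (Real.one_le_rpow (by linarith) (by linarith))
      (Real.one_le_exp (by positivity))
  have hNK (s : ℝ) (hs : s ∈ Set.Ioo 0 t) : N s ≤ K :=
    (le_mul_of_one_le_left (hN s hs) (hone s hs)).trans (hK s hs)
  have hFK (s : ℝ) (hs : s ∈ Set.Ioo 0 t) : ‖F s‖ ≤ K * s ^ (-(3 / 4) : ℝ) := by
    have h1 : 0 ≤ s ^ (-(3 / 4) : ℝ) := Real.rpow_nonneg hs.1.le _
    exact (norm_le_of_wt (mul_nonneg hμ hs.1.le) (mul_nonneg (hN s hs) h1) (hb s hs)).trans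
      (mul_le_mul_of_nonneg_right (hNK s hs) h1)
  have h1 := eLpNorm_smul_intervalIntegral_le (isLocMul_wt (μ * t) hr) ht.le
    (intervalIntegrable_duh ht.le hF hFK)
    (k := fun s => Real.exp (r ^ 2 / 4) * K * ((t - s) ^ (-(r / 2)) * s ^ (-(3 / 4) : ℝ)))
    ((intervalIntegrable_beta_scaled (by linarith) (by linarith) ht).const_mul _) ?_ ?_
  · rw [intervalIntegral.integral_const_mul, integral_beta_scaled ht] at h1
    refine h1.trans (le_of_eq ?_)
    congr 1
    ring
  · intro s hs
    have h2 : 0 ≤ K := (hN s hs).trans (hNK s hs)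
    have h3 : 0 ≤ (t - s) ^ (-(r / 2)) := Real.rpow_nonneg (sub_nonneg.2 hs.2.le) _
    have h4 : 0 ≤ s ^ (-(3 / 4) : ℝ) := Real.rpow_nonneg hs.1.le _
    positivity
  · intro s hs
    have h3 : 0 ≤ (t - s) ^ (-(r / 2)) := Real.rpow_nonneg (sub_nonneg.2 hs.2.le) _
    have h4 : 0 ≤ s ^ (-(3 / 4) : ℝ) := Real.rpow_nonneg hs.1.le _
    have h5 : eLpNorm (fun ξ => wt (μ * t) r ξ • mulCLM (hk (t - s)) (F s) ξ) 2 volume =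
        eLpNorm (fun ξ => wt (μ * t) r ξ • hk (t - s) ξ • F s ξ) 2 volume := by
      refine eLpNorm_congr_ae ?_
      filter_upwards [coeFn_mulCLM (isMul_hk (sub_nonneg.2 hs.2.le)) (F s)] with ξ hξ
      rw [hξ]
    rw [h5]
    refine (eLpNorm_wt_hk_le hr hs.2 _).trans
      ((mul_le_mul' le_rfl (hb s hs)).trans ?_)
    have h6 := hone s hs
    rw [← ENNReal.ofReal_mul (mul_nonneg (by positivity) (by linarith))]
    refine ENNReal.ofReal_le_ofReal ?_
    have h7 := mul_le_mul_of_nonneg_left (hK s hs)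
      (show 0 ≤ Real.exp (r ^ 2 / 4) * (t - s) ^ (-(r / 2)) * s ^ (-(3 / 4) : ℝ) by positivity)
    calc _ = Real.exp (r ^ 2 / 4) * (t - s) ^ (-(r / 2)) * s ^ (-(3 / 4) : ℝ) *
          ((1 + μ ^ 2 * (t - s)) ^ (r / 2) * Real.exp (μ ^ 2 * (t - s) / 4) * N s) := by ring
      _ ≤ _ := h7
      _ = _ := by ring

theorem continuousOn_wt_hk {F : ℝ → VecL2} {T μ r : ℝ} (hμ : 0 ≤ μ) (hr : 0 ≤ r) {D : Set ℝ}
    (hF : ContinuousOn F D) :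
    ContinuousOn (fun p : ℝ × ℝ => mulCLM (fun ξ => wt (μ * p.1) r ξ * hk (p.1 - p.2) ξ) (F p.2))
      {p | p.2 ∈ D ∧ p.2 < p.1 ∧ p.1 ≤ T} := by
  rintro ⟨t, s⟩ ⟨hs, hst, htT⟩
  dsimp only at hs hst htT
  set S := {p : ℝ × ℝ | p.2 ∈ D ∧ p.2 < p.1 ∧ p.1 ≤ T}
  -- A bound uniform near (t, s) comes from the largest weight μT and from half the time gap.
  obtain ⟨hm, C, hC⟩ := isMul_wt_mul_hk (μ * T) hr (τ := (t - s) / 2) (by linarith)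
  have hmem : ∀ᶠ p in 𝓝[S] (t, s), p ∈ S := self_mem_nhdsWithin
  have hlow : ∀ᶠ p in 𝓝[S] (t, s), (t - s) / 2 < p.1 - p.2 := by
    refine nhdsWithin_le_nhds ?_
    refine (isOpen_lt continuous_const (continuous_fst.sub continuous_snd)).mem_nhds ?_
    change (t - s) / 2 < t - s
    linarith
  have hbd (p : ℝ × ℝ) (hp : p ∈ S) (hl : (t - s) / 2 < p.1 - p.2) (ξ : Space) :
      |wt (μ * p.1) r ξ * hk (p.1 - p.2) ξ| ≤ C := by
    refine le_trans ?_ (hC ξ)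
    have h1 : wt (μ * p.1) r ξ ≤ wt (μ * T) r ξ := by
      refine mul_le_mul_of_nonneg_left ?_ (Real.rpow_nonneg (symA_nonneg ξ) _)
      gcongr
      · exact symA_nonneg ξ
      · exact hp.2.2
    have h2 : hk (p.1 - p.2) ξ ≤ hk ((t - s) / 2) ξ := by
      refine Real.exp_le_exp.2 ?_
      nlinarith [sq_nonneg (symA ξ)]
    rw [abs_of_nonneg (mul_nonneg (wt_nonneg _ _ _) (hk_pos _ _).le),
      abs_of_nonneg (mul_nonneg (wt_nonneg _ _ _) (hk_pos _ _).le)]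
    exact mul_le_mul h1 h2 (hk_pos _ _).le (wt_nonneg _ _ _)
  refine tendsto_mulCLM (C := C)
    (Eventually.of_forall fun p => (measurable_wt _ _).mul (measurable_hk _))
    ((measurable_wt _ _).mul (measurable_hk _)) ?_ ?_ ?_ ?_
  · filter_upwards [hmem, hlow] with p hp hl using hbd p hp hl
  · exact hbd (t, s) ⟨hs, hst, htT⟩ (by dsimp only; linarith)
  · intro ξ
    have : Continuous fun p : ℝ × ℝ => wt (μ * p.1) r ξ * hk (p.1 - p.2) ξ := by
      unfold wt hk; fun_prop
    exact this.continuousAt.continuousWithinAt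
  · have h1 : Tendsto F (𝓝[D] s) (𝓝 (F s)) := hF s hs
    refine h1.comp (tendsto_nhdsWithin_iff.2 ⟨?_, ?_⟩)
    · exact continuous_snd.continuousAt.continuousWithinAt
    · filter_upwards [hmem] with p hp using hp.1

theorem norm_mulCLM_wt_hk_le {F : VecL2} {t s μ r T N : ℝ} (hr : 0 ≤ r)
    (hs : 0 < s) (hst : s < t) (htT : t ≤ T) (hN : 0 ≤ N)
    (hb : eLpNorm (fun ξ => wt (μ * s) 0 ξ • F ξ) 2 volume ≤
      ENNReal.ofReal (N * s ^ (-(3 / 4) : ℝ))) :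
    ‖mulCLM (fun ξ => wt (μ * t) r ξ * hk (t - s) ξ) F‖ ≤
      Real.exp (r ^ 2 / 4) * ((1 + μ ^ 2 * T) ^ (r / 2) * Real.exp (μ ^ 2 * T / 4)) * N *
        ((t - s) ^ (-(r / 2)) * s ^ (-(3 / 4) : ℝ)) := by
  have h1 := (eLpNorm_wt_hk_le (μ := μ) hr hst F).trans (mul_le_mul' le_rfl hb)
  have hts : 0 < t - s := sub_pos.2 hst
  have hT : 0 < T := by linarith
  have hs4 : 0 ≤ s ^ (-(3 / 4) : ℝ) := Real.rpow_nonneg hs.le _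
  rw [← ENNReal.ofReal_mul (by positivity)] at h1
  rw [Lp.norm_def]
  refine ENNReal.toReal_le_of_le_ofReal (by positivity) (le_trans (le_of_eq ?_) (h1.trans ?_))
  · refine eLpNorm_congr_ae ?_
    filter_upwards [coeFn_mulCLM (isMul_wt_mul_hk (μ * t) hr hts) F] with ξ hξ
    rw [hξ, smul_smul]
  · refine ENNReal.ofReal_le_ofReal ?_
    have h2 : (1 + μ ^ 2 * (t - s)) ^ (r / 2) * Real.exp (μ ^ 2 * (t - s) / 4) ≤
        (1 + μ ^ 2 * T) ^ (r / 2) * Real.exp (μ ^ 2 * T / 4) := by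
      gcongr <;> linarith
    calc _ = Real.exp (r ^ 2 / 4) * (t - s) ^ (-(r / 2)) * N * s ^ (-(3 / 4) : ℝ) *
          ((1 + μ ^ 2 * (t - s)) ^ (r / 2) * Real.exp (μ ^ 2 * (t - s) / 4)) := by ring
      _ ≤ Real.exp (r ^ 2 / 4) * (t - s) ^ (-(r / 2)) * N * s ^ (-(3 / 4) : ℝ) *
          ((1 + μ ^ 2 * T) ^ (r / 2) * Real.exp (μ ^ 2 * T / 4)) := by gcongr
      _ = _ := by ring

section

variable {F : ℝ → VecL2} {T μ r N : ℝ}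

/-- The substitution s = tσ fixes the domain of integration, so that continuity in t becomes a
question of dominated convergence on [0, 1]. -/
theorem classL2_wt_duh_eq (hμ : 0 ≤ μ) (hr : 0 ≤ r)
    (hr2 : r < 2) (hF : ContinuousOn F (Set.Ioc 0 T)) (hN : 0 ≤ N)
    (hb : ∀ s ∈ Set.Ioc 0 T, eLpNorm (fun ξ => wt (μ * s) 0 ξ • F s ξ) 2 volume ≤
      ENNReal.ofReal (N * s ^ (-(3 / 4) : ℝ))) {t : ℝ} (ht : 0 < t) (htT : t ≤ T) :
    MemLp (fun ξ => wt (μ * t) r ξ • duh F t ξ) 2 volume ∧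
    classL2 (fun ξ => wt (μ * t) r ξ • duh F t ξ) = t • ∫ σ in (0 : ℝ)..1,
      mulCLM (fun ξ => wt (μ * t) r ξ * hk (t - t * σ) ξ) (F (t * σ)) := by
  have hF' : ContinuousOn F (Set.Ioc 0 t) := hF.mono (Set.Ioc_subset_Ioc_right htT)
  have hb' : ∀ s ∈ Set.Ioo 0 t, eLpNorm (fun ξ => wt (μ * s) 0 ξ • F s ξ) 2 volume ≤
      ENNReal.ofReal (N * s ^ (-(3 / 4) : ℝ)) := fun s hs => hb s ⟨hs.1, hs.2.le.trans htT⟩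
  have hFK (s : ℝ) (hs : s ∈ Set.Ioo 0 t) : ‖F s‖ ≤ N * s ^ (-(3 / 4) : ℝ) :=
    norm_le_of_wt (mul_nonneg hμ hs.1.le) (mul_nonneg hN (Real.rpow_nonneg hs.1.le _)) (hb' s hs)
  have hcl (s : ℝ) (hs : s ∈ Set.Ioo 0 t) :
      MemLp (fun ξ => wt (μ * t) r ξ • mulCLM (hk (t - s)) (F s) ξ) 2 volume ∧
      classL2 (fun ξ => wt (μ * t) r ξ • mulCLM (hk (t - s)) (F s) ξ) =
        mulCLM (fun ξ => wt (μ * t) r ξ * hk (t - s) ξ) (F s) := by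
    have hM := isMul_wt_mul_hk (μ * t) hr (sub_pos.2 hs.2)
    have hae : (fun ξ => wt (μ * t) r ξ • mulCLM (hk (t - s)) (F s) ξ) =ᵐ[volume]
        fun ξ => (wt (μ * t) r ξ * hk (t - s) ξ) • F s ξ := by
      filter_upwards [coeFn_mulCLM (isMul_hk (sub_pos.2 hs.2).le) (F s)] with ξ hξ
      rw [hξ, smul_smul]
    exact ⟨(memLp_congr_ae hae).2 (hM.memLp (Lp.memLp _)),
      (classL2_congr hae).trans (mulCLM_apply hM _).symm⟩
  have hcont : ContinuousOn (fun s => mulCLM (fun ξ => wt (μ * t) r ξ * hk (t - s) ξ) (F s))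
      (Set.Ioo 0 t) := by
    have h := continuousOn_wt_hk hμ hr hF (T := T)
    refine h.comp (f := fun s : ℝ => (t, s)) (by fun_prop) fun s hs =>
      ⟨⟨hs.1, hs.2.le.trans htT⟩, hs.2, htT⟩
  have hint : IntervalIntegrable
      (fun s => classL2 (fun ξ => wt (μ * t) r ξ • mulCLM (hk (t - s)) (F s) ξ)) volume 0 t := by
    have h1 := (intervalIntegrable_beta_scaled (a := r / 2) (by linarith) (by linarith)
      ht).const_mul (Real.exp (r ^ 2 / 4) * ((1 + μ ^ 2 * T) ^ (r / 2) *
        Real.exp (μ ^ 2 * T / 4)) * N)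
    have hae : ∀ᵐ s ∂(volume.restrict (Set.uIoc 0 t)), s ∈ Set.Ioo 0 t := by
      rw [Set.uIoc_of_le ht.le, ← restrict_Ioo_eq_restrict_Ioc]
      exact ae_restrict_mem measurableSet_Ioo
    refine h1.mono_fun' ?_ ?_
    · have h2 : AEStronglyMeasurable
          (fun s => mulCLM (fun ξ => wt (μ * t) r ξ * hk (t - s) ξ) (F s))
          (volume.restrict (Set.uIoc 0 t)) := by
        rw [Set.uIoc_of_le ht.le, ← restrict_Ioo_eq_restrict_Ioc]
        exact hcont.aestronglyMeasurable measurableSet_Ioo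
      refine h2.congr ?_
      filter_upwards [hae] with s hs using (hcl s hs).2.symm
    · filter_upwards [hae] with s hs
      rw [(hcl s hs).2]
      exact norm_mulCLM_wt_hk_le hr hs.1 hs.2 htT hN (hb' s hs)
  have hMem : MemLp (fun ξ => wt (μ * t) r ξ • duh F t ξ) 2 volume := by
    refine ⟨(measurable_wt _ _).aestronglyMeasurable.smul (Lp.aestronglyMeasurable _),
      lt_of_le_of_lt (eLpNorm_wt_duh_le ht hμ hr hr2 hF' (fun _ _ => hN) hb'
        (K := (1 + μ ^ 2 * T) ^ (r / 2) * Real.exp (μ ^ 2 * T / 4) * N) fun s hs => ?_)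
        ENNReal.ofReal_lt_top⟩
    have h0 : 0 ≤ μ ^ 2 * (t - s) := mul_nonneg (sq_nonneg _) (sub_nonneg.2 hs.2.le)
    have hT : 0 < T := ht.trans_le htT
    have h3 : t - s ≤ T := by linarith [hs.1]
    gcongr
  refine ⟨hMem, ?_⟩
  have h := classL2_smul_intervalIntegral (isLocMul_wt (μ * t) hr) ht.le
    (intervalIntegrable_duh ht.le hF' hFK) hint (fun s hs => (hcl s hs).1) hMem
  have h2 := intervalIntegral.integral_comp_mul_left
    (fun s : ℝ => mulCLM (fun ξ => wt (μ * t) r ξ * hk (t - s) ξ) (F s)) ht.ne' (a := 0) (b := 1)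
  rw [mul_zero, mul_one] at h2
  refine h.trans ?_
  rw [h2, smul_smul, mul_inv_cancel₀ ht.ne', one_smul]
  refine intervalIntegral.integral_congr_ae ?_
  have hne : ∀ᵐ s : ℝ, s ≠ t := by simp [ae_iff]
  filter_upwards [hne] with s hst hs
  rw [Set.uIoc_of_le ht.le] at hs
  exact (hcl s ⟨hs.1, lt_of_le_of_ne hs.2 hst⟩).2

theorem continuousOn_wt_duh (hμ : 0 ≤ μ) (hr : 0 ≤ r)
    (hr2 : r < 2) (hF : ContinuousOn F (Set.Ioc 0 T)) (hN : 0 ≤ N)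
    (hb : ∀ s ∈ Set.Ioc 0 T, eLpNorm (fun ξ => wt (μ * s) 0 ξ • F s ξ) 2 volume ≤
      ENNReal.ofReal (N * s ^ (-(3 / 4) : ℝ))) :
    ContinuousOn (fun t => classL2 (fun ξ => wt (μ * t) r ξ • duh F t ξ)) (Set.Ioc 0 T) := by
  have hcont := continuousOn_wt_hk hμ hr hF (T := T)
  have hmain : ContinuousOn (fun t : ℝ => t • ∫ σ in (0 : ℝ)..1,
      mulCLM (fun ξ => wt (μ * t) r ξ * hk (t - t * σ) ξ) (F (t * σ))) (Set.Ioc 0 T) := by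
    intro t ht
    refine continuousWithinAt_id.smul ?_
    have hmem : ∀ᶠ x in 𝓝[Set.Ioc 0 T] t, x ∈ Set.Ioc 0 T := self_mem_nhdsWithin
    have hlow : ∀ᶠ x in 𝓝[Set.Ioc 0 T] t, t / 2 < x :=
      nhdsWithin_le_nhds (lt_mem_nhds (half_lt_self ht.1))
    have hne : ∀ᵐ σ : ℝ, σ ≠ 1 := by simp [ae_iff]
    set c := Real.exp (r ^ 2 / 4) * ((1 + μ ^ 2 * T) ^ (r / 2) *
        Real.exp (μ ^ 2 * T / 4)) * N with hc
    have hT : 0 < T := ht.1.trans_le ht.2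
    have hc0 : 0 ≤ c := by positivity
    -- The power of time produced by the scaling is negative, so for times above t/2 it is at most
    -- its value at t/2.
    refine intervalIntegral.continuousWithinAt_of_dominated_interval
      (bound := fun σ => c * (t / 2) ^ (-(r / 2) - 3 / 4) *
        ((1 - σ) ^ (-(r / 2)) * σ ^ (-(3 / 4) : ℝ))) ?_ ?_ ?_ ?_
    · filter_upwards [hmem] with x hx
      rw [Set.uIoc_of_le zero_le_one, ← restrict_Ioo_eq_restrict_Ioc]
      refine ContinuousOn.aestronglyMeasurable ?_ measurableSet_Ioo
      refine hcont.comp (f := fun σ : ℝ => (x, x * σ)) (by fun_prop) fun σ hσ =>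
        ⟨⟨mul_pos hx.1 hσ.1, ?_⟩, mul_lt_of_lt_one_right hx.1 hσ.2, hx.2⟩
      exact (mul_le_of_le_one_right hx.1.le hσ.2.le).trans hx.2
    · filter_upwards [hmem, hlow] with x hx hl
      filter_upwards [hne] with σ h1 hσ
      rw [Set.uIoc_of_le zero_le_one] at hσ
      have hσ1 : σ < 1 := lt_of_le_of_ne hσ.2 h1
      refine (norm_mulCLM_wt_hk_le hr (mul_pos hx.1 hσ.1) (mul_lt_of_lt_one_right hx.1 hσ1) hx.2 hN
        (hb _ ⟨mul_pos hx.1 hσ.1, (mul_le_of_le_one_right hx.1.le hσ.2).trans hx.2⟩)).trans ?_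
      rw [beta_scale hx.1 hσ.1.le hσ.2, ← mul_assoc, ← hc]
      have h3 : 0 ≤ (1 - σ) ^ (-(r / 2)) := Real.rpow_nonneg (sub_nonneg.2 hσ.2) _
      have h4 : 0 ≤ σ ^ (-(3 / 4) : ℝ) := Real.rpow_nonneg hσ.1.le _
      have h5 : x ^ (-(r / 2) - 3 / 4) ≤ (t / 2) ^ (-(r / 2) - 3 / 4) :=
        Real.rpow_le_rpow_of_nonpos (half_pos ht.1) hl.le (by linarith)
      gcongr
    · exact (intervalIntegrable_beta (by linarith) (by linarith)).const_mul _
    · filter_upwards [hne] with σ h1 hσ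
      rw [Set.uIoc_of_le zero_le_one] at hσ
      have hσ1 : σ < 1 := lt_of_le_of_ne hσ.2 h1
      exact (hcont.comp (f := fun x : ℝ => (x, x * σ)) (by fun_prop)
        fun x hx => ⟨⟨mul_pos hx.1 hσ.1, (mul_le_of_le_one_right hx.1.le hσ.2).trans hx.2⟩,
          mul_lt_of_lt_one_right hx.1 hσ1, hx.2⟩) t ht
  refine hmain.congr fun t ht => ?_
  exact (classL2_wt_duh_eq hμ hr hr2 hF hN hb ht.1 ht.2).2

end

end NavierStokes

/-! ### Weighted norms, continuity of the forcing, and the path spaces. -/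

namespace NavierStokes

/-! ### The weighted transform as an element of `L²` -/

/-- The Fourier transform of `A^r exp(θ A) T` as an element of `(L²)³`. -/
def hatW (θ r : ℝ) (T : VecDist) : VecL2 := classL2 (fun ξ => wt θ r ξ • hat T ξ)

theorem expA_eq (θ r : ℝ) (T : VecDist) : expA θ r T = 𝓕⁻ (hatW θ r T) := rfl

theorem norm_expA_eq (θ r : ℝ) (T : VecDist) : ‖expA θ r T‖ = ‖hatW θ r T‖ := norm_fourierInv _

theorem continuousOn_expA_iff {θ : ℝ → ℝ} {r : ℝ} {v : ℝ → VecDist} {I : Set ℝ} :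
    ContinuousOn (fun t => expA (θ t) r (v t)) I ↔ ContinuousOn (fun t => hatW (θ t) r (v t)) I := by
  have h : Isometry fun f : VecL2 => (𝓕⁻ f : VecL2) :=
    (Lp.fourierTransformₗᵢ Space Vec).symm.isometry
  exact h.isEmbedding.continuousOn_iff.symm

theorem InDom.coeFn_hatW {θ r : ℝ} {T : VecDist} (h : InDom θ r T) :
    hatW θ r T =ᵐ[volume] fun ξ => wt θ r ξ • hat T ξ := coeFn_classL2 h.2

theorem wt_mul_wt (θ θ' : ℝ) {r r' : ℝ} (hr : 0 ≤ r) (hr' : 0 ≤ r') (ξ : Space) :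
    wt θ r ξ * wt θ' r' ξ = wt (θ + θ') (r + r') ξ := by
  simp only [wt]
  rw [Real.rpow_add_of_nonneg (symA_nonneg ξ) hr hr', add_mul, Real.exp_add]
  ring

theorem isMul_wt_neg {θ : ℝ} (hθ : θ ≤ 0) : IsMul (wt θ 0) ∧ ∀ ξ, |wt θ 0 ξ| ≤ 1 := by
  have h (ξ : Space) : |wt θ 0 ξ| ≤ 1 := by
    rw [abs_of_nonneg (wt_nonneg _ _ _), wt, Real.rpow_zero, one_mul]
    exact Real.exp_le_one_iff.2 (mul_nonpos_of_nonpos_of_nonneg hθ (symA_nonneg ξ))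
  exact ⟨⟨measurable_wt _ _, 1, h⟩, h⟩

theorem InDom.of_le {θ θ' r : ℝ} {T : VecDist} (h : InDom θ r T) (hr : 0 ≤ r) (hθ : θ' ≤ θ) :
    InDom θ' r T ∧ hatW θ' r T = mulCLM (wt (θ' - θ) 0) (hatW θ r T) ∧
      ‖expA θ' r T‖ ≤ ‖expA θ r T‖ := by
  have hm := isMul_wt_neg (sub_nonpos.2 hθ)
  have h1 : (fun ξ => wt (θ' - θ) 0 ξ • wt θ r ξ • hat T ξ) = fun ξ => wt θ' r ξ • hat T ξ := by
    funext ξ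
    rw [smul_smul, wt_mul_wt _ _ le_rfl hr, sub_add_cancel, zero_add]
  have h2 : InDom θ' r T := by
    refine ⟨h.1, ?_⟩
    have := hm.1.memLp h.2
    rw [weightedHat_eq] at this ⊢
    rwa [h1] at this
  have h3 : hatW θ' r T = mulCLM (wt (θ' - θ) 0) (hatW θ r T) := by
    rw [mulCLM_apply hm.1, hatW, ← h1]
    refine classL2_congr ?_
    filter_upwards [h.coeFn_hatW] with ξ hξ
    rw [hξ]
  refine ⟨h2, h3, ?_⟩
  rw [norm_expA_eq, norm_expA_eq, h3]
  simpa using norm_mulCLM_apply_le hm.1.1 hm.2 (hatW θ r T)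

theorem continuousOn_hatW_zero {θ : ℝ → ℝ} {r : ℝ} {v : ℝ → VecDist} {I : Set ℝ} (hr : 0 ≤ r)
    (hθ : ∀ t ∈ I, 0 ≤ θ t) (hθc : ContinuousOn θ I) (hv : ∀ t ∈ I, InDom (θ t) r (v t))
    (hc : ContinuousOn (fun t => hatW (θ t) r (v t)) I) :
    ContinuousOn (fun t => hatW 0 r (v t)) I := by
  have h : ContinuousOn (fun t => mulCLM (wt (0 - θ t) 0) (hatW (θ t) r (v t))) I := by
    intro t ht
    have hm : ∀ᶠ x in 𝓝[I] t, x ∈ I := self_mem_nhdsWithin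
    refine tendsto_mulCLM (C := 1) (Eventually.of_forall fun s => measurable_wt _ _)
      (measurable_wt _ _) ?_ (isMul_wt_neg (by linarith [hθ t ht])).2 ?_ (hc t ht)
    · filter_upwards [hm] with x hx using (isMul_wt_neg (by linarith [hθ x hx])).2
    · intro ξ
      have h1 : Continuous fun y : ℝ => wt (0 - y) 0 ξ := by unfold wt; fun_prop
      exact h1.continuousAt.tendsto.comp (hθc t ht)
  exact h.congr fun t ht => ((hv t ht).of_le hr (hθ t ht)).2.1

/-! ### Continuity of the forcing term -/

variable {P : Space → Matrix (Fin 3) (Fin 3) ℂ} {M : Matrix (Fin 3) (Fin 3) ℝ}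

theorem exists_forc_bound (hP : IsFiberedProjection P) (M : Matrix (Fin 3) (Fin 3) ℝ) :
    ∃ C : ℝ, 0 ≤ C ∧ ∀ θ : ℝ, 0 ≤ θ → ∀ u v : VecDist, InDom θ (5 / 4) u → InDom θ (5 / 4) v →
      eLpNorm (fun ξ => wt θ 0 ξ • forc P M u v ξ) 2 volume ≤
        ENNReal.ofReal (C * ‖expA θ (5 / 4) u‖ * ‖expA θ (5 / 4) v‖) := by
  obtain ⟨C, hC, h⟩ := eLpNorm_forc_le hP M (α := 5 / 4) (β := 1 / 4) (by norm_num) (by norm_num)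
    (by norm_num)
  refine ⟨C, hC, fun θ hθ u v hu hv => ?_⟩
  have h1 := h θ hθ u v (hu.of_le (by norm_num) hθ).1 (hv.of_le (by norm_num) hθ).1
  rw [show (1 + 1 / 4 : ℝ) = 5 / 4 by norm_num, eLpNorm_weighted hu, eLpNorm_weighted hv,
    ← ENNReal.ofReal_mul (norm_nonneg _), ← ENNReal.ofReal_mul hC, ← mul_assoc] at h1
  exact h1

theorem continuousOn_forc (hP : IsFiberedProjection P) {u v : ℝ → VecDist} {I : Set ℝ}
    (hu : ∀ t ∈ I, MemHdot (5 / 4) (u t)) (hv : ∀ t ∈ I, MemHdot (5 / 4) (v t))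
    (huc : ContinuousOn (fun t => expA 0 (5 / 4) (u t)) I)
    (hvc : ContinuousOn (fun t => expA 0 (5 / 4) (v t)) I) :
    ContinuousOn (fun t => forc P M (u t) (v t)) I := by
  obtain ⟨C, hC, h⟩ := exists_forc_bound hP M
  have hb (a b : VecDist) (ha : MemHdot (5 / 4) a) (hb : MemHdot (5 / 4) b) :
      ‖forc P M a b‖ ≤ C * ‖expA 0 (5 / 4) a‖ * ‖expA 0 (5 / 4) b‖ :=
    norm_le_of_wt le_rfl (by positivity) (h 0 le_rfl a b ha hb)
  intro t ht
  have hm : ∀ᶠ x in 𝓝[I] t, x ∈ I := self_mem_nhdsWithin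
  have h1 : Tendsto (fun s => expA 0 (5 / 4) (u s)) (𝓝[I] t) (𝓝 (expA 0 (5 / 4) (u t))) := huc t ht
  have h2 : Tendsto (fun s => expA 0 (5 / 4) (v s)) (𝓝[I] t) (𝓝 (expA 0 (5 / 4) (v t))) := hvc t ht
  refine tendsto_iff_norm_sub_tendsto_zero.2 ?_
  refine squeeze_zero' (Eventually.of_forall fun _ => norm_nonneg _) ?_
    (g := fun s => C * ‖expA 0 (5 / 4) (u s) - expA 0 (5 / 4) (u t)‖ * ‖expA 0 (5 / 4) (v s)‖ +
      C * ‖expA 0 (5 / 4) (u t)‖ * ‖expA 0 (5 / 4) (v s) - expA 0 (5 / 4) (v t)‖) ?_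
  · filter_upwards [hm] with s hs
    have e : forc P M (u s) (v s) - forc P M (u t) (v t) =
        forc P M (u s - u t) (v s) + forc P M (u t) (v s - v t) := by
      rw [forc_sub_left hP (hu s hs) (hu t ht) (hv s hs),
        forc_sub_right hP (hu t ht) (hv s hs) (hv t ht)]
      abel
    rw [e]
    refine (norm_add_le _ _).trans (add_le_add ?_ ?_)
    · rw [← expA_sub (hu s hs) (hu t ht)]
      exact hb _ _ ((hu s hs).sub (hu t ht)) (hv s hs)
    · rw [← expA_sub (hv s hs) (hv t ht)]
      exact hb _ _ (hu t ht) ((hv s hs).sub (hv t ht))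
  · have e1 := (tendsto_iff_norm_sub_tendsto_zero.1 h1)
    have e2 := (tendsto_iff_norm_sub_tendsto_zero.1 h2)
    have := ((e1.const_mul C).mul h2.norm).add (e2.const_mul (C * ‖expA 0 (5 / 4) (u t)‖))
    simpa using this

/-! ### The spaces `ℬ` -/

section

variable {ζ θ : ℝ → ℝ} {I : Set ℝ} {s₁ s₂ : ℝ} {v w : ℝ → VecDist}

theorem norm_scaled {t : ℝ} (ht : 0 ≤ t) :
    ‖scaled ζ θ s₁ s₂ v t‖ = Real.exp (-ζ t) * t ^ s₁ * ‖expA (θ t) s₂ (v t)‖ := by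
  rw [scaled, norm_smul, Real.norm_of_nonneg]
  exact mul_nonneg (Real.exp_pos _).le (Real.rpow_nonneg ht _)

theorem norm_scaled_le_iff {t : ℝ} (ht : 0 < t) {b : ℝ} : ‖scaled ζ θ s₁ s₂ v t‖ ≤ b ↔
    ‖expA (θ t) s₂ (v t)‖ ≤ b * Real.exp (ζ t) * t ^ (-s₁) := by
  have h1 : 0 < t ^ s₁ := Real.rpow_pos_of_pos ht _
  have h2 := Real.exp_pos (ζ t)
  rw [norm_scaled ht.le, Real.rpow_neg ht.le, Real.exp_neg, ← div_eq_mul_inv, le_div_iff₀ h1,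
    mul_assoc, inv_mul_le_iff₀ h2, mul_comm (t ^ s₁), mul_comm b]

theorem MemB.norm_expA_le (h : MemB ζ θ I s₁ s₂ v) {t : ℝ} (ht : t ∈ I) (ht0 : 0 < t) :
    ‖expA (θ t) s₂ (v t)‖ ≤ normB ζ θ I s₁ s₂ v * Real.exp (ζ t) * t ^ (-s₁) :=
  (norm_scaled_le_iff ht0).1 (le_csSup h.bounded ⟨t, ht, rfl⟩)

theorem normB_nonneg : 0 ≤ normB ζ θ I s₁ s₂ v :=
  Real.sSup_nonneg (by rintro _ ⟨t, _, rfl⟩; exact norm_nonneg _)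

theorem normB_le (hI : I ⊆ Set.Ioi 0) {b : ℝ} (hb : 0 ≤ b)
    (h : ∀ t ∈ I, ‖expA (θ t) s₂ (v t)‖ ≤ b * Real.exp (ζ t) * t ^ (-s₁)) :
    normB ζ θ I s₁ s₂ v ≤ b := by
  refine Real.sSup_le ?_ hb
  rintro _ ⟨t, ht, rfl⟩
  exact (norm_scaled_le_iff (hI ht)).2 (h t ht)

theorem memB_of (hI : I ⊆ Set.Ioi 0) (hζ : ContinuousOn ζ I) (hs₂ : 0 ≤ s₂) (hθ : ∀ t ∈ I, 0 ≤ θ t)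
    (hv : ∀ t ∈ I, InDom (θ t) s₂ (v t)) (hc : ContinuousOn (fun t => hatW (θ t) s₂ (v t)) I)
    {b : ℝ} (hb : ∀ t ∈ I, ‖expA (θ t) s₂ (v t)‖ ≤ b * Real.exp (ζ t) * t ^ (-s₁)) :
    MemB ζ θ I s₁ s₂ v where
  memHdot t ht := ((hv t ht).of_le hs₂ (hθ t ht)).1
  inDom := hv
  continuousOn := by
    refine ContinuousOn.smul (f := fun t => Real.exp (-ζ t) * t ^ s₁) ?_
      (continuousOn_expA_iff.2 hc)
    refine (Real.continuous_exp.comp_continuousOn hζ.neg).mul ?_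
    exact fun t ht => (Real.continuousAt_rpow_const _ _ (Or.inl (ne_of_gt (hI ht)))).continuousWithinAt
  bounded := by
    refine ⟨b, ?_⟩
    rintro _ ⟨t, ht, rfl⟩
    exact (norm_scaled_le_iff (hI ht)).2 (hb t ht)

theorem MemB.continuousOn_expA (h : MemB ζ θ I s₁ s₂ v) (hI : I ⊆ Set.Ioi 0)
    (hζ : ContinuousOn ζ I) : ContinuousOn (fun t => expA (θ t) s₂ (v t)) I := by
  have h1 : ContinuousOn (fun t => (Real.exp (ζ t) * t ^ (-s₁)) • scaled ζ θ s₁ s₂ v t) I := by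
    refine ContinuousOn.smul (f := fun t => Real.exp (ζ t) * t ^ (-s₁)) ?_ h.continuousOn
    refine (Real.continuous_exp.comp_continuousOn hζ).mul ?_
    exact fun t ht => (Real.continuousAt_rpow_const _ _ (Or.inl (ne_of_gt (hI ht)))).continuousWithinAt
  refine h1.congr fun t ht => ?_
  have h3 : 0 < t := hI ht
  have h2 : Real.exp (ζ t) * t ^ (-s₁) * (Real.exp (-ζ t) * t ^ s₁) = 1 := by
    have e1 : Real.exp (ζ t) * Real.exp (-ζ t) = 1 := by rw [← Real.exp_add]; simp
    have e2 : t ^ (-s₁) * t ^ s₁ = 1 := by rw [← Real.rpow_add h3]; simp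
    rw [mul_mul_mul_comm, e1, e2, one_mul]
  change _ = (Real.exp (ζ t) * t ^ (-s₁)) • ((Real.exp (-ζ t) * t ^ s₁) • expA (θ t) s₂ (v t))
  rw [smul_smul, h2, one_smul]

theorem MemB.mono (h : MemB ζ θ I s₁ s₂ v) {I' : Set ℝ} (hI : I' ⊆ I) : MemB ζ θ I' s₁ s₂ v where
  memHdot t ht := h.memHdot t (hI ht)
  inDom t ht := h.inDom t (hI ht)
  continuousOn := h.continuousOn.mono hI
  bounded := h.bounded.mono (Set.image_mono hI)

theorem MemB.sub (hv : MemB ζ θ I s₁ s₂ v) (hw : MemB ζ θ I s₁ s₂ w) :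
    MemB ζ θ I s₁ s₂ (fun t => v t - w t) := by
  have e (t : ℝ) (ht : t ∈ I) : scaled ζ θ s₁ s₂ (fun t => v t - w t) t =
      scaled ζ θ s₁ s₂ v t - scaled ζ θ s₁ s₂ w t := by
    rw [scaled, expA_sub (hv.inDom t ht) (hw.inDom t ht), smul_sub]; rfl
  refine ⟨fun t ht => (hv.memHdot t ht).sub (hw.memHdot t ht),
    fun t ht => (hv.inDom t ht).sub (hw.inDom t ht),
    (hv.continuousOn.sub hw.continuousOn).congr e, ?_⟩
  obtain ⟨a, ha⟩ := hv.bounded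
  obtain ⟨b, hb⟩ := hw.bounded
  refine ⟨a + b, ?_⟩
  rintro _ ⟨t, ht, rfl⟩
  dsimp only
  rw [e t ht]
  exact (norm_sub_le _ _).trans (add_le_add (ha ⟨t, ht, rfl⟩) (hb ⟨t, ht, rfl⟩))

theorem MemB.add (hv : MemB ζ θ I s₁ s₂ v) (hw : MemB ζ θ I s₁ s₂ w) :
    MemB ζ θ I s₁ s₂ (fun t => v t + w t) ∧
      normB ζ θ I s₁ s₂ (fun t => v t + w t) ≤ normB ζ θ I s₁ s₂ v + normB ζ θ I s₁ s₂ w := by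
  have e (t : ℝ) (ht : t ∈ I) : scaled ζ θ s₁ s₂ (fun t => v t + w t) t =
      scaled ζ θ s₁ s₂ v t + scaled ζ θ s₁ s₂ w t := by
    rw [scaled, expA_add (hv.inDom t ht) (hw.inDom t ht), smul_add]; rfl
  have hle (t : ℝ) (ht : t ∈ I) : ‖scaled ζ θ s₁ s₂ (fun t => v t + w t) t‖ ≤
      normB ζ θ I s₁ s₂ v + normB ζ θ I s₁ s₂ w := by
    rw [e t ht]
    exact (norm_add_le _ _).trans
      (add_le_add (le_csSup hv.bounded ⟨t, ht, rfl⟩) (le_csSup hw.bounded ⟨t, ht, rfl⟩))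
  refine ⟨⟨fun t ht => (hv.memHdot t ht).add (hw.memHdot t ht),
    fun t ht => (hv.inDom t ht).add (hw.inDom t ht),
    (hv.continuousOn.add hw.continuousOn).congr e,
    ⟨normB ζ θ I s₁ s₂ v + normB ζ θ I s₁ s₂ w, ?_⟩⟩, Real.sSup_le ?_ ?_⟩
  · rintro _ ⟨t, ht, rfl⟩
    exact hle t ht
  · rintro _ ⟨t, ht, rfl⟩
    exact hle t ht
  · exact add_nonneg normB_nonneg normB_nonneg

end

/-! ### The weights `exp ζ` and `exp (θ A)` -/

/-- The weight `exp ζ`. -/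
def zw (μ t : ℝ) : ℝ := Real.exp (μ ^ 2 * t / 4) * (1 + μ ^ 2 * t) ^ (3 / 8 : ℝ)

theorem zw_pos (μ : ℝ) {t : ℝ} (ht : 0 ≤ t) : 0 < zw μ t := by
  unfold zw; positivity

theorem lam_sq (lam0 : ℝ) {T t : ℝ} (hT : 0 < T) (ht : 0 ≤ t) :
    lam lam0 T t ^ 2 = (lam0 / Real.sqrt T) ^ 2 * t := by
  rw [lam, mul_pow, div_pow, Real.sq_sqrt (by positivity), Real.sq_sqrt hT.le]
  ring

/-- The choice λ(t) ∝ √t makes θ linear in time, as the Duhamel estimate requires; the slope is μ =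
λ₀/√T. -/
theorem thetaT_eq (lam0 : ℝ) {T t : ℝ} (ht : 0 ≤ t) :
    thetaT lam0 T t = lam0 / Real.sqrt T * t := by
  rw [thetaT, lam, Real.sqrt_div ht]
  have := Real.mul_self_sqrt ht
  calc _ = lam0 / Real.sqrt T * (Real.sqrt t * Real.sqrt t) := by ring
    _ = _ := by rw [this]

theorem exp_zetaT (lam0 : ℝ) {T t : ℝ} (hT : 0 < T) (ht : 0 ≤ t) :
    Real.exp (zetaT lam0 T t) = zw (lam0 / Real.sqrt T) t := by
  rw [zetaT, lam_sq lam0 hT ht, zw, Real.exp_add]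
  set a := (lam0 / Real.sqrt T) ^ 2 * t with ha
  have ha0 : 0 ≤ a := by positivity
  congr 1
  rw [Real.log_sqrt (by positivity), Real.rpow_def_of_pos (by positivity)]
  congr 1
  ring

theorem continuous_zetaT (lam0 T : ℝ) : Continuous (zetaT lam0 T) := by
  unfold zetaT lam
  refine Continuous.add (by fun_prop) (continuous_const.mul ?_)
  refine Continuous.log (by fun_prop) fun t => ?_
  exact (Real.sqrt_pos.2 (by positivity)).ne'

theorem thetaT_nonneg {lam0 : ℝ} (h : 0 ≤ lam0) (T t : ℝ) : 0 ≤ thetaT lam0 T t := by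
  unfold thetaT lam; positivity

theorem zetaT_zero (T : ℝ) : zetaT 0 T = 0 := by
  funext t; simp [zetaT, lam]

theorem thetaT_zero (T : ℝ) : thetaT 0 T = 0 := by
  funext t; simp [thetaT, lam]

end NavierStokes

/-! ### The bounds for the linear flow and for the bilinear operator. -/

namespace NavierStokes

variable {P : Space → Matrix (Fin 3) (Fin 3) ℂ} {M : Matrix (Fin 3) (Fin 3) ℝ}

/-! ### The heat flow in `ℬ` -/

/-- Gaining r - a derivatives costs t^{-(r-a)/2}. The form `t - 0` of the time gap matches
`continuousOn_wt_hk` at s = 0. -/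
theorem heat_inDom {u₀ : VecDist} {a r μ t : ℝ} (h : InDom 0 a u₀) (ha : 0 ≤ a) (har : a ≤ r)
    (ht : 0 < t) : InDom (μ * t) r (heat t u₀) ∧
    hatW (μ * t) r (heat t u₀) =
      mulCLM (fun ξ => wt (μ * t) (r - a) ξ * hk (t - 0) ξ) (hatW 0 a u₀) ∧
    ‖expA (μ * t) r (heat t u₀)‖ ≤ Real.exp ((r - a) ^ 2 / 4) * t ^ (-((r - a) / 2)) *
      ((1 + μ ^ 2 * t) ^ ((r - a) / 2) * Real.exp (μ ^ 2 * t / 4)) * ‖expA 0 a u₀‖ := by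
  have hra : 0 ≤ r - a := sub_nonneg.2 har
  have hm := isMul_wt_mul_hk (μ * t) hra ht
  have hae : (fun ξ => wt (μ * t) r ξ • hat (heat t u₀) ξ) =ᵐ[volume]
      fun ξ => (wt (μ * t) (r - a) ξ * hk t ξ) • wt 0 a ξ • hat u₀ ξ := by
    filter_upwards [hat_heat h.1 ht.le] with ξ hξ
    rw [hξ, smul_smul, smul_smul]
    congr 1
    have := wt_mul_wt (μ * t) 0 hra ha ξ
    rw [add_zero, sub_add_cancel] at this
    rw [← this]; ring
  have h1 : InDom (μ * t) r (heat t u₀) :=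
    ⟨⟨_, isFun_fourier_heat h.isFun ht.le⟩, (memLp_congr_ae hae).2 (hm.memLp h.2)⟩
  have h2 : hatW (μ * t) r (heat t u₀) =
      mulCLM (fun ξ => wt (μ * t) (r - a) ξ * hk (t - 0) ξ) (hatW 0 a u₀) := by
    rw [sub_zero, mulCLM_apply hm]
    refine classL2_congr (hae.trans ?_)
    filter_upwards [h.coeFn_hatW] with ξ hξ
    rw [hξ]
  refine ⟨h1, h2, ?_⟩
  rw [norm_expA_eq, norm_expA_eq, h2, sub_zero]
  refine norm_mulCLM_apply_le hm.1 (fun ξ => ?_) _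
  rw [abs_of_nonneg (mul_nonneg (wt_nonneg _ _ _) (hk_pos _ _).le)]
  refine le_trans (le_of_eq ?_) (rpow_mul_exp_le (μ := μ) hra ht (symA_nonneg ξ))
  rw [wt, hk, mul_assoc, ← Real.exp_add]
  congr 2
  ring

theorem continuousOn_hatW_heat {u₀ : VecDist} {a r μ : ℝ} (h : InDom 0 a u₀) (ha : 0 ≤ a)
    (har : a ≤ r) (hμ : 0 ≤ μ) (T : ℝ) :
    ContinuousOn (fun t => hatW (μ * t) r (heat t u₀)) (Set.Ioc 0 T) := by
  have h1 := (continuousOn_wt_hk hμ (sub_nonneg.2 har) (T := T) (D := Set.univ)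
    (continuousOn_const (c := hatW 0 a u₀))).comp (f := fun t : ℝ => (t, (0 : ℝ)))
    (s := Set.Ioc 0 T) (by fun_prop) fun t ht => ⟨trivial, ht.1, ht.2⟩
  exact h1.congr fun t ht => (heat_inDom h ha har ht.1).2.1

/-- From 1/2 to 5/4 there are 3/4 derivatives to gain, which gives the constant exp((3/4)²/4) and
the rate t^{-3/8}. The remaining factor (1+λ²)^{3/8} exp(λ²/4) is exactly exp ζ, which explains the
choice of ζ. -/
theorem dataBound_exp : DataBound (Real.exp (9 / 64)) := by
  intro lam0 T hlam hT u₀ hu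
  set μ := lam0 / Real.sqrt T with hμd
  have hμ : 0 ≤ μ := by positivity
  have hI : Set.Ioc 0 T ⊆ Set.Ioi 0 := fun t ht => ht.1
  have hb : ∀ t ∈ Set.Ioc 0 T, ‖expA (thetaT lam0 T t) (5 / 4) (heat t u₀)‖ ≤
      Real.exp (9 / 64) * normHdot (1 / 2) u₀ * Real.exp (zetaT lam0 T t) *
        t ^ (-(3 / 8) : ℝ) := by
    intro t ht
    have h := (heat_inDom (r := 5 / 4) (μ := μ) hu (by norm_num) (by norm_num) ht.1).2.2
    rw [thetaT_eq lam0 ht.1.le, exp_zetaT lam0 hT ht.1.le]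
    refine h.trans (le_of_eq ?_)
    rw [zw, normHdot]
    norm_num
    ring
  refine ⟨memB_of hI (continuous_zetaT _ _).continuousOn (by norm_num)
    (fun t _ => thetaT_nonneg hlam T t) (fun t ht => ?_) ?_ hb, normB_le hI ?_ hb⟩
  · rw [thetaT_eq lam0 ht.1.le]
    exact (heat_inDom hu (by norm_num) (by norm_num) ht.1).1
  · refine (continuousOn_hatW_heat hu (by norm_num) (r := 5 / 4) (by norm_num) hμ T).congr
      fun t ht => ?_
    rw [thetaT_eq lam0 ht.1.le]
  · exact mul_nonneg (Real.exp_pos _).le (norm_nonneg _)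

/-! ### The bilinear operator in `ℬ` -/

/-- In the exponents μ²(t-s)/4 + μ²s/2 ≤ μ²t/2. One factor `zw μ t` is split off as the weight of
the target space; for r = 5/4 the rest has the power 5/8 + 3/8 = 1, whence ⟨λ₀⟩² exp(λ₀²/4). -/
theorem zw_mul_le {μ s t r : ℝ} (hr : 0 ≤ r) (hs : 0 ≤ s) (hst : s ≤ t) :
    (1 + μ ^ 2 * (t - s)) ^ (r / 2) * Real.exp (μ ^ 2 * (t - s) / 4) * zw μ s ^ 2 ≤
      zw μ t * ((1 + μ ^ 2 * t) ^ (r / 2 + 3 / 8) * Real.exp (μ ^ 2 * t / 4)) := by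
  have h0 : 0 ≤ μ ^ 2 := sq_nonneg μ
  have h1 : 0 ≤ μ ^ 2 * s := mul_nonneg h0 hs
  have h2 : 0 ≤ μ ^ 2 * (t - s) := mul_nonneg h0 (sub_nonneg.2 hst)
  have h3 : 0 ≤ μ ^ 2 * t := mul_nonneg h0 (hs.trans hst)
  have e1 : zw μ s ^ 2 = Real.exp (μ ^ 2 * s / 2) * (1 + μ ^ 2 * s) ^ (3 / 4 : ℝ) := by
    rw [zw, mul_pow, ← Real.exp_nat_mul, ← Real.rpow_mul_natCast (by linarith)]
    congr 1
    · congr 1; push_cast; ring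
    · norm_num
  have e2 : zw μ t * ((1 + μ ^ 2 * t) ^ (r / 2 + 3 / 8) * Real.exp (μ ^ 2 * t / 4)) =
      (1 + μ ^ 2 * t) ^ (r / 2) * (1 + μ ^ 2 * t) ^ (3 / 4 : ℝ) * Real.exp (μ ^ 2 * t / 2) := by
    rw [zw, ← Real.rpow_add (by linarith)]
    calc _ = (1 + μ ^ 2 * t) ^ (3 / 8 : ℝ) * (1 + μ ^ 2 * t) ^ (r / 2 + 3 / 8) *
          (Real.exp (μ ^ 2 * t / 4) * Real.exp (μ ^ 2 * t / 4)) := by ring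
      _ = _ := by
          rw [← Real.exp_add, ← Real.rpow_add (by linarith)]
          congr 2 <;> ring
  rw [e1, e2]
  calc _ = (1 + μ ^ 2 * (t - s)) ^ (r / 2) * (1 + μ ^ 2 * s) ^ (3 / 4 : ℝ) *
        (Real.exp (μ ^ 2 * (t - s) / 4) * Real.exp (μ ^ 2 * s / 2)) := by ring
    _ = (1 + μ ^ 2 * (t - s)) ^ (r / 2) * (1 + μ ^ 2 * s) ^ (3 / 4 : ℝ) *
        Real.exp (μ ^ 2 * (t - s) / 4 + μ ^ 2 * s / 2) := by rw [Real.exp_add]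
    _ ≤ _ := by
      gcongr
      · nlinarith
      · nlinarith

theorem bil_inDom (hP : IsFiberedProjection P) {u v : ℝ → VecDist} {θ r t : ℝ} (ht : 0 ≤ t)
    (h : MemLp (fun ξ => wt θ r ξ • duh (fun s => forc P M (u s) (v s)) t ξ) 2 volume) :
    InDom θ r (bil P M u v t) ∧ hatW θ r (bil P M u v t) =
      -classL2 (fun ξ => wt θ r ξ • duh (fun s => forc P M (u s) (v s)) t ξ) := by
  have hae : (fun ξ => wt θ r ξ • hat (bil P M u v t) ξ) =ᵐ[volume]
      fun ξ => (-1 : ℝ) • wt θ r ξ • duh (fun s => forc P M (u s) (v s)) t ξ := by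
    filter_upwards [hat_bil (M := M) hP u v ht] with ξ hξ
    rw [hξ, smul_neg, neg_one_smul]
  refine ⟨⟨⟨_, isFun_fourier_bil hP u v ht⟩, (memLp_congr_ae hae).2 (h.const_smul (-1 : ℝ))⟩, ?_⟩
  rw [hatW, classL2_congr hae, classL2_smul (-1 : ℝ) h, neg_one_smul]

/-- Continuity and weighted bounds of the forcing for a pair in `ℬ`. -/
theorem forc_of_memB (hP : IsFiberedProjection P) (M : Matrix (Fin 3) (Fin 3) ℝ) :
    ∃ C : ℝ, 0 ≤ C ∧ ∀ lam0 T : ℝ, 0 ≤ lam0 → 0 < T → ∀ u v : ℝ → VecDist,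
      MemB (zetaT lam0 T) (thetaT lam0 T) (Set.Ioc 0 T) (3 / 8) (5 / 4) u →
      MemB (zetaT lam0 T) (thetaT lam0 T) (Set.Ioc 0 T) (3 / 8) (5 / 4) v →
      ContinuousOn (fun t => forc P M (u t) (v t)) (Set.Ioc 0 T) ∧ ∀ s ∈ Set.Ioc 0 T,
        eLpNorm (fun ξ => wt (lam0 / Real.sqrt T * s) 0 ξ • forc P M (u s) (v s) ξ) 2 volume ≤
          ENNReal.ofReal (C * normB (zetaT lam0 T) (thetaT lam0 T) (Set.Ioc 0 T) (3 / 8) (5 / 4) u *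
            normB (zetaT lam0 T) (thetaT lam0 T) (Set.Ioc 0 T) (3 / 8) (5 / 4) v *
            zw (lam0 / Real.sqrt T) s ^ 2 * s ^ (-(3 / 4) : ℝ)) := by
  obtain ⟨C, hC, h⟩ := exists_forc_bound hP M
  refine ⟨C, hC, fun lam0 T hlam hT u v hu hv => ⟨?_, fun s hs => ?_⟩⟩
  · have hI : Set.Ioc 0 T ⊆ Set.Ioi 0 := fun t ht => ht.1
    have hcont (w : ℝ → VecDist)
        (hw : MemB (zetaT lam0 T) (thetaT lam0 T) (Set.Ioc 0 T) (3 / 8) (5 / 4) w) :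
        ContinuousOn (fun t => expA 0 (5 / 4) (w t)) (Set.Ioc 0 T) := by
      refine continuousOn_expA_iff.2 (continuousOn_hatW_zero (θ := thetaT lam0 T) (by norm_num)
        (fun t _ => thetaT_nonneg hlam T t) ?_ hw.inDom
        (continuousOn_expA_iff.1 (hw.continuousOn_expA hI (continuous_zetaT _ _).continuousOn)))
      unfold thetaT lam
      fun_prop
    exact continuousOn_forc hP hu.memHdot hv.memHdot (hcont u hu) (hcont v hv)
  · have h1 := hu.inDom s hs
    have h2 := hv.inDom s hs
    have h3 := hu.norm_expA_le hs hs.1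
    have h4 := hv.norm_expA_le hs hs.1
    have h0 := thetaT_nonneg hlam T s
    rw [exp_zetaT lam0 hT hs.1.le] at h3 h4
    rw [thetaT_eq lam0 hs.1.le] at h0 h1 h2 h3 h4
    refine (h _ h0 _ _ h1 h2).trans (ENNReal.ofReal_le_ofReal ?_)
    have h5 : s ^ (-(3 / 8) : ℝ) * s ^ (-(3 / 8) : ℝ) = s ^ (-(3 / 4) : ℝ) := by
      rw [← Real.rpow_add hs.1]; norm_num
    calc C * ‖_‖ * ‖_‖ ≤ C * _ * _ := by
          refine mul_le_mul (mul_le_mul_of_nonneg_left h3 hC) h4 (norm_nonneg _) ?_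
          exact mul_nonneg hC ((norm_nonneg _).trans h3)
      _ = _ := by rw [← h5]; ring

theorem exists_bilinearBound (hP : IsFiberedProjection P) (M : Matrix (Fin 3) (Fin 3) ℝ) :
    ∃ C₃ : ℝ, 0 < C₃ ∧ BilinearBound P M C₃ := by
  obtain ⟨C, hC, h⟩ := forc_of_memB hP M
  have hβ := betaC_nonneg (5 / 4 / 2)
  -- The summand 1 makes the constant positive, since C is only known to be nonnegative.
  refine ⟨Real.exp ((5 / 4) ^ 2 / 4) * C * betaC (5 / 4 / 2) + 1, by positivity,
    fun lam0 T hlam hT u v hu hv => ?_⟩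
  obtain ⟨hFc, hFb⟩ := h lam0 T hlam hT u v hu hv
  set μ := lam0 / Real.sqrt T with hμd
  have hμ : 0 ≤ μ := by positivity
  have hμT : μ ^ 2 * T = lam0 ^ 2 := by
    rw [hμd, div_pow, Real.sq_sqrt hT.le, div_mul_cancel₀ _ hT.ne']
  have hI : Set.Ioc 0 T ⊆ Set.Ioi 0 := fun t ht => ht.1
  generalize hag : normB (zetaT lam0 T) (thetaT lam0 T) (Set.Ioc 0 T) (3 / 8) (5 / 4) u = a
    at hFb ⊢
  generalize hbg : normB (zetaT lam0 T) (thetaT lam0 T) (Set.Ioc 0 T) (3 / 8) (5 / 4) v = b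
    at hFb ⊢
  have ha : 0 ≤ a := hag ▸ normB_nonneg
  have hb : 0 ≤ b := hbg ▸ normB_nonneg
  set F := fun s => forc P M (u s) (v s) with hF
  have hzT (s : ℝ) (hs : s ∈ Set.Ioc 0 T) : zw μ s ≤ zw μ T := by
    have h0 : 0 ≤ μ ^ 2 * s := mul_nonneg (sq_nonneg _) hs.1.le
    unfold zw
    gcongr
    · exact hs.2
    · exact hs.2
  -- For membership and continuity the crude bound with the weight frozen at time T is enough.
  have hFN : ∀ s ∈ Set.Ioc 0 T, eLpNorm (fun ξ => wt (μ * s) 0 ξ • F s ξ) 2 volume ≤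
      ENNReal.ofReal (C * a * b * zw μ T ^ 2 * s ^ (-(3 / 4) : ℝ)) := fun s hs =>
    (hFb s hs).trans (ENNReal.ofReal_le_ofReal (by
      have h1 := (zw_pos μ hs.1.le).le
      have h2 := hzT s hs
      have h3 : 0 ≤ s ^ (-(3 / 4) : ℝ) := Real.rpow_nonneg hs.1.le _
      gcongr))
  have hN : 0 ≤ C * a * b * zw μ T ^ 2 := by positivity
  have hMem (t : ℝ) (ht : t ∈ Set.Ioc 0 T) :=
    bil_inDom (M := M) hP (u := u) (v := v) ht.1.le
      (classL2_wt_duh_eq hμ (r := 5 / 4) (by norm_num) (by norm_num) hFc hN hFN ht.1 ht.2).1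
  have hle : ∀ t ∈ Set.Ioc 0 T, ‖expA (thetaT lam0 T t) (5 / 4) (bil P M u v t)‖ ≤
      (Real.exp ((5 / 4) ^ 2 / 4) * C * betaC (5 / 4 / 2) + 1) * (1 + lam0 ^ 2) *
        Real.exp (lam0 ^ 2 / 4) * a * b * Real.exp (zetaT lam0 T t) * t ^ (-(3 / 8) : ℝ) := by
    intro t ht
    have hz := zw_pos μ ht.1.le
    have h0 : 0 ≤ μ ^ 2 * t := mul_nonneg (sq_nonneg _) ht.1.le
    have h1 : μ ^ 2 * t ≤ lam0 ^ 2 := by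
      rw [← hμT]; exact mul_le_mul_of_nonneg_left ht.2 (sq_nonneg _)
    -- For the norm the weight at time s is kept; its square is what `zw_mul_le` balances against
    -- the heat factor.
    have hd := eLpNorm_wt_duh_le ht.1 hμ (r := 5 / 4) (by norm_num) (by norm_num)
      (hFc.mono (Set.Ioc_subset_Ioc_right ht.2)) (N := fun s => C * a * b * zw μ s ^ 2)
      (fun s _ => mul_nonneg (mul_nonneg (mul_nonneg hC ha) hb) (sq_nonneg _)) (fun s hs => hFb s ⟨hs.1, hs.2.le.trans ht.2⟩)
      (K := C * a * b * (zw μ t * ((1 + lam0 ^ 2) * Real.exp (lam0 ^ 2 / 4)))) ?_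
    · rw [thetaT_eq lam0 ht.1.le, norm_expA (hMem t ht).1, exp_zetaT lam0 hT ht.1.le]
      have h2 : 0 ≤ t ^ (-(3 / 8) : ℝ) := Real.rpow_nonneg ht.1.le _
      refine ENNReal.toReal_le_of_le_ofReal (by positivity) (le_trans (le_of_eq ?_) (hd.trans ?_))
      · rw [← eLpNorm_neg]
        refine eLpNorm_congr_ae ?_
        filter_upwards [hat_bil (M := M) hP u v ht.1.le] with ξ hξ
        rw [Pi.neg_apply, hξ, smul_neg, neg_neg]
      · refine ENNReal.ofReal_le_ofReal ?_
        rw [show (1 / 4 - 5 / 4 / 2 : ℝ) = -(3 / 8) by norm_num]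
        calc _ = Real.exp ((5 / 4) ^ 2 / 4) * C * betaC (5 / 4 / 2) * ((1 + lam0 ^ 2) *
              Real.exp (lam0 ^ 2 / 4) * a * b * zw μ t * t ^ (-(3 / 8) : ℝ)) := by ring
          _ ≤ (Real.exp ((5 / 4) ^ 2 / 4) * C * betaC (5 / 4 / 2) + 1) * ((1 + lam0 ^ 2) *
              Real.exp (lam0 ^ 2 / 4) * a * b * zw μ t * t ^ (-(3 / 8) : ℝ)) := by
                gcongr; linarith
          _ = _ := by ring
    · intro s hs
      have h3 := zw_mul_le (μ := μ) (r := 5 / 4) (by norm_num) hs.1.le hs.2.le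
      have h4 : (1 + μ ^ 2 * t) ^ (5 / 4 / 2 + 3 / 8 : ℝ) * Real.exp (μ ^ 2 * t / 4) ≤
          (1 + lam0 ^ 2) * Real.exp (lam0 ^ 2 / 4) := by
        rw [show (5 / 4 / 2 + 3 / 8 : ℝ) = 1 by norm_num, Real.rpow_one]
        gcongr
      have h5 := mul_le_mul_of_nonneg_left (h3.trans (mul_le_mul_of_nonneg_left h4 hz.le))
        (show 0 ≤ C * a * b by positivity)
      refine le_trans (le_of_eq ?_) h5
      ring
  refine ⟨memB_of hI (continuous_zetaT _ _).continuousOn (by norm_num)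
    (fun t _ => thetaT_nonneg hlam T t) (fun t ht => ?_) ?_ hle, normB_le hI (by positivity) hle⟩
  · rw [thetaT_eq lam0 ht.1.le]
    exact (hMem t ht).1
  · refine (continuousOn_wt_duh hμ (r := 5 / 4) (by norm_num) (by norm_num) hFc hN hFN).neg.congr
      fun t ht => ?_
    rw [thetaT_eq lam0 ht.1.le]
    exact (hMem t ht).2

end NavierStokes

/-! ### Transfer of exponential bounds to the small solution. -/

namespace NavierStokes

variable {P : Space → Matrix (Fin 3) (Fin 3) ℂ} {M : Matrix (Fin 3) (Fin 3) ℝ}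

/-! ### Picard iterates -/

/-- The Picard iterates for `X = exp(-tA²)u₀ + B(X,X)`. -/
def picard (P : Space → Matrix (Fin 3) (Fin 3) ℂ) (M : Matrix (Fin 3) (Fin 3) ℝ) (u₀ : VecDist) :
    ℕ → ℝ → VecDist
  | 0 => fun t => heat t u₀
  | n + 1 => fun t => heat t u₀ + bil P M (picard P M u₀ n) (picard P M u₀ n) t

/-- With U the data norm and q = ⟨λ₀⟩² exp(λ₀²/4), the radius 2C₁U is preserved: C₁U + C₃q(2C₁U)² =
C₁U(1 + 4C₁C₃Uq) ≤ 2C₁U. No contraction is needed in the weighted space, so equality in the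
smallness condition is allowed. -/
theorem picard_bound {C₁ C₃ : ℝ} (hC₁ : 0 < C₁) (hC₃ : 0 < C₃) (hD : DataBound C₁)
    (hB : BilinearBound P M C₃) {u₀ : VecDist} (hu : MemHdot (1 / 2) u₀) {lam0 T : ℝ}
    (hlam : 0 ≤ lam0) (hT : 0 < T)
    (hs : 4 * C₁ * C₃ * normHdot (1 / 2) u₀ * (1 + lam0 ^ 2) * Real.exp (lam0 ^ 2 / 4) ≤ 1) (n : ℕ) :
    MemB (zetaT lam0 T) (thetaT lam0 T) (Set.Ioc 0 T) (3 / 8) (5 / 4) (picard P M u₀ n) ∧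
    normB (zetaT lam0 T) (thetaT lam0 T) (Set.Ioc 0 T) (3 / 8) (5 / 4) (picard P M u₀ n) ≤
      2 * C₁ * normHdot (1 / 2) u₀ := by
  have hU : 0 ≤ normHdot (1 / 2) u₀ := norm_nonneg _
  obtain ⟨h1, h2⟩ := hD lam0 T hlam hT u₀ hu
  induction n with
  | zero => exact ⟨h1, h2.trans (by nlinarith [mul_nonneg hC₁.le hU])⟩
  | succ n ih =>
    obtain ⟨h3, h4⟩ := hB lam0 T hlam hT _ _ ih.1 ih.1
    obtain ⟨h5, h6⟩ := h1.add h3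
    refine ⟨h5, h6.trans ((add_le_add h2 (h4.trans ?_)).trans
      (le_of_eq (show _ + C₁ * normHdot (1 / 2) u₀ = _ by ring)))⟩
    generalize hbg : normB (zetaT lam0 T) (thetaT lam0 T) (Set.Ioc 0 T) (3 / 8) (5 / 4)
      (picard P M u₀ n) = b at *
    have hb : 0 ≤ b := hbg ▸ normB_nonneg
    generalize normHdot (1 / 2) u₀ = U at *
    have hq : 0 ≤ (1 + lam0 ^ 2) * Real.exp (lam0 ^ 2 / 4) := by positivity
    generalize hqg : Real.exp (lam0 ^ 2 / 4) = q at *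
    have h7 : b * b ≤ (2 * C₁ * U) * (2 * C₁ * U) := mul_self_le_mul_self hb ih.2
    calc C₃ * (1 + lam0 ^ 2) * q * b * b = C₃ * ((1 + lam0 ^ 2) * q) * (b * b) := by ring
      _ ≤ C₃ * ((1 + lam0 ^ 2) * q) * ((2 * C₁ * U) * (2 * C₁ * U)) := by gcongr
      _ = (4 * C₁ * C₃ * U * (1 + lam0 ^ 2) * q) * (C₁ * U) := by ring
      _ ≤ 1 * (C₁ * U) := by gcongr
      _ = C₁ * U := one_mul _

theorem memB_zero_iff {T : ℝ} {v : ℝ → VecDist} : MemB 0 0 (Set.Ioc 0 T) (3 / 8) (5 / 4) v ↔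
    MemB (zetaT 0 T) (thetaT 0 T) (Set.Ioc 0 T) (3 / 8) (5 / 4) v := by
  rw [zetaT_zero, thetaT_zero]

theorem bil_self_sub (hP : IsFiberedProjection P) {u w : ℝ → VecDist} {T : ℝ} (hT : 0 < T)
    (hu : MemB 0 0 (Set.Ioc 0 T) (3 / 8) (5 / 4) u) (hw : MemB 0 0 (Set.Ioc 0 T) (3 / 8) (5 / 4) w)
    {t : ℝ} (ht : t ∈ Set.Ioc 0 T) : bil P M u u t - bil P M w w t =
      bil P M (fun s => u s - w s) u t + bil P M w (fun s => u s - w s) t := by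
  obtain ⟨C, hC, h⟩ := forc_of_memB hP M
  have hd := hu.sub hw
  have hint (a b : ℝ → VecDist) (ha : MemB 0 0 (Set.Ioc 0 T) (3 / 8) (5 / 4) a)
      (hb : MemB 0 0 (Set.Ioc 0 T) (3 / 8) (5 / 4) b) :
      IntervalIntegrable (fun s => mulCLM (hk (t - s)) (forc P M (a s) (b s))) volume 0 t := by
    rw [memB_zero_iff] at ha hb
    obtain ⟨h1, h2⟩ := h 0 T le_rfl hT a b ha hb
    refine intervalIntegrable_duh ht.1.le (h1.mono (Set.Ioc_subset_Ioc_right ht.2)) (K := C *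
      normB (zetaT 0 T) (thetaT 0 T) (Set.Ioc 0 T) (3 / 8) (5 / 4) a *
      normB (zetaT 0 T) (thetaT 0 T) (Set.Ioc 0 T) (3 / 8) (5 / 4) b)
      fun s hs => ?_
    have h3 := h2 s ⟨hs.1, hs.2.le.trans ht.2⟩
    rw [zero_div, zero_mul] at h3
    have hz : zw 0 s = 1 := by simp [zw]
    rw [hz, one_pow, mul_one] at h3
    refine norm_le_of_wt le_rfl ?_ h3
    exact mul_nonneg (mul_nonneg (mul_nonneg hC normB_nonneg) normB_nonneg)
      (Real.rpow_nonneg hs.1.le _)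
  have key : duh (fun s => forc P M (u s) (u s)) t - duh (fun s => forc P M (w s) (w s)) t =
      duh (fun s => forc P M (u s - w s) (u s)) t + duh (fun s => forc P M (w s) (u s - w s)) t := by
    simp only [duh]
    rw [← intervalIntegral.integral_sub (hint u u hu hu) (hint w w hw hw),
      ← intervalIntegral.integral_add (hint _ u hd hu) (hint w _ hw hd)]
    refine intervalIntegral.integral_congr_ae (ae_of_all _ fun s hs => ?_)
    rw [Set.uIoc_of_le ht.1.le] at hs
    have hs' : s ∈ Set.Ioc 0 T := ⟨hs.1, hs.2.trans ht.2⟩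
    rw [forc_sub_left hP (hu.memHdot s hs') (hw.memHdot s hs') (hu.memHdot s hs'),
      forc_sub_right hP (hw.memHdot s hs') (hu.memHdot s hs') (hw.memHdot s hs'), map_sub, map_sub]
    abel
  rw [bil_eq hP _ _ ht.1.le, bil_eq hP _ _ ht.1.le, bil_eq hP _ _ ht.1.le, bil_eq hP _ _ ht.1.le]
  have hL (f g a b : VecL2) (hfg : f - g = a + b) :
      Lp.toTemperedDistribution (𝓕⁻ (-f) : VecL2) - Lp.toTemperedDistribution (𝓕⁻ (-g) : VecL2) =
      Lp.toTemperedDistribution (𝓕⁻ (-a) : VecL2) +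
        Lp.toTemperedDistribution (𝓕⁻ (-b) : VecL2) := by
    have e : -f = -a + -b + -g := by rw [eq_add_of_sub_eq hfg]; abel
    have eF : (𝓕⁻ (-f) : VecL2) = 𝓕⁻ (-a) + 𝓕⁻ (-b) + 𝓕⁻ (-g) := by
      rw [e]
      exact ((Lp.fourierTransformₗᵢ Space Vec).symm.map_add _ _).trans
        (congrArg (· + _) ((Lp.fourierTransformₗᵢ Space Vec).symm.map_add _ _))
    have hadd (f g : VecL2) : Lp.toTemperedDistribution (f + g) =
        Lp.toTemperedDistribution f + Lp.toTemperedDistribution g :=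
      map_add (Lp.toTemperedDistributionCLM Vec volume 2) f g
    rw [eF, hadd, hadd, add_sub_cancel_right]
  exact hL _ _ _ _ key

/-- The Picard iterates converge to the small solution. -/
theorem tendsto_picard (hP : IsFiberedProjection P) {C₁ C₃ : ℝ} (hD : DataBound C₁)
    (hB : BilinearBound P M C₃) {u₀ : VecDist} (hu : MemHdot (1 / 2) u₀) {X : ℝ → VecDist}
    (hX : IsSmallSolution P M u₀ X) {t : ℝ} (ht : 0 < t) :
    Tendsto (fun n => hatW 0 (5 / 4) (picard P M u₀ n t)) atTop (𝓝 (hatW 0 (5 / 4) (X t))) := by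
  obtain ⟨γ, R, ⟨hγ, hγB⟩, hR, hY, hγR, hXm, hXR, hXe⟩ := hX
  have hIoc : Set.Ioc 0 t ⊆ Set.Ioi 0 := fun s hs => hs.1
  have ht' : t ∈ Set.Ioc 0 t := ⟨ht, le_rfl⟩
  have hbil (u v : ℝ → VecDist) (hu : MemB 0 0 (Set.Ioc 0 t) (3 / 8) (5 / 4) u)
      (hv : MemB 0 0 (Set.Ioc 0 t) (3 / 8) (5 / 4) v) :
      MemB 0 0 (Set.Ioc 0 t) (3 / 8) (5 / 4) (bil P M u v) :=
    memB_zero_iff.2 (hB 0 t le_rfl ht u v (memB_zero_iff.1 hu) (memB_zero_iff.1 hv)).1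
  have hYm : MemB 0 0 (Set.Ioc 0 t) (3 / 8) (5 / 4) (fun s => heat s u₀) :=
    memB_zero_iff.2 (hD 0 t le_rfl ht u₀ hu).1
  have hYR : normB 0 0 (Set.Ioc 0 t) (3 / 8) (5 / 4) (fun s => heat s u₀) ≤ R := by
    refine le_trans (csSup_le_csSup ?_ (Set.Nonempty.image _ ⟨t, ht'⟩) (Set.image_mono hIoc)) hY
    -- The supremum over all times is finite because C₁ does not depend on T; each time s is the
    -- endpoint of its own interval.
    refine ⟨C₁ * normHdot (1 / 2) u₀, ?_⟩
    rintro _ ⟨s, hs, rfl⟩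
    obtain ⟨h1, h2⟩ := hD 0 s le_rfl hs u₀ hu
    rw [zetaT_zero, thetaT_zero] at h1 h2
    exact (le_csSup h1.bounded ⟨s, ⟨hs, le_rfl⟩, rfl⟩).trans h2
  have hXm' := hXm.mono hIoc
  have hXR' : normB 0 0 (Set.Ioc 0 t) (3 / 8) (5 / 4) X ≤ 2 * R :=
    (csSup_le_csSup hXm.bounded (Set.Nonempty.image _ ⟨t, ht'⟩) (Set.image_mono hIoc)).trans hXR
  have hpic (n : ℕ) : MemB 0 0 (Set.Ioc 0 t) (3 / 8) (5 / 4) (picard P M u₀ n) ∧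
      normB 0 0 (Set.Ioc 0 t) (3 / 8) (5 / 4) (picard P M u₀ n) ≤ 2 * R := by
    induction n with
    | zero => exact ⟨hYm, hYR.trans (by linarith)⟩
    | succ n ih =>
      obtain ⟨h5, h6⟩ := hYm.add (hbil _ _ ih.1 ih.1)
      refine ⟨h5, h6.trans ?_⟩
      have h7 := hγB t ht _ _ ih.1 ih.1
      have h8 : 0 ≤ normB 0 0 (Set.Ioc 0 t) (3 / 8) (5 / 4) (picard P M u₀ n) := normB_nonneg
      have h9 := mul_self_le_mul_self h8 ih.2
      have h10 := mul_le_mul_of_nonneg_left h9 hγ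
      nlinarith
  -- Contraction: B(X,X) - B(Y,Y) = B(X-Y,X) + B(Y,X-Y), and both X and the iterates lie in the ball
  -- of radius 2R, which gives the factor 2·γ·2R.
  have hdiff (n : ℕ) : normB 0 0 (Set.Ioc 0 t) (3 / 8) (5 / 4) (fun s => X s - picard P M u₀ n s) ≤
      (4 * γ * R) ^ n * (4 * R) := by
    induction n with
    | zero =>
      refine normB_le hIoc (by positivity) fun s hs => ?_
      have h1 := hXm'.norm_expA_le hs hs.1
      have h2 := (hpic 0).1.norm_expA_le hs hs.1
      rw [expA_sub (hXm'.inDom s hs) ((hpic 0).1.inDom s hs)]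
      refine (norm_sub_le _ _).trans ((add_le_add h1 h2).trans ?_)
      rw [← add_mul, ← add_mul, pow_zero, one_mul]
      have h3 : 0 ≤ s ^ (-(3 / 8) : ℝ) := Real.rpow_nonneg hs.1.le _
      gcongr
      linarith [(hpic 0).2]
    | succ n ih =>
      have hd := hXm'.sub (hpic n).1
      have h0 : 0 ≤ normB 0 0 (Set.Ioc 0 t) (3 / 8) (5 / 4) (fun s => X s - picard P M u₀ n s) :=
        normB_nonneg
      obtain ⟨h1, h2⟩ := (hbil _ _ hd hXm').add (hbil _ _ (hpic n).1 hd)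
      refine normB_le hIoc (by positivity) fun s hs => ?_
      have e : X s - picard P M u₀ (n + 1) s = bil P M (fun s => X s - picard P M u₀ n s) X s +
          bil P M (picard P M u₀ n) (fun s => X s - picard P M u₀ n s) s := by
        rw [← bil_self_sub hP ht hXm' (hpic n).1 hs, hXe s hs.1]
        simp only [picard]
        abel
      rw [e]
      refine (h1.norm_expA_le hs hs.1).trans ?_
      have h3 : 0 ≤ s ^ (-(3 / 8) : ℝ) := Real.rpow_nonneg hs.1.le _
      gcongr
      refine h2.trans ((add_le_add (hγB t ht _ _ hd hXm') (hγB t ht _ _ (hpic n).1 hd)).trans ?_)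
      generalize normB 0 0 (Set.Ioc 0 t) (3 / 8) (5 / 4) (fun s => X s - picard P M u₀ n s) = d
        at *
      have h4 := mul_le_mul_of_nonneg_left hXR' (mul_nonneg hγ h0)
      have h5 := mul_le_mul_of_nonneg_left (hpic n).2 (mul_nonneg hγ h0)
      have h6 := mul_le_mul_of_nonneg_left ih (show 0 ≤ 4 * γ * R by positivity)
      rw [pow_succ]
      nlinarith
  refine tendsto_iff_norm_sub_tendsto_zero.2 ?_
  have hlim : Tendsto (fun n : ℕ => (4 * γ * R) ^ n * (4 * R) * (Real.exp 0 * t ^ (-(3 / 8) : ℝ)))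
      atTop (𝓝 0) := by
    have := ((tendsto_pow_atTop_nhds_zero_of_lt_one (by positivity) hγR).mul_const (4 * R)).mul_const
      (Real.exp 0 * t ^ (-(3 / 8) : ℝ))
    simpa only [zero_mul] using this
  refine squeeze_zero (fun _ => norm_nonneg _) (fun n => ?_) hlim
  have hd := hXm'.sub (hpic n).1
  have h1 := hd.norm_expA_le ht' ht
  have h2 : ‖hatW 0 (5 / 4) (picard P M u₀ n t) - hatW 0 (5 / 4) (X t)‖ =
      ‖expA 0 (5 / 4) (X t - picard P M u₀ n t)‖ := by
    rw [expA_sub (hXm'.memHdot t ht') ((hpic n).1.memHdot t ht'), expA_eq, expA_eq, norm_sub_rev,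
      ← norm_fourierInv]
    congr 1
    exact (Lp.fourierTransformₗᵢ Space Vec).symm.map_sub _ _
  rw [h2]
  refine h1.trans ?_
  rw [mul_assoc]
  have h3 : 0 ≤ t ^ (-(3 / 8) : ℝ) := Real.rpow_nonneg ht.le _
  exact mul_le_mul_of_nonneg_right (hdiff n) (mul_nonneg (Real.exp_pos _).le h3)

/-- Exponentially weighted bounds for the small solution. -/
theorem solution_bound (hP : IsFiberedProjection P) {C₁ C₃ : ℝ} (hC₁ : 0 < C₁) (hC₃ : 0 < C₃)
    (hD : DataBound C₁) (hB : BilinearBound P M C₃) {u₀ : VecDist} (hu : MemHdot (1 / 2) u₀)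
    {X : ℝ → VecDist} (hX : IsSmallSolution P M u₀ X) {l t : ℝ} (ht : 0 < t) (hl : 0 ≤ l)
    (hs : 4 * C₁ * C₃ * normHdot (1 / 2) u₀ * (1 + l ^ 2) * Real.exp (l ^ 2 / 4) ≤ 1) :
    InDom (l * Real.sqrt t) (5 / 4) (X t) ∧ ‖expA (l * Real.sqrt t) (5 / 4) (X t)‖ ≤
      2 * C₁ * normHdot (1 / 2) u₀ * (Real.exp (l ^ 2 / 4) * (1 + l ^ 2) ^ (3 / 8 : ℝ)) *
        t ^ (-(3 / 8) : ℝ) := by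
  have hXm : MemHdot (5 / 4) (X t) := by
    obtain ⟨γ, R, -, -, -, -, hXm, -⟩ := hX
    exact hXm.memHdot t ht
  have ht' : t ∈ Set.Ioc 0 t := ⟨ht, le_rfl⟩
  have hst := Real.mul_self_sqrt ht.le
  -- The weighted space is used with T = t: at the endpoint λ(t) = l, so the weight is exp(l√t A).
  have hθ : l / Real.sqrt t * t = l * Real.sqrt t := by
    rw [div_mul_eq_mul_div, div_eq_iff (Real.sqrt_pos.2 ht).ne', mul_assoc, hst]
  have hz : zw (l / Real.sqrt t) t = Real.exp (l ^ 2 / 4) * (1 + l ^ 2) ^ (3 / 8 : ℝ) := by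
    rw [zw, div_pow, Real.sq_sqrt ht.le, div_mul_cancel₀ _ ht.ne']
  have hU : 0 ≤ normHdot (1 / 2) u₀ := norm_nonneg _
  set θ := l * Real.sqrt t with hθd
  set B := 2 * C₁ * normHdot (1 / 2) u₀ * (Real.exp (l ^ 2 / 4) * (1 + l ^ 2) ^ (3 / 8 : ℝ)) *
        t ^ (-(3 / 8) : ℝ) with hBd
  have h3 : 0 ≤ t ^ (-(3 / 8) : ℝ) := Real.rpow_nonneg ht.le _
  have hB0 : 0 ≤ B := by positivity
  have hpic (k : ℕ) : InDom θ (5 / 4) (picard P M u₀ k t) ∧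
      ‖expA θ (5 / 4) (picard P M u₀ k t)‖ ≤ B := by
    obtain ⟨h1, h2⟩ := picard_bound hC₁ hC₃ hD hB hu hl ht hs k
    have h4 := h1.inDom t ht'
    have h5 := h1.norm_expA_le ht' ht
    rw [thetaT_eq l ht.le, hθ] at h4 h5
    rw [exp_zetaT l ht ht.le, hz] at h5
    refine ⟨h4, h5.trans ?_⟩
    rw [hBd]
    gcongr
  have hθ0 : 0 ≤ θ := by positivity
  have hmul (n : ℕ) := (isLocMul_wt θ (le_refl 0)).isMul n
  -- The iterates are known to converge only without the weight. On bounded frequencies the weight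
  -- is a bounded operator, so the uniform bound passes to the limit, and then the cut-off is
  -- removed.
  have hle : eLpNorm (fun ξ => wt θ (5 / 4) ξ • hat (X t) ξ) 2 volume ≤ ENNReal.ofReal B := by
    refine eLpNorm_le_of_chi ?_ fun n => ?_
    · exact (measurable_wt _ _).aestronglyMeasurable.smul (InDom.isFun hXm).1
    have h6 : (fun ξ => chi n ξ • wt θ (5 / 4) ξ • hat (X t) ξ) =ᵐ[volume]
        mulCLM (fun ξ => chi n ξ * wt θ 0 ξ) (hatW 0 (5 / 4) (X t)) := by
      filter_upwards [coeFn_mulCLM (hmul n) (hatW 0 (5 / 4) (X t)), hXm.coeFn_hatW] with ξ h1 h2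
      rw [h1, h2, smul_smul, smul_smul, mul_assoc, wt_mul_wt _ _ le_rfl (by norm_num), add_zero,
        zero_add]
    rw [eLpNorm_congr_ae h6, ← ENNReal.ofReal_toReal (Lp.eLpNorm_ne_top _), ← Lp.norm_def]
    refine ENNReal.ofReal_le_ofReal ?_
    refine le_of_tendsto' (((mulCLM fun ξ => chi n ξ * wt θ 0 ξ).continuous.tendsto _).comp
      (tendsto_picard hP hD hB hu hX ht)).norm fun k => ?_
    refine le_trans ?_ (hpic k).2
    have h7 : mulCLM (fun ξ => chi n ξ * wt θ 0 ξ) (hatW 0 (5 / 4) (picard P M u₀ k t)) =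
        mulCLM (chi n) (hatW θ (5 / 4) (picard P M u₀ k t)) := by
      rw [((hpic k).1.of_le (by norm_num) hθ0).2.1,
        mulCLM_mulCLM (hmul n) (isMul_wt_neg (by linarith)).1]
      congr 2
      funext ξ
      rw [mul_assoc, wt_mul_wt _ _ le_rfl le_rfl]
      simp [wt]
    rw [Function.comp_apply, h7, norm_expA_eq]
    simpa using norm_mulCLM_apply_le (measurable_chi n) (abs_chi_le n)
      (hatW θ (5 / 4) (picard P M u₀ k t))
  have hdom : InDom θ (5 / 4) (X t) :=
    ⟨hXm.1, (measurable_wt _ _).aestronglyMeasurable.smul (InDom.isFun hXm).1,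
      hle.trans_lt ENNReal.ofReal_lt_top⟩
  refine ⟨hdom, ?_⟩
  rw [norm_expA hdom]
  exact ENNReal.toReal_le_of_le_ofReal hB0 hle

end NavierStokes

/-! ### Solutions with critical exponentially weighted bounds. -/

namespace NavierStokes

variable {P : Space → Matrix (Fin 3) (Fin 3) ℂ} {M : Matrix (Fin 3) (Fin 3) ℝ}

/-! ### Solutions with exponentially weighted bounds -/

/-- `X` solves the integral equation, and its forcing obeys the critical bounds with weights
`exp(θ A)`, `θ ≤ l √t`. -/
structure Regular (P : Space → Matrix (Fin 3) (Fin 3) ℂ) (M : Matrix (Fin 3) (Fin 3) ℝ)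
    (u₀ : VecDist) (X : ℝ → VecDist) (l N : ℝ) : Prop where
  l_nonneg : 0 ≤ l
  N_nonneg : 0 ≤ N
  data : MemHdot (1 / 2) u₀
  data_le : normHdot (1 / 2) u₀ ≤ N
  eq : ∀ t, 0 < t → X t = heat t u₀ + bil P M X X t
  hdot : ∀ t, 0 < t → MemHdot (5 / 4) (X t)
  cont : ContinuousOn (fun s => forc P M (X s) (X s)) (Set.Ioi 0)
  forc_le : ∀ t, 0 < t → ∀ θ, 0 ≤ θ → θ ≤ l * Real.sqrt t →
    eLpNorm (fun ξ => wt θ 0 ξ • forc P M (X t) (X t) ξ) 2 volume ≤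
      ENNReal.ofReal (N * t ^ (-(3 / 4) : ℝ))

/-- The smallness condition alone bounds the data norm by 1/(4C₁C₃), so N can be chosen before the
data. This is why K in the differential inequality does not depend on u₀. -/
theorem exists_regular (hP : IsFiberedProjection P) {C₁ C₃ : ℝ} (hC₁ : 0 < C₁) (hC₃ : 0 < C₃)
    (hD : DataBound C₁) (hB : BilinearBound P M C₃) {l : ℝ} (hl : 0 ≤ l) :
    ∃ N : ℝ, ∀ u₀ X, MemHdot (1 / 2) u₀ → IsSmallSolution P M u₀ X →
      4 * C₁ * C₃ * normHdot (1 / 2) u₀ * (1 + l ^ 2) * Real.exp (l ^ 2 / 4) ≤ 1 →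
      Regular P M u₀ X l N := by
  obtain ⟨C, hC, h⟩ := exists_forc_bound hP M
  set z := Real.exp (l ^ 2 / 4) * (1 + l ^ 2) ^ (3 / 8 : ℝ) with hz
  have hz0 : 0 ≤ z := by positivity
  refine ⟨C * (2 * C₁ * (1 / (4 * C₁ * C₃)) * z) ^ 2 + 1 / (4 * C₁ * C₃), fun u₀ X hu hX hs => ?_⟩
  have hU : 0 ≤ normHdot (1 / 2) u₀ := norm_nonneg _
  have hU1 : normHdot (1 / 2) u₀ ≤ 1 / (4 * C₁ * C₃) := by
    rw [le_div_iff₀ (by positivity)]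
    refine le_trans ?_ hs
    rw [mul_assoc (4 * C₁ * C₃ * _), mul_comm (normHdot (1 / 2) u₀)]
    refine le_mul_of_one_le_right (by positivity) ?_
    exact one_le_mul_of_one_le_of_one_le (by nlinarith [sq_nonneg l])
      (Real.one_le_exp (by positivity))
  have hb (t : ℝ) (ht : 0 < t) := solution_bound hP hC₁ hC₃ hD hB hu hX ht hl hs
  obtain ⟨γ, R, -, -, -, -, hXm, -, hXe⟩ := hX
  have hcont : ContinuousOn (fun t => expA 0 (5 / 4) (X t)) (Set.Ioi 0) :=
    hXm.continuousOn_expA subset_rfl continuousOn_const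
  refine ⟨hl, by positivity, hu, hU1.trans (le_add_of_nonneg_left (by positivity)), hXe,
    hXm.memHdot, continuousOn_forc hP hXm.memHdot hXm.memHdot hcont hcont,
    fun t ht θ hθ hθl => ?_⟩
  obtain ⟨h1, h2⟩ := hb t ht
  obtain ⟨h3, -, h4⟩ := h1.of_le (by norm_num) hθl
  refine (h θ hθ _ _ h3 h3).trans (ENNReal.ofReal_le_ofReal ?_)
  have h5 : 0 ≤ t ^ (-(3 / 8) : ℝ) := Real.rpow_nonneg ht.le _
  have h6 : t ^ (-(3 / 8) : ℝ) * t ^ (-(3 / 8) : ℝ) = t ^ (-(3 / 4) : ℝ) := by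
    rw [← Real.rpow_add ht]; norm_num
  have h7 : ‖expA θ (5 / 4) (X t)‖ ≤
      2 * C₁ * (1 / (4 * C₁ * C₃)) * z * t ^ (-(3 / 8) : ℝ) := by
    refine h4.trans (h2.trans ?_)
    gcongr
  calc C * ‖expA θ (5 / 4) (X t)‖ * ‖expA θ (5 / 4) (X t)‖
      ≤ C * (2 * C₁ * (1 / (4 * C₁ * C₃)) * z * t ^ (-(3 / 8) : ℝ)) *
        (2 * C₁ * (1 / (4 * C₁ * C₃)) * z * t ^ (-(3 / 8) : ℝ)) := by gcongr
    _ = C * (2 * C₁ * (1 / (4 * C₁ * C₃)) * z) ^ 2 * t ^ (-(3 / 4) : ℝ) := by rw [← h6]; ring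
    _ ≤ _ := by
      have : 0 ≤ t ^ (-(3 / 4) : ℝ) := Real.rpow_nonneg ht.le _
      gcongr
      exact le_add_of_nonneg_right (by positivity)

/-- The constant in the bounds for regular solutions. -/
def solC (l N r : ℝ) : ℝ :=
  Real.exp (r ^ 2 / 4) * ((1 + l ^ 2) ^ (r / 2) * Real.exp (l ^ 2 / 4)) * (1 + N * betaC (r / 2))

section

variable {u₀ : VecDist} {X : ℝ → VecDist} {l N : ℝ}

theorem Regular.solC_nonneg (h : Regular P M u₀ X l N) (r : ℝ) : 0 ≤ solC l N r := by
  have h1 := h.N_nonneg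
  have h2 := betaC_nonneg (r / 2)
  unfold solC
  positivity

theorem Regular.hat_eq (hP : IsFiberedProjection P) (h : Regular P M u₀ X l N) {t : ℝ}
    (ht : 0 < t) : hat (X t) =ᵐ[volume] fun ξ =>
      hk t ξ • hat u₀ ξ - duh (fun s => forc P M (X s) (X s)) t ξ := by
  rw [h.eq t ht]
  have h1 := hat_add ⟨_, isFun_fourier_heat (InDom.isFun h.data) ht.le⟩
    ⟨_, isFun_fourier_bil (M := M) hP X X ht.le⟩
  filter_upwards [h1, hat_heat h.data.1 ht.le, hat_bil (M := M) hP X X ht.le] with ξ e1 e2 e3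
  rw [e1, e2, e3, sub_eq_add_neg]

/-- The curve l√s is concave and vanishes at 0, so a line through the origin that lies below it at
time t lies below it on all of (0, t]. -/
theorem Regular.forc_le_of_le (h : Regular P M u₀ X l N) {t μ : ℝ} (ht : 0 < t) (hμ : 0 ≤ μ)
    (hμt : μ * t ≤ l * Real.sqrt t) {s : ℝ} (hs : s ∈ Set.Ioc 0 t) :
    eLpNorm (fun ξ => wt (μ * s) 0 ξ • forc P M (X s) (X s) ξ) 2 volume ≤
      ENNReal.ofReal (N * s ^ (-(3 / 4) : ℝ)) := by
  refine h.forc_le s hs.1 _ (mul_nonneg hμ hs.1.le) ?_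
  have h1 : 0 < Real.sqrt t := Real.sqrt_pos.2 ht
  have h2 : μ * Real.sqrt t ≤ l := by
    have e := Real.mul_self_sqrt ht.le
    have : μ * Real.sqrt t * Real.sqrt t ≤ l * Real.sqrt t := by rwa [mul_assoc, e]
    exact le_of_mul_le_mul_right this h1
  have h3 : Real.sqrt s ≤ Real.sqrt t := Real.sqrt_le_sqrt hs.2
  calc μ * s = μ * Real.sqrt s * Real.sqrt s := by rw [mul_assoc, Real.mul_self_sqrt hs.1.le]
    _ ≤ l * Real.sqrt s := by
      refine mul_le_mul_of_nonneg_right (le_trans ?_ h2) (Real.sqrt_nonneg s)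
      exact mul_le_mul_of_nonneg_left h3 hμ

theorem Regular.memLp_duh (h : Regular P M u₀ X l N) {r t θ : ℝ} (hr : 0 ≤ r) (hr2 : r < 2)
    (ht : 0 < t) (hθ : 0 ≤ θ) (hθl : θ ≤ l * Real.sqrt t) :
    MemLp (fun ξ => wt θ r ξ • duh (fun s => forc P M (X s) (X s)) t ξ) 2 volume ∧
    ‖classL2 (fun ξ => wt θ r ξ • duh (fun s => forc P M (X s) (X s)) t ξ)‖ ≤
      Real.exp (r ^ 2 / 4) * ((1 + l ^ 2) ^ (r / 2) * Real.exp (l ^ 2 / 4) * N) *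
        betaC (r / 2) * t ^ (1 / 4 - r / 2) := by
  have hN := h.N_nonneg
  have hl := h.l_nonneg
  have hβ := betaC_nonneg (r / 2)
  -- The fixed weight θ is reached at time t along the linear weight of slope θ/t, to which the
  -- Duhamel estimate applies.
  have hμ : 0 ≤ θ / t := by positivity
  have hμt : θ / t * t = θ := div_mul_cancel₀ _ ht.ne'
  have hF : ContinuousOn (fun s => forc P M (X s) (X s)) (Set.Ioc 0 t) :=
    h.cont.mono fun s hs => hs.1
  have hb := fun s (hs : s ∈ Set.Ioc 0 t) => h.forc_le_of_le ht hμ (hμt.trans_le hθl) hs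
  have hm := (classL2_wt_duh_eq hμ hr hr2 hF hN hb ht le_rfl).1
  have hle := eLpNorm_wt_duh_le ht hμ hr hr2 hF (N := fun _ => N) (fun _ _ => hN)
    (fun s hs => hb s ⟨hs.1, hs.2.le⟩)
    (K := (1 + l ^ 2) ^ (r / 2) * Real.exp (l ^ 2 / 4) * N) (fun s hs => ?_)
  · rw [hμt] at hm hle
    refine ⟨hm, ?_⟩
    rw [norm_classL2 hm]
    refine ENNReal.toReal_le_of_le_ofReal ?_ hle
    have : 0 ≤ t ^ (1 / 4 - r / 2) := Real.rpow_nonneg ht.le _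
    positivity
  · have h1 : (θ / t) ^ 2 * (t - s) ≤ l ^ 2 := by
      have h2 : (θ / t) ^ 2 * t ≤ l ^ 2 := by
        have h3 : θ ^ 2 ≤ l ^ 2 * t := by
          have := mul_self_le_mul_self hθ hθl
          have e := Real.mul_self_sqrt ht.le
          calc θ ^ 2 = θ * θ := sq θ
            _ ≤ l * Real.sqrt t * (l * Real.sqrt t) := this
            _ = l ^ 2 * (Real.sqrt t * Real.sqrt t) := by ring
            _ = _ := by rw [e]
        rw [div_pow, sq t, div_mul_eq_mul_div, mul_div_mul_right _ _ ht.ne', div_le_iff₀ ht]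
        exact h3
      refine le_trans ?_ h2
      exact mul_le_mul_of_nonneg_left (by linarith [hs.1]) (sq_nonneg _)
    have h0 : 0 ≤ (θ / t) ^ 2 * (t - s) := mul_nonneg (sq_nonneg _) (by linarith [hs.2])
    gcongr

theorem Regular.inDom (hP : IsFiberedProjection P) (h : Regular P M u₀ X l N) {a r : ℝ}
    (ha : 0 ≤ a) (har : a ≤ r) (hr2 : r < 2) (hu : InDom 0 a u₀) {t θ : ℝ} (ht : 0 < t)
    (hθ : 0 ≤ θ) (hθl : θ ≤ l * Real.sqrt t) :
    InDom θ r (X t) ∧ ‖expA θ r (X t)‖ ≤ solC l N r *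
      (t ^ (-((r - a) / 2)) * ‖expA 0 a u₀‖ + t ^ (1 / 4 - r / 2)) := by
  have hr : 0 ≤ r := ha.trans har
  have hN := h.N_nonneg
  have hl := h.l_nonneg
  have hβ := betaC_nonneg (r / 2)
  have hμt : θ / t * t = θ := div_mul_cancel₀ _ ht.ne'
  obtain ⟨h1, -, h2⟩ := heat_inDom (μ := θ / t) hu ha har ht
  obtain ⟨h3, h4⟩ := h.memLp_duh hr hr2 ht hθ hθl
  obtain ⟨h5, h6⟩ := bil_inDom hP ht.le h3
  rw [hμt] at h1 h2
  rw [h.eq t ht]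
  refine ⟨h1.add h5, ?_⟩
  rw [expA_add h1 h5]
  refine (norm_add_le _ _).trans ?_
  rw [norm_expA_eq θ r (bil P M X X t), h6, norm_neg]
  have h7 : (θ / t) ^ 2 * t ≤ l ^ 2 := by
    have h3 : θ ^ 2 ≤ l ^ 2 * t := by
      have := mul_self_le_mul_self hθ hθl
      have e := Real.mul_self_sqrt ht.le
      calc θ ^ 2 = θ * θ := sq θ
        _ ≤ l * Real.sqrt t * (l * Real.sqrt t) := this
        _ = l ^ 2 * (Real.sqrt t * Real.sqrt t) := by ring
        _ = _ := by rw [e]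
    rw [div_pow, sq t, div_mul_eq_mul_div, mul_div_mul_right _ _ ht.ne', div_le_iff₀ ht]
    exact h3
  have h8 : 0 ≤ (θ / t) ^ 2 * t := mul_nonneg (sq_nonneg _) ht.le
  have h9 : 0 ≤ t ^ (-((r - a) / 2)) := Real.rpow_nonneg ht.le _
  have h10 : 0 ≤ t ^ (1 / 4 - r / 2) := Real.rpow_nonneg ht.le _
  have h11 : Real.exp ((r - a) ^ 2 / 4) ≤ Real.exp (r ^ 2 / 4) := by
    refine Real.exp_le_exp.2 ?_
    nlinarith
  have h12 : (1 + (θ / t) ^ 2 * t) ^ ((r - a) / 2) * Real.exp ((θ / t) ^ 2 * t / 4) ≤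
      (1 + l ^ 2) ^ (r / 2) * Real.exp (l ^ 2 / 4) := by
    have e1 : (1 + (θ / t) ^ 2 * t) ^ ((r - a) / 2) ≤ (1 + l ^ 2) ^ (r / 2) :=
      (Real.rpow_le_rpow_of_exponent_le (by linarith) (by linarith)).trans
        (Real.rpow_le_rpow (by linarith) (by linarith) (by linarith))
    gcongr
  have h13 : ‖expA θ r (heat t u₀)‖ ≤ Real.exp (r ^ 2 / 4) * t ^ (-((r - a) / 2)) *
      ((1 + l ^ 2) ^ (r / 2) * Real.exp (l ^ 2 / 4)) * ‖expA 0 a u₀‖ :=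
    h2.trans (by gcongr)
  refine (add_le_add h13 h4).trans ?_
  set E := Real.exp (r ^ 2 / 4) * ((1 + l ^ 2) ^ (r / 2) * Real.exp (l ^ 2 / 4)) with hE
  have hE0 : 0 ≤ E := by positivity
  have hU := norm_nonneg (expA 0 a u₀)
  have e1 : solC l N r = E * (1 + N * betaC (r / 2)) := rfl
  rw [e1]
  have e2 : 0 ≤ E * (t ^ (-((r - a) / 2)) * ‖expA 0 a u₀‖) * (N * betaC (r / 2)) := by positivity
  have e3 : 0 ≤ E * t ^ (1 / 4 - r / 2) := by positivity
  calc _ = E * (t ^ (-((r - a) / 2)) * ‖expA 0 a u₀‖) +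
        E * t ^ (1 / 4 - r / 2) * (N * betaC (r / 2)) := by rw [hE]; ring
    _ ≤ E * (t ^ (-((r - a) / 2)) * ‖expA 0 a u₀‖) +
        E * t ^ (1 / 4 - r / 2) * (N * betaC (r / 2)) +
        (E * (t ^ (-((r - a) / 2)) * ‖expA 0 a u₀‖) * (N * betaC (r / 2)) +
          E * t ^ (1 / 4 - r / 2)) := le_add_of_nonneg_right (add_nonneg e2 e3)
    _ = _ := by ring

/-- The scale invariant bound, which is uniform in the data. -/
theorem Regular.inDom_half (hP : IsFiberedProjection P) (h : Regular P M u₀ X l N) {r : ℝ}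
    (hr : 1 / 2 ≤ r) (hr2 : r < 2) {t θ : ℝ} (ht : 0 < t) (hθ : 0 ≤ θ)
    (hθl : θ ≤ l * Real.sqrt t) :
    InDom θ r (X t) ∧ ‖expA θ r (X t)‖ ≤ solC l N r * (N + 1) * t ^ (1 / 4 - r / 2) := by
  obtain ⟨h1, h2⟩ := h.inDom hP (by norm_num) hr hr2 h.data ht hθ hθl
  refine ⟨h1, h2.trans ?_⟩
  rw [mul_assoc]
  refine mul_le_mul_of_nonneg_left ?_ (h.solC_nonneg r)
  have h3 := h.data_le
  have h4 : 0 ≤ t ^ (1 / 4 - r / 2) := Real.rpow_nonneg ht.le _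
  rw [show -((r - 1 / 2) / 2) = 1 / 4 - r / 2 by ring, mul_comm, ← add_one_mul]
  gcongr
  exact h3

end

/-! ### Trading exponential weights for powers -/

/-- Raise y/b ≤ exp(y/b) to the power b; at b = 0 the convention 0^0 = 1 keeps the bound true. -/
theorem rpow_le_mul_exp {b y : ℝ} (hb : 0 ≤ b) (hy : 0 ≤ y) : y ^ b ≤ b ^ b * Real.exp y := by
  rcases hb.eq_or_lt with rfl | hb
  · simpa using Real.one_le_exp hy
  · have h1 : y / b ≤ Real.exp (y / b) := by linarith [Real.add_one_le_exp (y / b)]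
    have h2 : (y / b) ^ b ≤ Real.exp y := by
      refine (Real.rpow_le_rpow (by positivity) h1 hb.le).trans (le_of_eq ?_)
      rw [← Real.exp_mul, div_mul_cancel₀ _ hb.ne']
    calc y ^ b = b ^ b * (y / b) ^ b := by
          rw [← Real.mul_rpow hb.le (by positivity), mul_div_cancel₀ _ hb.ne']
      _ ≤ _ := by gcongr

theorem wt_neg_le {b δ : ℝ} (hb : 0 ≤ b) (hδ : 0 < δ) (ξ : Space) :
    |wt (-δ) b ξ| ≤ b ^ b * δ ^ (-b) := by
  have h := rpow_le_mul_exp hb (mul_nonneg hδ.le (symA_nonneg ξ))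
  rw [Real.mul_rpow hδ.le (symA_nonneg ξ)] at h
  have h1 : δ ^ (-b) * δ ^ b = 1 := by rw [← Real.rpow_add hδ]; simp
  have h2 : Real.exp (δ * symA ξ) * Real.exp (-δ * symA ξ) = 1 := by rw [← Real.exp_add]; simp
  have h3 : 0 < δ ^ (-b) := Real.rpow_pos_of_pos hδ _
  rw [abs_of_nonneg (wt_nonneg _ _ _), wt]
  calc symA ξ ^ b * Real.exp (-δ * symA ξ)
      = δ ^ (-b) * (δ ^ b * symA ξ ^ b) * Real.exp (-δ * symA ξ) := by
        rw [← mul_assoc (δ ^ (-b)), h1, one_mul]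
    _ ≤ δ ^ (-b) * (b ^ b * Real.exp (δ * symA ξ)) * Real.exp (-δ * symA ξ) := by gcongr
    _ = b ^ b * δ ^ (-b) * (Real.exp (δ * symA ξ) * Real.exp (-δ * symA ξ)) := by ring
    _ = _ := by rw [h2, mul_one]

/-- A surplus δ in the exponential weight pays for any number of derivatives. There is no upper
limit on r here, unlike in the Duhamel estimate. -/
theorem InDom.gap {θ δ a r : ℝ} {T : VecDist} (h : InDom (θ + δ) a T) (ha : 0 ≤ a) (har : a ≤ r)
    (hδ : 0 < δ) : InDom θ r T ∧ ‖expA θ r T‖ ≤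
      (r - a) ^ (r - a) * δ ^ (-(r - a)) * ‖expA (θ + δ) a T‖ := by
  have hb : 0 ≤ r - a := sub_nonneg.2 har
  have hm : IsMul (wt (-δ) (r - a)) := ⟨measurable_wt _ _, _, wt_neg_le hb hδ⟩
  have h1 : (fun ξ => wt (-δ) (r - a) ξ • wt (θ + δ) a ξ • hat T ξ) =
      fun ξ => wt θ r ξ • hat T ξ := by
    funext ξ
    rw [smul_smul, wt_mul_wt _ _ hb ha, sub_add_cancel, add_comm θ, neg_add_cancel_left]
  have h2 : InDom θ r T := by
    refine ⟨h.1, ?_⟩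
    have := hm.memLp h.2
    rw [weightedHat_eq] at this ⊢
    rwa [h1] at this
  refine ⟨h2, ?_⟩
  have h3 : hatW θ r T = mulCLM (wt (-δ) (r - a)) (hatW (θ + δ) a T) := by
    rw [mulCLM_apply hm, hatW, ← h1]
    refine classL2_congr ?_
    filter_upwards [h.coeFn_hatW] with ξ hξ
    rw [hξ]
  rw [norm_expA_eq, norm_expA_eq, h3]
  exact norm_mulCLM_apply_le hm.1 (wt_neg_le hb hδ) _

end NavierStokes

/-! ### Differentiation in time at bounded frequency. -/

namespace NavierStokes

variable {P : Space → Matrix (Fin 3) (Fin 3) ℂ} {M : Matrix (Fin 3) (Fin 3) ℝ}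

/-! ### Multipliers cut off in frequency -/

theorem isLocMul_of_continuous {f : ℝ → ℝ} (hf : Continuous f) : IsLocMul (fun ξ => f (symA ξ)) := by
  refine ⟨hf.measurable.comp measurable_symA, fun n => ?_⟩
  obtain ⟨C, hC⟩ := (isCompact_Icc (a := (0 : ℝ)) (b := n)).exists_bound_of_continuousOn
    hf.continuousOn
  exact ⟨C, fun ξ hξ => hC _ ⟨symA_nonneg ξ, hξ⟩⟩

theorem IsLocMul.mul {m k : Space → ℝ} (hm : IsLocMul m) (hk : IsLocMul k) :
    IsLocMul (fun ξ => m ξ * k ξ) := by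
  refine ⟨hm.1.mul hk.1, fun n => ?_⟩
  obtain ⟨C, hC⟩ := hm.2 n
  obtain ⟨D, hD⟩ := hk.2 n
  refine ⟨C * D, fun ξ hξ => ?_⟩
  rw [abs_mul]
  exact mul_le_mul (hC ξ hξ) (hD ξ hξ) (abs_nonneg _) ((abs_nonneg _).trans (hC ξ hξ))

theorem isLocMul_hk (τ : ℝ) : IsLocMul (hk τ) :=
  isLocMul_of_continuous (f := fun x => Real.exp (-τ * x ^ 2)) (by fun_prop)

theorem chi_mul_chi (n : ℕ) (ξ : Space) : chi n ξ * chi n ξ = chi n ξ := by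
  rcases chi_eq_or n ξ with h | h <;> simp [h.2]

theorem exists_bound_chi {f : ℝ → ℝ → ℝ} {K : Set ℝ} (hK : IsCompact K)
    (hf : ContinuousOn (fun p : ℝ × ℝ => f p.1 p.2) (K ×ˢ Set.univ)) (n : ℕ) :
    ∃ C : ℝ, ∀ s ∈ K, ∀ ξ, |chi n ξ * f s (symA ξ)| ≤ C := by
  obtain ⟨C, hC⟩ := (hK.prod (isCompact_Icc (a := (0 : ℝ)) (b := n))).exists_bound_of_continuousOn
    (hf.mono (Set.prod_mono_right (Set.subset_univ _)))
  refine ⟨|C|, fun s hs ξ => ?_⟩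
  rcases chi_eq_or n ξ with h | h
  · rw [h.2, one_mul]
    exact (hC (s, symA ξ) ⟨hs, symA_nonneg ξ, h.1⟩).trans (le_abs_self C)
  · rw [h.2, zero_mul, abs_zero]
    exact abs_nonneg C

theorem mulCLM_chi_chi {m : Space → ℝ} (hm : IsLocMul m) (n : ℕ) (f : VecL2) :
    mulCLM (fun ξ => chi n ξ * m ξ) (mulCLM (chi n) f) = mulCLM (fun ξ => chi n ξ * m ξ) f := by
  rw [mulCLM_mulCLM (hm.isMul n) (isMul_chi n)]
  congr 2
  funext ξ
  linear_combination m ξ * chi_mul_chi n ξ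

theorem mulCLM_chi_mul_chi {m k : Space → ℝ} (hm : IsLocMul m) (hk : IsLocMul k) (n : ℕ)
    (f : VecL2) : mulCLM (fun ξ => chi n ξ * m ξ) (mulCLM (fun ξ => chi n ξ * k ξ) f) =
      mulCLM (fun ξ => chi n ξ * (m ξ * k ξ)) f := by
  rw [mulCLM_mulCLM (hm.isMul n) (hk.isMul n)]
  congr 2
  funext ξ
  linear_combination m ξ * k ξ * chi_mul_chi n ξ

/-- One spare power of the frequency gives the rate 1/n for the tail. The rate makes the later limit
n → ∞ uniform in time. -/
theorem norm_sub_mulCLM_chi_le {m : Space → ℝ} (hm : IsMul m) {B : ℝ}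
    (hB : ∀ ξ, symA ξ * |m ξ| ≤ B) (f : VecL2) {n : ℕ} (hn : 0 < n) :
    ‖mulCLM m f - mulCLM (chi n) (mulCLM m f)‖ ≤ B / n * ‖f‖ := by
  have h1 : mulCLM m f - mulCLM (chi n) (mulCLM m f) =
      mulCLM (fun ξ => (1 - chi n ξ) * m ξ) f := by
    have hs : IsMul (fun ξ => (1 - chi n ξ) * m ξ) := by
      refine IsMul.mul ⟨measurable_const.sub (measurable_chi n), 1, fun ξ => ?_⟩ hm
      rcases chi_eq_or n ξ with h | h <;> simp [h.2]
    refine Lp.ext ?_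
    filter_upwards [Lp.coeFn_sub (mulCLM m f) (mulCLM (chi n) (mulCLM m f)), coeFn_mulCLM hm f,
      coeFn_mulCLM (isMul_chi n) (mulCLM m f), coeFn_mulCLM hs f] with ξ e1 e2 e3 e4
    rw [e1, Pi.sub_apply, e3, e2, e4, smul_smul, ← sub_smul]
    congr 1
    ring
  have hn' : (0 : ℝ) < n := Nat.cast_pos.2 hn
  rw [h1]
  refine norm_mulCLM_apply_le ((measurable_const.sub (measurable_chi n)).mul hm.1) (fun ξ => ?_) f
  change |(1 - chi n ξ) * m ξ| ≤ B / n
  rw [le_div_iff₀ hn', abs_mul]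
  rcases chi_eq_or n ξ with h | h
  · rw [h.2, sub_self, abs_zero, zero_mul, zero_mul]
    exact (mul_nonneg (symA_nonneg ξ) (abs_nonneg _)).trans (hB ξ)
  · rw [h.2, sub_zero, abs_one, one_mul]
    refine le_trans ?_ (hB ξ)
    rw [mul_comm]
    exact mul_le_mul_of_nonneg_right h.1.le (abs_nonneg _)

/-! ### Time derivatives at bounded frequency -/

/-- The Duhamel integral at frequencies at most `n`, with the heat factor `exp(-tA²)` removed. -/
def growth (n : ℕ) (F : ℝ → VecL2) (t : ℝ) : VecL2 :=
  ∫ s in (0 : ℝ)..t, mulCLM (fun ξ => chi n ξ * hk (-s) ξ) (F s)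

section

variable {F : ℝ → VecL2} {N : ℝ}

theorem continuousOn_growth_integrand (n : ℕ) (hF : ContinuousOn F (Set.Ioi 0)) :
    ContinuousOn (fun s => mulCLM (fun ξ => chi n ξ * hk (-s) ξ) (F s)) (Set.Ioi 0) := by
  intro s hs
  have hs0 : (0 : ℝ) < s := hs
  obtain ⟨C, hC⟩ := exists_bound_chi (f := fun s x => Real.exp (s * x ^ 2))
    (isCompact_Icc (a := (0 : ℝ)) (b := 2 * s)) (by fun_prop) n
  have hb (x : ℝ) (hx : x ∈ Set.Icc 0 (2 * s)) (ξ : Space) : |chi n ξ * hk (-x) ξ| ≤ C := by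
    have := hC x hx ξ
    rwa [hk, neg_neg]
  refine ContinuousAt.continuousWithinAt ?_
  refine tendsto_mulCLM (C := C)
    (Eventually.of_forall fun x => (measurable_chi n).mul (measurable_hk _))
    ((measurable_chi n).mul (measurable_hk _)) ?_ (hb s ⟨hs0.le, by linarith⟩) (fun ξ => ?_)
    (hF.continuousAt (Ioi_mem_nhds hs0))
  · filter_upwards [Icc_mem_nhds hs0 (show s < 2 * s by linarith)] with x hx using hb x hx
  · have : Continuous fun x : ℝ => chi n ξ * hk (-x) ξ := by unfold hk; fun_prop
    exact this.continuousAt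

theorem intervalIntegrable_growth (n : ℕ) (hF : ContinuousOn F (Set.Ioi 0)) {t : ℝ} (ht : 0 < t)
    (hb : ∀ s, 0 < s → ‖F s‖ ≤ N * s ^ (-(3 / 4) : ℝ)) :
    IntervalIntegrable (fun s => mulCLM (fun ξ => chi n ξ * hk (-s) ξ) (F s)) volume 0 t := by
  obtain ⟨C, hC⟩ := exists_bound_chi (f := fun s x => Real.exp (s * x ^ 2))
    (isCompact_Icc (a := (0 : ℝ)) (b := t)) (by fun_prop) n
  refine intervalIntegrable_of_bound ht.le ((continuousOn_growth_integrand n hF).mono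
    fun s hs => hs.1) (K := C * N) fun s hs => ?_
  have h1 : ∀ ξ, |chi n ξ * hk (-s) ξ| ≤ C := fun ξ => by
    have := hC s ⟨hs.1.le, hs.2.le⟩ ξ
    rwa [hk, neg_neg]
  refine (norm_mulCLM_apply_le ((measurable_chi n).mul (measurable_hk _)) h1 _).trans ?_
  rw [mul_assoc]
  exact mul_le_mul_of_nonneg_left (hb s hs.1) ((abs_nonneg _).trans (h1 0))

/-- Factoring exp(-tA²) out of the Duhamel integral leaves an integrand independent of t, so the
fundamental theorem of calculus applies. The remaining exp(sA²) is bounded only thanks to the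
cut-off. -/
theorem hasDerivAt_growth (n : ℕ) (hF : ContinuousOn F (Set.Ioi 0)) {t : ℝ} (ht : 0 < t)
    (hb : ∀ s, 0 < s → ‖F s‖ ≤ N * s ^ (-(3 / 4) : ℝ)) :
    HasDerivAt (growth n F) (mulCLM (fun ξ => chi n ξ * hk (-t) ξ) (F t)) t :=
  intervalIntegral.integral_hasDerivAt_right (intervalIntegrable_growth n hF ht hb)
    ((continuousOn_growth_integrand n hF).stronglyMeasurableAtFilter isOpen_Ioi t ht)
    ((continuousOn_growth_integrand n hF).continuousAt (Ioi_mem_nhds ht))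

theorem mulCLM_chi_duh (n : ℕ) (hF : ContinuousOn F (Set.Ioi 0)) {t : ℝ} (ht : 0 < t)
    (hb : ∀ s, 0 < s → ‖F s‖ ≤ N * s ^ (-(3 / 4) : ℝ)) :
    mulCLM (chi n) (duh F t) = mulCLM (fun ξ => chi n ξ * hk t ξ) (growth n F t) := by
  rw [duh, growth, ← ContinuousLinearMap.intervalIntegral_comp_comm _
    (intervalIntegrable_growth n hF ht hb), ← ContinuousLinearMap.intervalIntegral_comp_comm _
    (intervalIntegrable_duh ht.le (hF.mono fun s hs => hs.1) fun s hs => hb s hs.1)]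
  refine intervalIntegral.integral_congr_ae (ae_of_all _ fun s hs => ?_)
  rw [Set.uIoc_of_le ht.le] at hs
  rw [mulCLM_chi_mul_chi (isLocMul_hk t) (isLocMul_hk (-s)),
    mulCLM_mulCLM (isMul_chi n) (isMul_hk (sub_nonneg.2 hs.2))]
  congr 2
  funext ξ
  rw [hk, hk, hk, ← Real.exp_add]
  congr 2
  ring

end

/-- The logarithmic time derivative of `exp(l √t x - t x²)` at `x = symA ξ`. -/
def gen (l t : ℝ) (ξ : Space) : ℝ := l / (2 * Real.sqrt t) * symA ξ - symA ξ ^ 2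

theorem isLocMul_gen (l t : ℝ) : IsLocMul (gen l t) :=
  isLocMul_of_continuous (f := fun x => l / (2 * Real.sqrt t) * x - x ^ 2) (by fun_prop)

theorem hasDerivAt_wt_mul_hk (l r : ℝ) {t : ℝ} (ht : 0 < t) (ξ : Space) :
    HasDerivAt (fun s => wt (l * Real.sqrt s) r ξ * hk s ξ)
      (gen l t ξ * (wt (l * Real.sqrt t) r ξ * hk t ξ)) t := by
  have h1 : HasDerivAt (fun s => symA ξ ^ r * Real.exp (l * Real.sqrt s * symA ξ))
      (symA ξ ^ r * (Real.exp (l * Real.sqrt t * symA ξ) *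
        (l * (1 / (2 * Real.sqrt t)) * symA ξ))) t :=
    ((((Real.hasDerivAt_sqrt ht.ne').const_mul l).mul_const (symA ξ)).exp).const_mul _
  have h2 : HasDerivAt (fun s => Real.exp (-s * symA ξ ^ 2))
      (Real.exp (-t * symA ξ ^ 2) * (-1 * symA ξ ^ 2)) t :=
    ((hasDerivAt_neg t).mul_const (symA ξ ^ 2)).exp
  refine (h1.mul h2).congr_deriv ?_
  simp only [wt, hk, gen]
  ring

theorem hasDerivAt_mulCLM_wt_mul_hk (n : ℕ) (l : ℝ) {r t : ℝ} (hr : 0 ≤ r) (ht : 0 < t)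
    {V : ℝ → VecL2} {V' : VecL2} (hV : HasDerivAt V V' t) :
    HasDerivAt
      (fun s => mulCLM (fun ξ => chi n ξ * (wt (l * Real.sqrt s) r ξ * hk s ξ)) (V s))
      (mulCLM (fun ξ => chi n ξ * (gen l t ξ * (wt (l * Real.sqrt t) r ξ * hk t ξ))) (V t) +
        mulCLM (fun ξ => chi n ξ * (wt (l * Real.sqrt t) r ξ * hk t ξ)) V') t := by
  have hc : Continuous fun p : ℝ × ℝ =>
      p.2 ^ r * Real.exp (l * Real.sqrt p.1 * p.2) * Real.exp (-p.1 * p.2 ^ 2) := by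
    refine Continuous.mul (Continuous.mul ?_ (by fun_prop)) (by fun_prop)
    exact continuous_snd.rpow_const fun _ => Or.inr hr
  -- The times stay away from 0, where the factor 1/√s in `gen` is singular.
  have hK : IsCompact (Set.Icc (t / 2) (2 * t)) := isCompact_Icc
  have hmem : ∀ᶠ s in 𝓝 t, s ∈ Set.Icc (t / 2) (2 * t) :=
    Icc_mem_nhds (by linarith) (by linarith)
  obtain ⟨C, hC⟩ := exists_bound_chi hK
    (f := fun s x => x ^ r * Real.exp (l * Real.sqrt s * x) * Real.exp (-s * x ^ 2))
    hc.continuousOn n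
  obtain ⟨D, hD⟩ := exists_bound_chi hK
    (f := fun s x => (l / (2 * Real.sqrt s) * x - x ^ 2) *
      (x ^ r * Real.exp (l * Real.sqrt s * x) * Real.exp (-s * x ^ 2)))
    (by
      refine ContinuousOn.mul ?_ hc.continuousOn
      refine ContinuousOn.sub (ContinuousOn.mul ?_ (by fun_prop)) (by fun_prop)
      refine ContinuousOn.div continuousOn_const (by fun_prop) fun p hp => ?_
      have : 0 < p.1 := lt_of_lt_of_le (half_pos ht) hp.1.1
      exact (mul_pos two_pos (Real.sqrt_pos.2 this)).ne') n
  refine hasDerivAt_mulCLM (C := max C D)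
    (m := fun s ξ => chi n ξ * (wt (l * Real.sqrt s) r ξ * hk s ξ))
    (m' := fun s ξ => chi n ξ * (gen l s ξ * (wt (l * Real.sqrt s) r ξ * hk s ξ)))
    (fun s => (measurable_chi n).mul ((measurable_wt _ _).mul (measurable_hk _)))
    (fun s => (measurable_chi n).mul
      ((isLocMul_gen l s).1.mul ((measurable_wt _ _).mul (measurable_hk _)))) ?_ ?_ ?_ hV
  · filter_upwards [hmem] with s hs ξ using (hC s hs ξ).trans (le_max_left _ _)
  · filter_upwards [hmem] with s hs ξ using (hD s hs ξ).trans (le_max_right _ _)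
  · filter_upwards [lt_mem_nhds ht] with s hs ξ using (hasDerivAt_wt_mul_hk l r hs ξ).const_mul _

/-! ### The time derivative of the weighted solution -/

section

variable {u₀ : VecDist} {X : ℝ → VecDist} {l N : ℝ}

theorem Regular.norm_forc_le (h : Regular P M u₀ X l N) {s : ℝ} (hs : 0 < s) :
    ‖forc P M (X s) (X s)‖ ≤ N * s ^ (-(3 / 4) : ℝ) :=
  norm_le_of_wt le_rfl (mul_nonneg h.N_nonneg (Real.rpow_nonneg hs.le _))
    (h.forc_le s hs 0 le_rfl (mul_nonneg h.l_nonneg (Real.sqrt_nonneg s)))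

theorem Regular.mulCLM_chi_hatW (hP : IsFiberedProjection P) (h : Regular P M u₀ X l N)
    {r k t : ℝ} (hr : 0 ≤ r) (hu : InDom 0 r u₀) (ht : 0 < t)
    (hX : InDom (k * Real.sqrt t) r (X t)) (n : ℕ) :
    mulCLM (chi n) (hatW (k * Real.sqrt t) r (X t)) =
      mulCLM (fun ξ => chi n ξ * (wt (k * Real.sqrt t) 0 ξ * hk t ξ)) (hatW 0 r u₀) -
      mulCLM (fun ξ => chi n ξ * (wt (k * Real.sqrt t) r ξ * hk t ξ))
        (growth n (fun s => forc P M (X s) (X s)) t) := by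
  have hF := mulCLM_chi_duh n h.cont ht fun s hs => h.norm_forc_le hs
  have hw := isLocMul_wt (k * Real.sqrt t) hr
  have hw0 := (isLocMul_wt (k * Real.sqrt t) le_rfl).mul (isLocMul_hk t)
  rw [← mulCLM_chi_mul_chi hw (isLocMul_hk t), ← hF, mulCLM_chi_chi hw]
  set f := duh (fun s => forc P M (X s) (X s)) t
  refine Lp.ext ?_
  filter_upwards [coeFn_mulCLM (isMul_chi n) (hatW (k * Real.sqrt t) r (X t)), hX.coeFn_hatW,
    h.hat_eq hP ht, Lp.coeFn_sub
      (mulCLM (fun ξ => chi n ξ * (wt (k * Real.sqrt t) 0 ξ * hk t ξ)) (hatW 0 r u₀))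
      (mulCLM (fun ξ => chi n ξ * wt (k * Real.sqrt t) r ξ) f), coeFn_mulCLM (hw0.isMul n)
      (hatW 0 r u₀), coeFn_mulCLM (hw.isMul n) f, hu.coeFn_hatW] with ξ e1 e2 e3 e4 e5 e6 e7
  rw [e1, e2, e3, e4, Pi.sub_apply, e5, e6, e7, smul_sub, smul_sub, smul_smul, smul_smul, smul_smul,
    smul_smul]
  congr 2
  have := wt_mul_wt (k * Real.sqrt t) 0 le_rfl hr ξ
  rw [add_zero, zero_add] at this
  rw [← this]
  ring

/-- The time derivative of `A^r exp(k √t A) X(t)`, in Fourier space. -/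
def flux (P : Space → Matrix (Fin 3) (Fin 3) ℂ) (M : Matrix (Fin 3) (Fin 3) ℝ) (X : ℝ → VecDist)
    (k r t : ℝ) : VecL2 :=
  classL2 (fun ξ => gen k t ξ • hatW (k * Real.sqrt t) r (X t) ξ) -
    classL2 (fun ξ => wt (k * Real.sqrt t) r ξ • forc P M (X t) (X t) ξ)

/-- The generator costs one and two powers of A, and the rate 1/n costs one more; hence the
constants with exponents 2 and 3. All are paid for by the surplus δ. -/
theorem memLp_gen_wt {T : VecDist} {k θ δ r t : ℝ} (hδ : 0 < δ) (hk : 0 ≤ k) (hr : 0 ≤ r)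
    (h : InDom (θ + δ) r T) : MemLp (fun ξ => gen k t ξ • hatW θ r T ξ) 2 volume ∧
    ∀ n : ℕ, 0 < n → ‖classL2 (fun ξ => gen k t ξ • hatW θ r T ξ) -
      mulCLM (chi n) (classL2 (fun ξ => gen k t ξ • hatW θ r T ξ))‖ ≤
      (k / (2 * Real.sqrt t) * ((2 : ℝ) ^ (2 : ℝ) * δ ^ (-2 : ℝ)) +
        (3 : ℝ) ^ (3 : ℝ) * δ ^ (-3 : ℝ)) / n * ‖expA (θ + δ) r T‖ := by
  have hx (ξ : Space) : |gen k t ξ| ≤ k / (2 * Real.sqrt t) * symA ξ + symA ξ ^ 2 := by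
    have h0 := symA_nonneg ξ
    have h1 : 0 ≤ k / (2 * Real.sqrt t) * symA ξ := by positivity
    rw [gen, abs_le]
    constructor <;> nlinarith [sq_nonneg (symA ξ)]
  have hc : 0 ≤ k / (2 * Real.sqrt t) := by positivity
  have hpow (ξ : Space) (j : ℕ) : symA ξ ^ j * wt (-δ) 0 ξ = wt (-δ) j ξ := by
    simp only [wt, Real.rpow_zero, one_mul, Real.rpow_natCast]
  have hb (ξ : Space) (j : ℕ) : wt (-δ) j ξ ≤ (j : ℝ) ^ (j : ℝ) * δ ^ (-(j : ℝ)) :=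
    (le_abs_self _).trans (wt_neg_le (Nat.cast_nonneg j) hδ ξ)
  have hm : IsMul (fun ξ => gen k t ξ * wt (-δ) 0 ξ) := by
    refine ⟨(isLocMul_gen k t).1.mul (measurable_wt _ _), k / (2 * Real.sqrt t) *
      (((1 : ℕ) : ℝ) ^ ((1 : ℕ) : ℝ) * δ ^ (-((1 : ℕ) : ℝ))) +
      ((2 : ℕ) : ℝ) ^ ((2 : ℕ) : ℝ) * δ ^ (-((2 : ℕ) : ℝ)), fun ξ => ?_⟩
    rw [abs_mul, abs_of_nonneg (wt_nonneg (-δ) 0 ξ)]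
    refine (mul_le_mul_of_nonneg_right (hx ξ) (wt_nonneg _ _ _)).trans ?_
    rw [add_mul, hpow ξ 2, mul_assoc]
    have e : symA ξ * wt (-δ) 0 ξ = wt (-δ) (1 : ℕ) ξ := by rw [← hpow ξ 1, pow_one]
    rw [e]
    exact add_le_add (mul_le_mul_of_nonneg_left (hb ξ 1) hc) (hb ξ 2)
  have hB (ξ : Space) : symA ξ * |gen k t ξ * wt (-δ) 0 ξ| ≤
      k / (2 * Real.sqrt t) * ((2 : ℝ) ^ (2 : ℝ) * δ ^ (-2 : ℝ)) +
        (3 : ℝ) ^ (3 : ℝ) * δ ^ (-3 : ℝ) := by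
    rw [abs_mul, abs_of_nonneg (wt_nonneg (-δ) 0 ξ)]
    refine (mul_le_mul_of_nonneg_left (mul_le_mul_of_nonneg_right (hx ξ) (wt_nonneg _ _ _))
      (symA_nonneg ξ)).trans ?_
    have e : symA ξ * ((k / (2 * Real.sqrt t) * symA ξ + symA ξ ^ 2) * wt (-δ) 0 ξ) =
        k / (2 * Real.sqrt t) * wt (-δ) (2 : ℕ) ξ + wt (-δ) (3 : ℕ) ξ := by
      rw [← hpow ξ 2, ← hpow ξ 3]; ring
    rw [e]
    exact add_le_add (mul_le_mul_of_nonneg_left (by exact_mod_cast hb ξ 2) hc)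
      (by exact_mod_cast hb ξ 3)
  have hae : (fun ξ => gen k t ξ • hatW θ r T ξ) =ᵐ[volume]
      fun ξ => (gen k t ξ * wt (-δ) 0 ξ) • hatW (θ + δ) r T ξ := by
    have h1 := h.of_le hr (θ' := θ) (by linarith)
    filter_upwards [h.coeFn_hatW, h1.1.coeFn_hatW] with ξ e1 e2
    rw [e1, e2, smul_smul, smul_smul, mul_assoc, wt_mul_wt _ _ le_rfl hr, zero_add,
      add_comm θ, neg_add_cancel_left]
  refine ⟨(memLp_congr_ae hae).2 (hm.memLp (Lp.memLp _)), fun n hn => ?_⟩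
  rw [classL2_congr hae, ← mulCLM_apply hm, norm_expA_eq]
  exact norm_sub_mulCLM_chi_le hm hB _ hn

theorem memLp_wt_of_gap {f : VecL2} {θ δ r b : ℝ} (hδ : 0 < δ) (hr : 0 ≤ r) (hb : 0 ≤ b)
    (h : eLpNorm (fun ξ => wt (θ + δ) 0 ξ • f ξ) 2 volume ≤ ENNReal.ofReal b) :
    MemLp (fun ξ => wt θ r ξ • f ξ) 2 volume ∧
    ∀ n : ℕ, 0 < n → ‖classL2 (fun ξ => wt θ r ξ • f ξ) -
      mulCLM (chi n) (classL2 (fun ξ => wt θ r ξ • f ξ))‖ ≤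
      (r + 1) ^ (r + 1) * δ ^ (-(r + 1)) / n * b := by
  have hM : MemLp (fun ξ => wt (θ + δ) 0 ξ • f ξ) 2 volume :=
    ⟨(measurable_wt _ _).aestronglyMeasurable.smul (Lp.aestronglyMeasurable _),
      h.trans_lt ENNReal.ofReal_lt_top⟩
  have hm : IsMul (wt (-δ) r) := ⟨measurable_wt _ _, _, wt_neg_le hr hδ⟩
  have hae : (fun ξ => wt θ r ξ • f ξ) =ᵐ[volume]
      fun ξ => wt (-δ) r ξ • classL2 (fun ξ => wt (θ + δ) 0 ξ • f ξ) ξ := by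
    filter_upwards [coeFn_classL2 hM] with ξ e1
    rw [e1, smul_smul, wt_mul_wt _ _ hr le_rfl, add_zero, add_comm θ, neg_add_cancel_left]
  refine ⟨(memLp_congr_ae hae).2 (hm.memLp (Lp.memLp _)), fun n hn => ?_⟩
  rw [classL2_congr hae, ← mulCLM_apply hm]
  refine (norm_sub_mulCLM_chi_le hm (B := (r + 1) ^ (r + 1) * δ ^ (-(r + 1))) (fun ξ => ?_) _
    hn).trans ?_
  · have h1 := wt_neg_le (show 0 ≤ r + 1 by linarith) hδ ξ
    refine le_trans (le_of_eq ?_) h1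
    rw [abs_of_nonneg (wt_nonneg _ _ _), abs_of_nonneg (wt_nonneg _ _ _), wt, wt,
      Real.rpow_add_of_nonneg (symA_nonneg ξ) hr zero_le_one, Real.rpow_one]
    ring
  · have h0 : 0 ≤ δ ^ (-(r + 1)) := Real.rpow_nonneg hδ.le _
    refine mul_le_mul_of_nonneg_left ?_ (by positivity)
    rw [norm_classL2 hM]
    exact ENNReal.toReal_le_of_le_ofReal hb h

end

end NavierStokes

/-! ### Differentiability of the weighted solution, and the elementary inequality. -/

namespace NavierStokes

variable {P : Space → Matrix (Fin 3) (Fin 3) ℂ} {M : Matrix (Fin 3) (Fin 3) ℝ}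
  {u₀ : VecDist} {X : ℝ → VecDist} {l N : ℝ}

theorem Regular.memLp_flux (hP : IsFiberedProjection P) (h : Regular P M u₀ X l N) {r k t : ℝ}
    (hr : 0 ≤ r) (hr2 : r < 2) (hu : InDom 0 r u₀) (hk : 0 ≤ k) (hkl : k < l) (ht : 0 < t) :
    MemLp (fun ξ => gen k t ξ • hatW (k * Real.sqrt t) r (X t) ξ) 2 volume ∧
    MemLp (fun ξ => wt (k * Real.sqrt t) r ξ • forc P M (X t) (X t) ξ) 2 volume ∧
    ∀ n : ℕ, 0 < n → ‖flux P M X k r t - mulCLM (chi n) (flux P M X k r t)‖ ≤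
      ((k / (2 * Real.sqrt t) * ((2 : ℝ) ^ (2 : ℝ) * ((l - k) * Real.sqrt t) ^ (-2 : ℝ)) +
        (3 : ℝ) ^ (3 : ℝ) * ((l - k) * Real.sqrt t) ^ (-3 : ℝ)) *
        (solC l N r * (‖expA 0 r u₀‖ + t ^ (1 / 4 - r / 2))) +
      (r + 1) ^ (r + 1) * ((l - k) * Real.sqrt t) ^ (-(r + 1)) * (N * t ^ (-(3 / 4) : ℝ))) / n := by
  have hst := Real.sqrt_pos.2 ht
  have hδ : 0 < (l - k) * Real.sqrt t := mul_pos (sub_pos.2 hkl) hst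
  have e : k * Real.sqrt t + (l - k) * Real.sqrt t = l * Real.sqrt t := by ring
  have hl : 0 ≤ l * Real.sqrt t := mul_nonneg h.l_nonneg hst.le
  obtain ⟨h1, h2⟩ := h.inDom hP hr le_rfl hr2 hu ht hl le_rfl
  rw [sub_self, zero_div, neg_zero, Real.rpow_zero, one_mul] at h2
  rw [← e] at h1
  obtain ⟨h3, h4⟩ := memLp_gen_wt (t := t) hδ hk hr h1
  have h5 := h.forc_le t ht _ hl le_rfl
  rw [← e] at h5
  obtain ⟨h6, h7⟩ := memLp_wt_of_gap hδ hr
    (mul_nonneg h.N_nonneg (Real.rpow_nonneg ht.le _)) h5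
  refine ⟨h3, h6, fun n hn => ?_⟩
  have hn' : (0 : ℝ) < n := Nat.cast_pos.2 hn
  rw [flux, map_sub, sub_sub_sub_comm, add_div]
  refine (norm_sub_le _ _).trans (add_le_add ((h4 n hn).trans ?_) ((h7 n hn).trans (le_of_eq ?_)))
  · rw [e, div_mul_eq_mul_div]
    refine div_le_div_of_nonneg_right (mul_le_mul_of_nonneg_left h2 ?_) hn'.le
    have a1 : 0 ≤ ((l - k) * Real.sqrt t) ^ (-2 : ℝ) := Real.rpow_nonneg hδ.le _
    have a2 : 0 ≤ ((l - k) * Real.sqrt t) ^ (-3 : ℝ) := Real.rpow_nonneg hδ.le _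
    positivity
  · rw [div_mul_eq_mul_div]

theorem Regular.mulCLM_chi_flux (hP : IsFiberedProjection P) (h : Regular P M u₀ X l N)
    {r k t : ℝ} (hr : 0 ≤ r) (hu : InDom 0 r u₀) (ht : 0 < t)
    (hX : InDom (k * Real.sqrt t) r (X t))
    (h1 : MemLp (fun ξ => gen k t ξ • hatW (k * Real.sqrt t) r (X t) ξ) 2 volume)
    (h2 : MemLp (fun ξ => wt (k * Real.sqrt t) r ξ • forc P M (X t) (X t) ξ) 2 volume) (n : ℕ) :
    mulCLM (chi n) (flux P M X k r t) =
      mulCLM (fun ξ => chi n ξ * (gen k t ξ * (wt (k * Real.sqrt t) 0 ξ * hk t ξ)))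
        (hatW 0 r u₀) -
      (mulCLM (fun ξ => chi n ξ * (gen k t ξ * (wt (k * Real.sqrt t) r ξ * hk t ξ)))
        (growth n (fun s => forc P M (X s) (X s)) t) +
      mulCLM (fun ξ => chi n ξ * (wt (k * Real.sqrt t) r ξ * hk t ξ))
        (mulCLM (fun ξ => chi n ξ * hk (-t) ξ) (forc P M (X t) (X t)))) := by
  have hgen := isLocMul_gen k t
  have hw := isLocMul_wt (k * Real.sqrt t) hr
  have hw0 := isLocMul_wt (k * Real.sqrt t) (le_refl 0)
  have hh := isLocMul_hk t
  -- The heat factor in front of the Duhamel term cancels the growing factor in the derivative of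
  -- `growth`.
  have e : (fun ξ => chi n ξ * (wt (k * Real.sqrt t) r ξ * hk t ξ * hk (-t) ξ)) =
      fun ξ => chi n ξ * wt (k * Real.sqrt t) r ξ := by
    funext ξ
    have : hk t ξ * hk (-t) ξ = 1 := by
      rw [hk, hk, ← Real.exp_add]
      simp
    rw [mul_assoc (wt _ _ _), this, mul_one]
  have hA : mulCLM (chi n) (classL2 (fun ξ => gen k t ξ • hatW (k * Real.sqrt t) r (X t) ξ)) =
      mulCLM (fun ξ => chi n ξ * (gen k t ξ * (wt (k * Real.sqrt t) 0 ξ * hk t ξ)))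
        (hatW 0 r u₀) -
      mulCLM (fun ξ => chi n ξ * (gen k t ξ * (wt (k * Real.sqrt t) r ξ * hk t ξ)))
        (growth n (fun s => forc P M (X s) (X s)) t) := by
    refine (mulCLM_chi_mul hgen h1 n).trans ?_
    refine (mulCLM_chi_chi hgen n _).symm.trans ?_
    refine (congrArg _ (h.mulCLM_chi_hatW hP hr hu ht hX n)).trans ?_
    refine (map_sub _ _ _).trans ?_
    exact congrArg₂ _ (mulCLM_chi_mul_chi hgen (hw0.mul hh) n _)
      (mulCLM_chi_mul_chi hgen (hw.mul hh) n _)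
  have hB : mulCLM (chi n)
      (classL2 (fun ξ => wt (k * Real.sqrt t) r ξ • forc P M (X t) (X t) ξ)) =
      mulCLM (fun ξ => chi n ξ * (wt (k * Real.sqrt t) r ξ * hk t ξ))
        (mulCLM (fun ξ => chi n ξ * hk (-t) ξ) (forc P M (X t) (X t))) := by
    refine (mulCLM_chi_mul hw h2 n).trans ?_
    refine Eq.trans ?_ (mulCLM_chi_mul_chi (hw.mul hh) (isLocMul_hk (-t)) n _).symm
    rw [e]
  rw [← sub_sub, ← hA, ← hB, ← map_sub]
  rfl

theorem Regular.hasDerivAt_chi (hP : IsFiberedProjection P) (h : Regular P M u₀ X l N) {r k t : ℝ}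
    (hr : 0 ≤ r) (hr2 : r < 2) (hu : InDom 0 r u₀) (hk : 0 ≤ k) (hkl : k < l) (ht : 0 < t)
    (n : ℕ) : HasDerivAt (fun s => mulCLM (chi n) (hatW (k * Real.sqrt s) r (X s)))
      (mulCLM (chi n) (flux P M X k r t)) t := by
  have hX (s : ℝ) (hs : 0 < s) : InDom (k * Real.sqrt s) r (X s) :=
    (h.inDom hP hr le_rfl hr2 hu hs (by positivity)
      (mul_le_mul_of_nonneg_right hkl.le (Real.sqrt_nonneg s))).1
  have hg := hasDerivAt_growth n h.cont ht fun s hs => h.norm_forc_le hs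
  have hd1 := hasDerivAt_mulCLM_wt_mul_hk n k (le_refl 0) ht
    (hasDerivAt_const t (hatW 0 r u₀))
  rw [map_zero, add_zero] at hd1
  have hd2 := hasDerivAt_mulCLM_wt_mul_hk n k hr ht hg
  have hev := (lt_mem_nhds ht).mono fun s hs => h.mulCLM_chi_hatW hP hr hu hs (hX s hs) n
  obtain ⟨h1, h2, -⟩ := h.memLp_flux hP hr hr2 hu hk hkl ht
  rw [h.mulCLM_chi_flux hP hr hu ht (hX t ht) h1 h2 n]
  exact (hd1.fun_sub hd2).congr_of_eventuallyEq hev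

/-- The truncated functions are differentiable and their derivatives converge to `flux` at the rate
B/n, uniformly for times near t, so the limit is differentiable. The strict inequality k < l
supplies the surplus weight (l-k)√t. -/
theorem Regular.hasDerivAt_hatW (hP : IsFiberedProjection P) (h : Regular P M u₀ X l N)
    {r k t : ℝ} (hr : 0 ≤ r) (hr2 : r < 2) (hu : InDom 0 r u₀) (hk : 0 ≤ k) (hkl : k < l)
    (ht : 0 < t) :
    HasDerivAt (fun s => hatW (k * Real.sqrt s) r (X s)) (flux P M X k r t) t := by
  have hS : IsOpen (Set.Ioo (t / 2) (2 * t)) := isOpen_Ioo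
  have htS : t ∈ Set.Ioo (t / 2) (2 * t) := ⟨by linarith, by linarith⟩
  have hpos (s : ℝ) (hs : s ∈ Set.Icc (t / 2) (2 * t)) : 0 < s := (half_pos ht).trans_le hs.1
  have hsq : ContinuousOn (fun s => (l - k) * Real.sqrt s) (Set.Icc (t / 2) (2 * t)) := by fun_prop
  have hne (s : ℝ) (hs : s ∈ Set.Icc (t / 2) (2 * t)) : (l - k) * Real.sqrt s ≠ 0 :=
    (mul_pos (sub_pos.2 hkl) (Real.sqrt_pos.2 (hpos s hs))).ne'
  obtain ⟨B, hB⟩ := (isCompact_Icc (a := t / 2) (b := 2 * t)).exists_bound_of_continuousOn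
    (f := fun s => (k / (2 * Real.sqrt s) * ((2 : ℝ) ^ (2 : ℝ) *
        ((l - k) * Real.sqrt s) ^ (-2 : ℝ)) +
        (3 : ℝ) ^ (3 : ℝ) * ((l - k) * Real.sqrt s) ^ (-3 : ℝ)) *
        (solC l N r * (‖expA 0 r u₀‖ + s ^ (1 / 4 - r / 2))) +
      (r + 1) ^ (r + 1) * ((l - k) * Real.sqrt s) ^ (-(r + 1)) * (N * s ^ (-(3 / 4) : ℝ))) (by
    have hrp (p : ℝ) : ContinuousOn (fun s => ((l - k) * Real.sqrt s) ^ p)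
        (Set.Icc (t / 2) (2 * t)) := hsq.rpow_const fun s hs => Or.inl (hne s hs)
    have hrs (p : ℝ) : ContinuousOn (fun s : ℝ => s ^ p) (Set.Icc (t / 2) (2 * t)) :=
      continuousOn_id.rpow_const fun s hs => Or.inl (hpos s hs).ne'
    have hdv : ContinuousOn (fun s => k / (2 * Real.sqrt s)) (Set.Icc (t / 2) (2 * t)) :=
      continuousOn_const.div (by fun_prop) fun s hs =>
        (mul_pos two_pos (Real.sqrt_pos.2 (hpos s hs))).ne'
    exact (((hdv.mul (continuousOn_const.mul (hrp _))).add (continuousOn_const.mul (hrp _))).mul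
      (continuousOn_const.mul (continuousOn_const.add (hrs _)))).add
      ((continuousOn_const.mul (hrp _)).mul (continuousOn_const.mul (hrs _))))
  refine hasDerivAt_of_tendstoUniformlyOn (l := atTop) hS
    (f := fun (n : ℕ) s => mulCLM (chi n) (hatW (k * Real.sqrt s) r (X s)))
    (f' := fun (n : ℕ) s => mulCLM (chi n) (flux P M X k r s))
    (g' := flux P M X k r) ?_ (Eventually.of_forall fun n s hs =>
      h.hasDerivAt_chi hP hr hr2 hu hk hkl (hpos s ⟨hs.1.le, hs.2.le⟩) n)
    (fun s _ => tendsto_mulCLM_chi _) htS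
  refine Metric.tendstoUniformlyOn_iff.2 fun ε hε => ?_
  have hlim : Tendsto (fun n : ℕ => B / n) atTop (𝓝 0) :=
    tendsto_const_nhds.div_atTop tendsto_natCast_atTop_atTop
  filter_upwards [hlim.eventually_lt_const hε, eventually_gt_atTop 0] with n hn hn0 s hs
  have hs' : s ∈ Set.Icc (t / 2) (2 * t) := ⟨hs.1.le, hs.2.le⟩
  rw [dist_eq_norm]
  refine ((h.memLp_flux hP hr hr2 hu hk hkl (hpos s hs')).2.2 n hn0).trans_lt (lt_of_le_of_lt ?_ hn)
  exact div_le_div_of_nonneg_right ((le_abs_self _).trans (hB s hs')) (Nat.cast_nonneg n)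

/-! ### The differential inequality -/

theorem integrable_weight_of_memLp {m : Space → ℝ} (hm0 : ∀ ξ, 0 ≤ m ξ) {f : Space → Vec}
    (h : MemLp (fun ξ => m ξ • f ξ) 2 volume) :
    Integrable (fun ξ => m ξ ^ 2 * ‖f ξ‖ ^ 2) volume ∧
      ‖classL2 (fun ξ => m ξ • f ξ)‖ ^ 2 = ∫ ξ, m ξ ^ 2 * ‖f ξ‖ ^ 2 := by
  have e : (fun ξ => ‖m ξ • f ξ‖ ^ 2) = fun ξ => m ξ ^ 2 * ‖f ξ‖ ^ 2 := by
    funext ξ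
    rw [norm_smul, mul_pow, Real.norm_of_nonneg (hm0 ξ)]
  refine ⟨?_, ?_⟩
  · rw [← e]
    exact h.integrable_norm_pow two_ne_zero
  · rw [norm_classL2_sq h, e]

/-- The elementary inequality behind the absorption of low frequencies. -/
theorem exists_poly_le (k c κ : ℝ) (hk : 0 ≤ k) (hc : 0 ≤ c) (hκ : 0 ≤ κ) :
    ∃ K : ℝ, 0 < K ∧ ∀ y : ℝ, 0 ≤ y →
      k * y - 2 * y ^ 2 + c * (y ^ (3 / 2 : ℝ) + 1) ≤ -κ + K * Real.exp (-(2 * k * y)) := by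
  -- Young's inequality gives c y^{3/2} ≤ (y² + c²y)/2, leaving by - (3/2)y² with b = k + c²/2. Then
  -- by ≤ (b² + y²)/2 bounds the left side plus κ by Q - y². This is negative for y > √Q, while for
  -- y ≤ √Q the exponential factor is at least 1.
  set b := k + c ^ 2 / 2 with hb
  set Q := b ^ 2 / 2 + c + κ + 1 with hQ
  have hb0 : 0 ≤ b := by positivity
  have hQ0 : 0 < Q := by positivity
  refine ⟨Q * Real.exp (2 * k * Real.sqrt Q), by positivity, fun y hy => ?_⟩
  have h1 : y ^ (3 / 2 : ℝ) = y * Real.sqrt y := by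
    rw [show (3 / 2 : ℝ) = 1 + 1 / 2 by norm_num, Real.rpow_add_of_nonneg hy (by norm_num)
      (by norm_num), Real.rpow_one, Real.sqrt_eq_rpow]
  have hs := Real.mul_self_sqrt hy
  have h2 : c * (y * Real.sqrt y) ≤ (y ^ 2 + c ^ 2 * y) / 2 := by
    nlinarith [sq_nonneg (y - c * Real.sqrt y)]
  have h3 : k * y - 2 * y ^ 2 + c * (y ^ (3 / 2 : ℝ) + 1) + κ ≤ Q - y ^ 2 := by
    rw [h1]
    nlinarith [sq_nonneg (y - b)]
  have h4 : Q - y ^ 2 ≤ Q * Real.exp (2 * k * Real.sqrt Q) * Real.exp (-(2 * k * y)) := by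
    rw [mul_assoc, ← Real.exp_add]
    rcases le_total y (Real.sqrt Q) with h | h
    · have : 1 ≤ Real.exp (2 * k * Real.sqrt Q + -(2 * k * y)) := by
        refine Real.one_le_exp ?_
        nlinarith
      nlinarith [sq_nonneg y]
    · have : Q ≤ y ^ 2 := by
        have := mul_self_le_mul_self (Real.sqrt_nonneg Q) h
        rw [Real.mul_self_sqrt hQ0.le] at this
        nlinarith
      have : 0 ≤ Q * Real.exp (2 * k * Real.sqrt Q + -(2 * k * y)) := by positivity
      linarith
  linarith

end NavierStokes

/-! ### The differential inequality and its integrated form. -/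

namespace NavierStokes

variable {P : Space → Matrix (Fin 3) (Fin 3) ℂ} {M : Matrix (Fin 3) (Fin 3) ℝ}
  {u₀ : VecDist} {X : ℝ → VecDist} {l N : ℝ}

theorem inner_classL2_smul {m : Space → ℝ} {f : VecL2}
    (h : MemLp (fun ξ => m ξ • f ξ) 2 volume) :
    Integrable (fun ξ => m ξ * ‖f ξ‖ ^ 2) volume ∧
      inner ℝ f (classL2 (fun ξ => m ξ • f ξ)) = ∫ ξ, m ξ * ‖f ξ‖ ^ 2 := by
  have e : (fun ξ => inner ℝ (f ξ) (classL2 (fun ξ => m ξ • f ξ) ξ)) =ᵐ[volume]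
      fun ξ => m ξ * ‖f ξ‖ ^ 2 := by
    filter_upwards [coeFn_classL2 h] with ξ hξ
    rw [hξ, real_inner_smul_right, real_inner_self_eq_norm_sq]
  refine ⟨(L2.integrable_inner (𝕜 := ℝ) f (classL2 fun ξ => m ξ • f ξ)).congr e, ?_⟩
  rw [L2.inner_def]
  exact integral_congr_ae e

/-- Moving A^r from the forcing to the solution leaves the forcing with the exponential weight
alone, in which the bilinear estimate is formulated. -/
theorem inner_hatW_classL2 {T : VecDist} {F : VecL2} {θ r : ℝ} (hr : 0 ≤ r) (h1 : InDom θ r T)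
    (h2 : InDom θ (r + r) T) (h3 : MemLp (fun ξ => wt θ r ξ • F ξ) 2 volume)
    (h4 : MemLp (fun ξ => wt θ 0 ξ • F ξ) 2 volume) :
    inner ℝ (hatW θ r T) (classL2 (fun ξ => wt θ r ξ • F ξ)) =
      inner ℝ (hatW θ (r + r) T) (classL2 (fun ξ => wt θ 0 ξ • F ξ)) := by
  rw [L2.inner_def, L2.inner_def]
  refine integral_congr_ae ?_
  filter_upwards [h1.coeFn_hatW, h2.coeFn_hatW, coeFn_classL2 h3, coeFn_classL2 h4]
    with ξ e1 e2 e3 e4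
  rw [e1, e2, e3, e4]
  simp only [real_inner_smul_left, real_inner_smul_right]
  have e5 := wt_mul_wt θ θ hr hr ξ
  have e6 := wt_mul_wt θ θ (add_nonneg hr hr) le_rfl ξ
  rw [add_zero] at e6
  linear_combination (e5 - e6) * inner ℝ (hat T ξ) (F ξ)

/-- Norms with other weights in terms of `hatW θ r T`. -/
theorem InDom.norm_sq_expA {T : VecDist} {θ r η ρ : ℝ} (h1 : InDom θ r T) (hr : 0 ≤ r) (hρ : 0 ≤ ρ)
    (h2 : InDom (η + θ) (ρ + r) T) :
    Integrable (fun ξ => wt η ρ ξ ^ 2 * ‖hatW θ r T ξ‖ ^ 2) volume ∧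
      ‖expA (η + θ) (ρ + r) T‖ ^ 2 = ∫ ξ, wt η ρ ξ ^ 2 * ‖hatW θ r T ξ‖ ^ 2 := by
  have e : (fun ξ => wt (η + θ) (ρ + r) ξ • hat T ξ) =ᵐ[volume]
      fun ξ => wt η ρ ξ • hatW θ r T ξ := by
    filter_upwards [h1.coeFn_hatW] with ξ e1
    rw [e1, smul_smul, wt_mul_wt _ _ hρ hr]
  have h3 := (memLp_congr_ae e).1 h2.2
  obtain ⟨h4, h5⟩ := integrable_weight_of_memLp (wt_nonneg η ρ) h3
  refine ⟨h4, ?_⟩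
  rw [norm_expA_eq, hatW, classL2_congr e, h5]

theorem G_eq (k r : ℝ) (X : ℝ → VecDist) :
    G k r X = fun t => ‖hatW (k * Real.sqrt t) r (X t)‖ ^ 2 := by
  funext t
  rw [G, norm_expA_eq]

theorem J_eq (r : ℝ) (X : ℝ → VecDist) : J r X = G 0 r X := by
  funext t
  rw [G, J, zero_mul]

theorem Regular.hasDerivAt_G (hP : IsFiberedProjection P) (h : Regular P M u₀ X l N) {r k t : ℝ}
    (hr : 0 ≤ r) (hr2 : r < 2) (hu : InDom 0 r u₀) (hk : 0 ≤ k) (hkl : k < l) (ht : 0 < t) :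
    HasDerivAt (G k r X) (2 * inner ℝ (hatW (k * Real.sqrt t) r (X t)) (flux P M X k r t)) t := by
  rw [G_eq]
  exact (h.hasDerivAt_hatW hP hr hr2 hu hk hkl ht).norm_sq

/-- The powers of t make both squares scale invariant: relative to A^r X they become the multipliers
y^{2r} and y^{2(3/4-r)} with y = √t|ξ|. The exponents match because -5/8 = -1 + r/2 + (3/4-r)/2. -/
theorem young_scaled {t : ℝ} (r a b : ℝ) (ht : 0 < t) :
    2 * t ^ (-(5 / 8) : ℝ) * (a * b) ≤ t⁻¹ * (t ^ r * a ^ 2 + t ^ (3 / 4 - r) * b ^ 2) := by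
  have h1 : t ^ (-(5 / 8) : ℝ) = t⁻¹ * (t ^ (r / 2) * t ^ ((3 / 4 - r) / 2)) := by
    rw [← Real.rpow_add ht, ← Real.rpow_neg_one, ← Real.rpow_add ht]
    congr 1
    ring
  have h2 : t ^ r = (t ^ (r / 2)) ^ 2 := by
    rw [sq, ← Real.rpow_add ht]
    congr 1
    ring
  have h3 : t ^ (3 / 4 - r) = (t ^ ((3 / 4 - r) / 2)) ^ 2 := by
    rw [sq, ← Real.rpow_add ht]
    congr 1
    ring
  rw [h1, h2, h3]
  have h4 := two_mul_le_add_sq (t ^ (r / 2) * a) (t ^ ((3 / 4 - r) / 2) * b)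
  have h5 : 0 < t⁻¹ := inv_pos.2 ht
  calc _ = t⁻¹ * (2 * (t ^ (r / 2) * a) * (t ^ ((3 / 4 - r) / 2) * b)) := by ring
    _ ≤ t⁻¹ * ((t ^ (r / 2) * a) ^ 2 + (t ^ ((3 / 4 - r) / 2) * b) ^ 2) := by gcongr
    _ = _ := by ring

theorem rpow_le_add_one {y p : ℝ} (hy : 0 ≤ y) (hp : 0 ≤ p) (hp2 : p ≤ 3 / 2) :
    y ^ p ≤ y ^ (3 / 2 : ℝ) + 1 := by
  rcases le_total y 1 with h | h
  · have := Real.rpow_le_one hy h hp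
    have := Real.rpow_nonneg hy (3 / 2)
    linarith
  · have := Real.rpow_le_rpow_of_exponent_le h hp2
    linarith

theorem rpow_mul_wt_sq {t p : ℝ} (ht : 0 ≤ t) (ξ : Space) :
    t ^ p * wt 0 p ξ ^ 2 = (Real.sqrt t * symA ξ) ^ (2 * p) := by
  rw [wt, zero_mul, Real.exp_zero, mul_one, Real.mul_rpow (Real.sqrt_nonneg t) (symA_nonneg ξ),
    Real.sqrt_eq_rpow, ← Real.rpow_mul ht, ← Real.rpow_mul_natCast (symA_nonneg ξ)]
  congr 2
  · ring
  · push_cast; ring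

theorem integral_combination_le {f₁ f₂ f₃ g₁ g₂ : Space → ℝ} (h₁ : Integrable f₁ volume)
    (h₂ : Integrable f₂ volume) (h₃ : Integrable f₃ volume) (k₁ : Integrable g₁ volume)
    (k₂ : Integrable g₂ volume) {a b c d e : ℝ}
    (h : ∀ ξ, a * f₁ ξ + b * f₂ ξ + c * f₃ ξ ≤ d * g₁ ξ + e * g₂ ξ) :
    a * (∫ ξ, f₁ ξ) + b * (∫ ξ, f₂ ξ) + c * (∫ ξ, f₃ ξ) ≤ d * (∫ ξ, g₁ ξ) + e * ∫ ξ, g₂ ξ := by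
  have hl := ((h₁.const_mul a).add (h₂.const_mul b)).add (h₃.const_mul c)
  have hr := (k₁.const_mul d).add (k₂.const_mul e)
  have h12 : ∫ ξ, (a * f₁ ξ + b * f₂ ξ) = a * (∫ ξ, f₁ ξ) + b * ∫ ξ, f₂ ξ := by
    rw [integral_add (h₁.const_mul a) (h₂.const_mul b), integral_const_mul, integral_const_mul]
  have h123 : ∫ ξ, (a * f₁ ξ + b * f₂ ξ + c * f₃ ξ) =
      a * (∫ ξ, f₁ ξ) + b * (∫ ξ, f₂ ξ) + c * ∫ ξ, f₃ ξ := by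
    rw [← h12, ← integral_const_mul]
    exact integral_add ((h₁.const_mul a).add (h₂.const_mul b)) (h₃.const_mul c)
  have k12 : ∫ ξ, (d * g₁ ξ + e * g₂ ξ) = d * (∫ ξ, g₁ ξ) + e * ∫ ξ, g₂ ξ := by
    rw [integral_add (k₁.const_mul d) (k₂.const_mul e), integral_const_mul, integral_const_mul]
  rw [← h123, ← k12]
  exact integral_mono hl hr h

/-- The differential inequality for `G`. -/
theorem exists_deriv_bound (hP : IsFiberedProjection P) (M : Matrix (Fin 3) (Fin 3) ℝ)
    {k κ : ℝ} (hκ : 0 ≤ κ) (N : ℝ) :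
    ∃ K : ℝ, 0 < K ∧ ∀ u₀ X l N' r, Regular P M u₀ X k N → Regular P M u₀ X l N' → k < l →
      0 ≤ r → r ≤ 1 / 2 → InDom 0 r u₀ → ∀ t, 0 < t → ∃ G', HasDerivAt (G k r X) G' t ∧
        G' ≤ -κ * t⁻¹ * G k r X t + K * t⁻¹ * J r X t := by
  -- Otherwise no solution satisfies `Regular` with these constants.
  by_cases hkN : 0 ≤ k ∧ 0 ≤ N
  swap
  · exact ⟨1, one_pos, fun _ _ _ _ _ h => absurd ⟨h.l_nonneg, h.N_nonneg⟩ hkN⟩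
  obtain ⟨hk, hN⟩ := hkN
  -- In this splitting A^{7/4}X is replaced by its scale invariant bound D t^{-5/8}, and A^{3/4}X is
  -- kept, so the nonlinear term is quadratic in X and subordinate to the dissipation.
  obtain ⟨C, hC, hF⟩ := eLpNorm_forc_le hP M (α := 3 / 4) (β := 3 / 4) (by norm_num) (by norm_num)
    (by norm_num)
  set D := |solC k N (7 / 4) * (N + 1)| with hD
  obtain ⟨K, hK, hpoly⟩ := exists_poly_le k (2 * (C * D)) κ hk (by positivity) hκ
  -- `h` supplies the constants; `h'`, with the larger weight l, is used only for differentiability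
  -- and membership, so l and N' do not enter K.
  refine ⟨K, hK, fun u₀ X l N' r h h' hkl hr hr2 hu t ht => ?_⟩
  have hst := Real.sqrt_pos.2 ht
  have hθ : 0 ≤ k * Real.sqrt t := by positivity
  set θ := k * Real.sqrt t with hθd
  obtain ⟨h1, -⟩ := h.inDom hP hr le_rfl (by linarith) hu ht hθ le_rfl
  obtain ⟨h2, -⟩ := h.inDom hP (r := r + r) hr (by linarith) (by linarith) hu ht hθ le_rfl
  obtain ⟨h3, -⟩ := h.inDom_half hP (r := 3 / 4) (by norm_num) (by norm_num) ht hθ le_rfl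
  obtain ⟨h4, h4'⟩ := h.inDom_half hP (r := 7 / 4) (by norm_num) (by norm_num) ht hθ le_rfl
  obtain ⟨m1, m2, -⟩ := h'.memLp_flux hP hr (by linarith) hu hk hkl ht
  refine ⟨_, h'.hasDerivAt_G hP hr (by linarith) hu hk hkl ht, ?_⟩
  rw [← hθd] at m1 m2 ⊢
  have hFt := hF θ hθ (X t) (X t) (h.hdot t ht) (h.hdot t ht)
  rw [show (1 + 3 / 4 : ℝ) = 7 / 4 by norm_num, eLpNorm_weighted h3, eLpNorm_weighted h4,
    ← ENNReal.ofReal_mul (norm_nonneg _), ← ENNReal.ofReal_mul hC] at hFt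
  have m3 : MemLp (fun ξ => wt θ 0 ξ • forc P M (X t) (X t) ξ) 2 volume :=
    ⟨(measurable_wt _ _).aestronglyMeasurable.smul (Lp.aestronglyMeasurable _),
      hFt.trans_lt ENNReal.ofReal_lt_top⟩
  have hFn : ‖classL2 (fun ξ => wt θ 0 ξ • forc P M (X t) (X t) ξ)‖ ≤
      C * D * t ^ (-(5 / 8) : ℝ) * ‖expA θ (3 / 4) (X t)‖ := by
    rw [norm_classL2 m3]
    refine ENNReal.toReal_le_of_le_ofReal ?_ (hFt.trans (ENNReal.ofReal_le_ofReal ?_))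
    · have : 0 ≤ t ^ (-(5 / 8) : ℝ) := Real.rpow_nonneg ht.le _
      positivity
    · have h5 : ‖expA θ (7 / 4) (X t)‖ ≤ D * t ^ (-(5 / 8) : ℝ) := by
        refine h4'.trans ?_
        rw [show (1 / 4 - 7 / 4 / 2 : ℝ) = -(5 / 8) by norm_num]
        have : 0 ≤ t ^ (-(5 / 8) : ℝ) := Real.rpow_nonneg ht.le _
        gcongr
        exact le_abs_self _
      calc C * (‖expA θ (3 / 4) (X t)‖ * ‖expA θ (7 / 4) (X t)‖)
          ≤ C * (‖expA θ (3 / 4) (X t)‖ * (D * t ^ (-(5 / 8) : ℝ))) := by gcongr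
        _ = _ := by ring
  obtain ⟨i1, e1⟩ := inner_classL2_smul m1
  have e2 := inner_hatW_classL2 hr h1 h2 m2 m3
  obtain ⟨i3, e3⟩ := h1.norm_sq_expA (η := 0) (ρ := r) hr hr (by rwa [zero_add])
  obtain ⟨i4, e4⟩ := h1.norm_sq_expA (η := 0) (ρ := 3 / 4 - r) hr (by linarith)
    (by rwa [zero_add, sub_add_cancel])
  obtain ⟨i5, e5⟩ := h1.norm_sq_expA (η := -θ) (ρ := 0) hr le_rfl
    (by rw [neg_add_cancel, zero_add]; exact (h1.of_le hr hθ).1)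
  obtain ⟨i6, e6⟩ := h1.norm_sq_expA (η := 0) (ρ := 0) hr le_rfl (by rwa [zero_add, zero_add])
  rw [zero_add] at e3
  rw [zero_add, sub_add_cancel] at e4
  rw [neg_add_cancel, zero_add] at e5
  rw [zero_add, zero_add] at e6
  set W := hatW θ r (X t) with hW
  have hG : G k r X t = ∫ ξ, wt 0 0 ξ ^ 2 * ‖W ξ‖ ^ 2 := e6
  have hJ : J r X t = ∫ ξ, wt (-θ) 0 ξ ^ 2 * ‖W ξ‖ ^ 2 := e5
  have hinner : -inner ℝ W (classL2 fun ξ => wt θ r ξ • forc P M (X t) (X t) ξ) ≤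
      C * D * t ^ (-(5 / 8) : ℝ) * (‖expA θ (r + r) (X t)‖ * ‖expA θ (3 / 4) (X t)‖) := by
    rw [e2]
    refine (neg_le_abs _).trans ((abs_real_inner_le_norm _ _).trans ?_)
    rw [← norm_expA_eq]
    calc _ ≤ ‖expA θ (r + r) (X t)‖ * (C * D * t ^ (-(5 / 8) : ℝ) * ‖expA θ (3 / 4) (X t)‖) := by
          gcongr
      _ = _ := by ring
  have hy := young_scaled r ‖expA θ (r + r) (X t)‖ ‖expA θ (3 / 4) (X t)‖ ht
  have hCD : 0 ≤ C * D := by positivity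
  have step : 2 * inner ℝ W (flux P M X k r t) ≤ 2 * (∫ ξ, gen k t ξ * ‖W ξ‖ ^ 2) +
      C * D * (t⁻¹ * (t ^ r * ‖expA θ (r + r) (X t)‖ ^ 2 +
        t ^ (3 / 4 - r) * ‖expA θ (3 / 4) (X t)‖ ^ 2)) := by
    have e7 : flux P M X k r t = classL2 (fun ξ => gen k t ξ • W ξ) -
      classL2 (fun ξ => wt θ r ξ • forc P M (X t) (X t) ξ) := rfl
    rw [e7, inner_sub_right, e1]
    have := mul_le_mul_of_nonneg_left hy hCD
    linarith
  refine step.trans ?_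
  rw [hG, hJ, e3, e4]
  -- All norms are now integrals of |W|² against multipliers, so the inequality may be checked for
  -- each frequency.
  refine le_trans (le_of_eq (by ring)) (integral_combination_le i1 i3 i4 i6 i5 (a := 2)
    (b := C * D * (t⁻¹ * t ^ r)) (c := C * D * (t⁻¹ * t ^ (3 / 4 - r))) fun ξ => ?_)
  have hy0 : 0 ≤ Real.sqrt t * symA ξ := mul_nonneg hst.le (symA_nonneg ξ)
  have p1 := hpoly _ hy0
  have p2 := rpow_le_add_one hy0 (p := 2 * r) (by linarith) (by linarith)
  have p3 := rpow_le_add_one hy0 (p := 2 * (3 / 4 - r)) (by linarith) (by linarith)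
  have p4 : wt 0 0 ξ = 1 := by simp [wt]
  -- This factor removes the exponential weight from |W|² and so turns G into J.
  have p5 : wt (-θ) 0 ξ ^ 2 = Real.exp (-(2 * k * (Real.sqrt t * symA ξ))) := by
    rw [wt, Real.rpow_zero, one_mul, ← Real.exp_nat_mul, hθd]
    congr 1
    push_cast
    ring
  have p6 : 2 * gen k t ξ = t⁻¹ * (k * (Real.sqrt t * symA ξ) - 2 * (Real.sqrt t * symA ξ) ^ 2) := by
    rw [gen, eq_inv_mul_iff_mul_eq₀ ht.ne']
    field_simp
    rw [Real.sq_sqrt ht.le]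
  have p7 := mul_le_mul_of_nonneg_left (add_le_add p2 p3) hCD
  have hti : 0 < t⁻¹ := inv_pos.2 ht
  calc _ = t⁻¹ * (k * (Real.sqrt t * symA ξ) - 2 * (Real.sqrt t * symA ξ) ^ 2 +
        C * D * ((Real.sqrt t * symA ξ) ^ (2 * r) + (Real.sqrt t * symA ξ) ^ (2 * (3 / 4 - r)))) *
        ‖W ξ‖ ^ 2 := by
        rw [← rpow_mul_wt_sq ht.le, ← rpow_mul_wt_sq ht.le]
        linear_combination ‖W ξ‖ ^ 2 * p6
    _ ≤ t⁻¹ * (-κ + K * Real.exp (-(2 * k * (Real.sqrt t * symA ξ)))) * ‖W ξ‖ ^ 2 := by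
        refine mul_le_mul_of_nonneg_right (mul_le_mul_of_nonneg_left ?_ hti.le) (sq_nonneg _)
        linarith
    _ = _ := by rw [p4, p5]; ring

/-! ### Integration of the differential inequality -/

/-- With the integrating factor t^κ, the function t^κ G - K∫₀ᵗ s^{κ-1}J is nonincreasing. Near 0 it
is at most t^κ B, which tends to 0 because κ > 0, so it is never positive. -/
theorem diffIneq_of {κ K : ℝ} {G J : ℝ → ℝ} (hκ : 0 < κ) (hK : 0 ≤ K)
    (hd : ∀ t, 0 < t → ∃ G', HasDerivAt G G' t ∧ G' ≤ -κ * t⁻¹ * G t + K * t⁻¹ * J t)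
    (hJc : ContinuousOn J (Set.Ioi 0)) (hJ : ∀ t, 0 < t → 0 ≤ J t)
    (hb : ∀ T, 0 < T → ∃ B, ∀ t ∈ Set.Ioc 0 T, G t ≤ B ∧ J t ≤ B) : DiffIneq κ K G J := by
  have hcont : ContinuousOn (fun s : ℝ => s ^ (κ - 1) * J s) (Set.Ioi 0) :=
    (continuousOn_id.rpow_const fun s hs => Or.inl (ne_of_gt hs)).mul hJc
  have hint (t : ℝ) (ht : 0 < t) : IntervalIntegrable (fun s => s ^ (κ - 1) * J s) volume 0 t := by
    obtain ⟨B, hB⟩ := hb t ht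
    have h1 : IntervalIntegrable (fun s : ℝ => s ^ (κ - 1) * B) volume 0 t :=
      (intervalIntegral.intervalIntegrable_rpow' (by linarith)).mul_const B
    refine h1.mono_fun' ?_ ?_
    · rw [Set.uIoc_of_le ht.le]
      exact (hcont.mono fun s hs => hs.1).aestronglyMeasurable measurableSet_Ioc
    · rw [Set.uIoc_of_le ht.le]
      filter_upwards [ae_restrict_mem measurableSet_Ioc] with s hs
      have h2 : 0 ≤ s ^ (κ - 1) := Real.rpow_nonneg hs.1.le _
      rw [Real.norm_of_nonneg (mul_nonneg h2 (hJ s hs.1))]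
      exact mul_le_mul_of_nonneg_left (hB s hs).2 h2
  have hΦ (t : ℝ) (ht : 0 < t) : ∃ Φ' ≤ 0,
      HasDerivAt (fun t => t ^ κ * G t - K * ∫ s in (0 : ℝ)..t, s ^ (κ - 1) * J s) Φ' t := by
    obtain ⟨G', h1, h2⟩ := hd t ht
    have h3 := (Real.hasDerivAt_rpow_const (p := κ) (Or.inl ht.ne')).mul h1
    have h4 := intervalIntegral.integral_hasDerivAt_right (hint t ht)
      (hcont.stronglyMeasurableAtFilter isOpen_Ioi t ht) (hcont.continuousAt (Ioi_mem_nhds ht))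
    refine ⟨_, ?_, h3.sub (h4.const_mul K)⟩
    have h5 : t ^ κ = t ^ (κ - 1) * t := by
      rw [← Real.rpow_add_one ht.ne', sub_add_cancel]
    have h6 : 0 < t ^ (κ - 1) := Real.rpow_pos_of_pos ht _
    have h7 : t * G' ≤ -κ * G t + K * J t := by
      have := mul_le_mul_of_nonneg_left h2 ht.le
      refine this.trans (le_of_eq ?_)
      field_simp
    rw [h5]
    have := mul_le_mul_of_nonneg_left h7 h6.le
    nlinarith
  intro t ht
  obtain ⟨G', h1, h2⟩ := hd t ht
  refine ⟨⟨h1.differentiableAt, h1.deriv ▸ h2⟩, hint t ht, ?_⟩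
  have hanti : AntitoneOn (fun t => t ^ κ * G t - K * ∫ s in (0 : ℝ)..t, s ^ (κ - 1) * J s)
      (Set.Ioi 0) := by
    refine antitoneOn_of_deriv_nonpos (convex_Ioi 0) (fun s hs => ?_) (fun s hs => ?_)
      fun s hs => ?_
    · obtain ⟨_, -, h⟩ := hΦ s hs
      exact h.continuousAt.continuousWithinAt
    · rw [interior_Ioi] at hs
      obtain ⟨_, -, h⟩ := hΦ s hs
      exact h.differentiableAt.differentiableWithinAt
    · rw [interior_Ioi] at hs
      obtain ⟨_, h0, h⟩ := hΦ s hs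
      rwa [h.deriv]
  obtain ⟨B, hB⟩ := hb t ht
  have hlim : Tendsto (fun s : ℝ => s ^ κ * B) (𝓝[>] 0) (𝓝 0) := by
    have h3 : ContinuousAt (fun s : ℝ => s ^ κ * B) 0 :=
      (Real.continuousAt_rpow_const 0 κ (Or.inr hκ.le)).mul continuousAt_const
    have h4 := h3.tendsto
    rw [Real.zero_rpow hκ.ne', zero_mul] at h4
    exact h4.mono_left nhdsWithin_le_nhds
  have hle : t ^ κ * G t - K * ∫ s in (0 : ℝ)..t, s ^ (κ - 1) * J s ≤ 0 := by
    refine ge_of_tendsto hlim ?_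
    filter_upwards [Ioc_mem_nhdsGT ht] with s hs
    refine (hanti (Set.mem_Ioi.2 hs.1) ht hs.2).trans ?_
    have h5 : 0 ≤ ∫ x in (0 : ℝ)..s, x ^ (κ - 1) * J x := by
      refine intervalIntegral.integral_nonneg_of_ae_restrict hs.1.le ?_
      refine (ae_restrict_iff' measurableSet_Icc).2 ?_
      have hne : ∀ᵐ x : ℝ, x ≠ 0 := by simp [ae_iff]
      filter_upwards [hne] with x h0 hx
      have hx0 : 0 < x := lt_of_le_of_ne hx.1 (Ne.symm h0)
      exact mul_nonneg (Real.rpow_nonneg hx0.le _) (hJ x hx0)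
    have h6 := mul_le_mul_of_nonneg_left (hB s hs).1 (Real.rpow_nonneg hs.1.le κ)
    have h7 := mul_nonneg hK h5
    dsimp only
    linarith
  have h8 : t ^ (-κ) * t ^ κ = 1 := by rw [← Real.rpow_add ht]; simp
  have h9 : 0 < t ^ (-κ) := Real.rpow_pos_of_pos ht _
  calc G t = t ^ (-κ) * (t ^ κ * G t) := by rw [← mul_assoc, h8, one_mul]
    _ ≤ t ^ (-κ) * (K * ∫ s in (0 : ℝ)..t, s ^ (κ - 1) * J s) := by
        exact mul_le_mul_of_nonneg_left (by linarith) h9.le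
    _ = _ := by ring

end NavierStokes

/-! ### Decay at infinity. -/

namespace NavierStokes

variable {P : Space → Matrix (Fin 3) (Fin 3) ℂ} {M : Matrix (Fin 3) (Fin 3) ℝ}

section

variable {C₁ C₃ : ℝ} {u₀ : VecDist} {X : ℝ → VecDist} {lamBar : EReal} {lam0 : ℝ}

/-! ### Consequences of the smallness condition -/

theorem Setting.small_at (h : Setting P M C₁ C₃ u₀ X lamBar lam0) (hC₁ : 0 < C₁) (hC₃ : 0 < C₃) :
    4 * C₁ * C₃ * normHdot (1 / 2) u₀ * (1 + lam0 ^ 2) * Real.exp (lam0 ^ 2 / 4) ≤ 1 := by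
  have hU : 0 ≤ normHdot (1 / 2) u₀ := norm_nonneg _
  rcases h.critical with ⟨h1, -⟩ | ⟨-, l, -, h2, h3⟩
  · rw [h1]; simp
  · have h4 : lam0 < l := by
      have := h.lt
      rw [h2] at this
      exact_mod_cast this
    have h5 := h.pos.le
    refine le_trans ?_ h3.le
    have h6 : 0 ≤ 4 * C₁ * C₃ * normHdot (1 / 2) u₀ := by positivity
    gcongr

/-- The strict inequality λ₀ < λ̄ leaves room for the surplus weight that pays for derivatives. -/
theorem Setting.exists_gt (h : Setting P M C₁ C₃ u₀ X lamBar lam0) :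
    ∃ l, lam0 < l ∧ Setting P M C₁ C₃ u₀ X lamBar l := by
  obtain ⟨l, h1, h2⟩ := EReal.lt_iff_exists_real_btwn.1 h.lt
  have h3 : lam0 < l := by exact_mod_cast h1
  exact ⟨l, h3, h.data, h.small, h.solution, h.critical, h.pos.trans h3, h2⟩

theorem Setting.exists_regular (hP : IsFiberedProjection P) (hC₁ : 0 < C₁) (hC₃ : 0 < C₃)
    (hD : DataBound C₁) (hB : BilinearBound P M C₃)
    (h : Setting P M C₁ C₃ u₀ X lamBar lam0) : ∃ N, Regular P M u₀ X lam0 N := by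
  obtain ⟨N, hN⟩ := NavierStokes.exists_regular hP hC₁ hC₃ hD hB h.pos.le
  exact ⟨N, hN u₀ X h.data h.solution (h.small_at hC₁ hC₃)⟩

theorem MemL2.inDom (h : MemL2 u₀) : InDom 0 0 u₀ := by
  obtain ⟨f, rfl⟩ := h
  have h1 : IsFun (𝓕 (Lp.toTemperedDistribution f : VecDist)) (𝓕 f : VecL2) := by
    rw [Lp.fourier_toTemperedDistribution_eq]
    exact isFun_toTemperedDistribution _
  refine ⟨⟨_, h1⟩, ?_⟩
  have h2 : (fun ξ => wt 0 0 ξ • hat (Lp.toTemperedDistribution f) ξ) =ᵐ[volume] (𝓕 f : VecL2) := by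
    filter_upwards [(isFun_toFun ⟨_, h1⟩).ae_eq h1] with ξ hξ
    have : hat (Lp.toTemperedDistribution f) ξ = (𝓕 f : VecL2) ξ := hξ
    rw [this]
    simp [wt]
  rw [weightedHat_eq]
  exact (memLp_congr_ae h2).2 (Lp.memLp _)

end

section

variable {u₀ : VecDist} {X : ℝ → VecDist} {k l N N' : ℝ}

theorem Regular.diffIneq (hP : IsFiberedProjection P) (h : Regular P M u₀ X k N)
    (h' : Regular P M u₀ X l N') (hkl : k < l) {r : ℝ} (hr : 0 ≤ r) (hr2 : r ≤ 1 / 2)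
    (hu : InDom 0 r u₀) {κ K : ℝ} (hκ : 0 < κ) (hK : 0 < K)
    (hd : ∀ t, 0 < t → ∃ G', HasDerivAt (G k r X) G' t ∧
        G' ≤ -κ * t⁻¹ * G k r X t + K * t⁻¹ * J r X t) : DiffIneq κ K (G k r X) (J r X) := by
  refine diffIneq_of hκ hK.le hd ?_ (fun t _ => sq_nonneg _) fun T hT => ?_
  -- J is G with weight 0, so its continuity follows from the same derivative formula.
  · rw [J_eq]
    exact fun t ht => (h'.hasDerivAt_G hP hr (by linarith) hu le_rfl
      (h.l_nonneg.trans_lt hkl) ht).continuousAt.continuousWithinAt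
  -- Boundedness near t = 0 needs a nonnegative exponent 1/4 - r/2, that is r ≤ 1/2.
  · refine ⟨(solC k N r * (‖expA 0 r u₀‖ + T ^ (1 / 4 - r / 2))) ^ 2, fun t ht => ?_⟩
    have hθ : 0 ≤ k * Real.sqrt t := mul_nonneg h.l_nonneg (Real.sqrt_nonneg t)
    obtain ⟨h1, h2⟩ := h.inDom hP hr le_rfl (by linarith) hu ht.1 hθ le_rfl
    rw [sub_self, zero_div, neg_zero, Real.rpow_zero, one_mul] at h2
    have h3 : t ^ (1 / 4 - r / 2) ≤ T ^ (1 / 4 - r / 2) :=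
      Real.rpow_le_rpow ht.1.le ht.2 (by linarith)
    have h4 : ‖expA (k * Real.sqrt t) r (X t)‖ ≤
        solC k N r * (‖expA 0 r u₀‖ + T ^ (1 / 4 - r / 2)) :=
      h2.trans (mul_le_mul_of_nonneg_left (by linarith) (h.solC_nonneg r))
    have h5 := (h1.of_le hr hθ).2.2
    exact ⟨pow_le_pow_left₀ (norm_nonneg _) h4 2,
      pow_le_pow_left₀ (norm_nonneg _) (h5.trans h4) 2⟩

/-- Higher norms are controlled by lower ones with a larger exponential weight. -/
theorem Regular.gap (hP : IsFiberedProjection P) (h : Regular P M u₀ X l N) (hk : 0 ≤ k)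
    (hkl : k < l) {a r : ℝ} (ha : 0 ≤ a) (ha2 : a < 2) (har : a ≤ r) (hu : InDom 0 a u₀) {t : ℝ}
    (ht : 0 < t) :
    InDom 0 r (X t) ∧ InDom (k * Real.sqrt t) r (X t) ∧ J r X t ≤ G k r X t ∧
      G k r X t ≤ ((r - a) ^ (r - a) * (l - k) ^ (-(r - a))) ^ 2 * t ^ (-(r - a)) * G l a X t := by
  have hst := Real.sqrt_pos.2 ht
  have hlk : 0 < l - k := sub_pos.2 hkl
  have hθ : 0 ≤ k * Real.sqrt t := mul_nonneg hk hst.le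
  have h1 := (h.inDom hP ha le_rfl ha2 hu ht (mul_nonneg h.l_nonneg hst.le) le_rfl).1
  rw [show l * Real.sqrt t = k * Real.sqrt t + (l - k) * Real.sqrt t by ring] at h1
  obtain ⟨h2, h3⟩ := h1.gap ha har (mul_pos hlk hst)
  obtain ⟨h4, -, h5⟩ := h2.of_le (ha.trans har) hθ
  refine ⟨h4, h2, pow_le_pow_left₀ (norm_nonneg _) h5 2,
    (pow_le_pow_left₀ (norm_nonneg _) h3 2).trans (le_of_eq ?_)⟩
  rw [G, show l * Real.sqrt t = k * Real.sqrt t + (l - k) * Real.sqrt t by ring, mul_pow,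
    Real.mul_rpow hlk.le hst.le, ← mul_assoc, mul_pow _ (Real.sqrt t ^ _)]
  congr 2
  rw [← Real.rpow_mul_natCast hst.le, Real.sqrt_eq_rpow, ← Real.rpow_mul ht.le]
  congr 1
  push_cast
  ring

end

/-! ### Propagation of decay -/

/-- Since s < κ, the integral of x^{κ-s-1} grows like t^{κ-s}. This dominates the constant
contribution of the initial interval, where the decay bound is not available. -/
theorem DiffIneq.isBigO {κ K s : ℝ} {G J : ℝ → ℝ} (h : DiffIneq κ K G J) (hK : 0 < K)
    (hκs : s < κ) (hG : ∀ t, 0 ≤ G t) (hJ : J =O[atTop] fun t : ℝ => t ^ (-s)) :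
    G =O[atTop] fun t : ℝ => t ^ (-s) := by
  obtain ⟨C, hC0, hC⟩ := hJ.exists_nonneg
  obtain ⟨t₁, ht₁⟩ := eventually_atTop.1 hC.bound
  set t₀ := max t₁ 1 with ht₀
  have h1 : 1 ≤ t₀ := le_max_right _ _
  set A := |∫ x in (0 : ℝ)..t₀, x ^ (κ - 1) * J x| with hA
  have hκs' : 0 < κ - s := sub_pos.2 hκs
  refine IsBigO.of_bound (K * (A + C / (κ - s))) ?_
  filter_upwards [eventually_ge_atTop t₀] with t ht
  have ht1 : 1 ≤ t := h1.trans ht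
  have ht0 : 0 < t := by linarith
  have hi := (h t ht0).2.1
  have hi0 := (h t₀ (by linarith)).2.1
  have hi1 : IntervalIntegrable (fun x => x ^ (κ - 1) * J x) volume t₀ t := hi0.symm.trans hi
  have hne : ∀ x ∈ Set.uIcc t₀ t, x ≠ 0 := fun x hx => by
    rw [Set.uIcc_of_le ht] at hx
    linarith [hx.1]
  have h2 : ∫ x in t₀..t, x ^ (κ - 1) * J x ≤ C / (κ - s) * t ^ (κ - s) := by
    have h3 : ∫ x in t₀..t, x ^ (κ - 1) * J x ≤ ∫ x in t₀..t, C * x ^ (κ - s - 1) := by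
      refine intervalIntegral.integral_mono_on ht hi1 ?_ fun x hx => ?_
      · refine ContinuousOn.intervalIntegrable (continuousOn_const.mul ?_)
        exact continuousOn_id.rpow_const fun x hx => Or.inl (hne x hx)
      · have hx0 : 0 < x := by linarith [hx.1]
        have h4 := ht₁ x ((le_max_left _ _).trans hx.1)
        rw [Real.norm_of_nonneg (Real.rpow_nonneg hx0.le _)] at h4
        have h5 : 0 ≤ x ^ (κ - 1) := Real.rpow_nonneg hx0.le _
        calc x ^ (κ - 1) * J x ≤ x ^ (κ - 1) * (C * x ^ (-s)) :=
              mul_le_mul_of_nonneg_left ((le_abs_self _).trans h4) h5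
          _ = C * (x ^ (κ - 1) * x ^ (-s)) := by ring
          _ = _ := by rw [← Real.rpow_add hx0]; ring_nf
    refine h3.trans ?_
    rw [intervalIntegral.integral_const_mul, integral_rpow (Or.inl (by linarith)), sub_add_cancel,
      div_mul_eq_mul_div, mul_div_assoc]
    have h6 : 0 ≤ t₀ ^ (κ - s) := Real.rpow_nonneg (by linarith) _
    gcongr
    linarith
  have h7 : ∫ x in (0 : ℝ)..t, x ^ (κ - 1) * J x ≤ (A + C / (κ - s)) * t ^ (κ - s) := by
    rw [← intervalIntegral.integral_add_adjacent_intervals hi0 hi1, add_mul]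
    refine add_le_add ((le_abs_self _).trans ?_) h2
    exact le_mul_of_one_le_right (abs_nonneg _) (Real.one_le_rpow ht1 hκs'.le)
  rw [Real.norm_of_nonneg (hG t), Real.norm_of_nonneg (Real.rpow_nonneg ht0.le _)]
  refine (h t ht0).2.2.trans ?_
  have h8 : 0 ≤ K * t ^ (-κ) := mul_nonneg hK.le (Real.rpow_nonneg ht0.le _)
  refine (mul_le_mul_of_nonneg_left h7 h8).trans (le_of_eq ?_)
  have h9 : t ^ (-κ) * t ^ (κ - s) = t ^ (-s) := by
    rw [← Real.rpow_add ht0]; ring_nf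
  rw [← h9]
  ring

/-- For κ = 1 the integrated form bounds G by K times the mean of J over (0, t), and means of a
function tending to 0 tend to 0. -/
theorem DiffIneq.tendsto_zero {K : ℝ} {G J : ℝ → ℝ} (h : DiffIneq 1 K G J) (hK : 0 < K)
    (hG : ∀ t, 0 ≤ G t) (hJ : Tendsto J atTop (𝓝 0)) : Tendsto G atTop (𝓝 0) := by
  refine tendsto_order.2 ⟨fun a ha => Eventually.of_forall fun t => ha.trans_le (hG t),
    fun ε hε => ?_⟩
  obtain ⟨t₁, ht₁⟩ := eventually_atTop.1 (hJ.eventually_lt_const (show 0 < ε / (2 * K) by positivity))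
  set t₀ := max t₁ 1 with ht₀
  have h1 : 1 ≤ t₀ := le_max_right _ _
  set A := |∫ x in (0 : ℝ)..t₀, x ^ ((1 : ℝ) - 1) * J x| with hA
  have hlim : Tendsto (fun t : ℝ => K * A / t) atTop (𝓝 0) := tendsto_const_nhds.div_atTop tendsto_id
  filter_upwards [eventually_ge_atTop t₀, hlim.eventually_lt_const (half_pos hε)] with t ht htA
  have ht0 : 0 < t := by linarith
  have hi := (h t ht0).2.1
  have hi0 := (h t₀ (by linarith)).2.1
  have hi1 : IntervalIntegrable (fun x => x ^ ((1 : ℝ) - 1) * J x) volume t₀ t := hi0.symm.trans hi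
  have h2 : ∫ x in t₀..t, x ^ ((1 : ℝ) - 1) * J x ≤ t * (ε / (2 * K)) := by
    have h3 : ∫ x in t₀..t, x ^ ((1 : ℝ) - 1) * J x ≤ ∫ _ in t₀..t, ε / (2 * K) := by
      refine intervalIntegral.integral_mono_on ht hi1 intervalIntegrable_const fun x hx => ?_
      rw [sub_self, Real.rpow_zero, one_mul]
      exact (ht₁ x ((le_max_left _ _).trans hx.1)).le
    refine h3.trans ?_
    rw [intervalIntegral.integral_const, smul_eq_mul]
    gcongr
    linarith
  have h7 : ∫ x in (0 : ℝ)..t, x ^ ((1 : ℝ) - 1) * J x ≤ A + t * (ε / (2 * K)) := by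
    rw [← intervalIntegral.integral_add_adjacent_intervals hi0 hi1]
    exact add_le_add (le_abs_self _) h2
  refine (h t ht0).2.2.trans_lt ?_
  rw [Real.rpow_neg_one]
  have h8 : 0 ≤ K * t⁻¹ := by positivity
  refine (mul_le_mul_of_nonneg_left h7 h8).trans_lt ?_
  have h9 : K * t⁻¹ * (A + t * (ε / (2 * K))) = K * A / t + ε / 2 := by
    field_simp
  rw [h9]
  linarith

/-! ### Decay to zero of square integrable solutions -/

/-- The heat symbols converge pointwise to the indicator of the origin, a null set. -/
theorem tendsto_mulCLM_hk (f : VecL2) : Tendsto (fun t => mulCLM (hk t) f) atTop (𝓝 0) := by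
  have h0 : Measurable (Set.indicator {(0 : Space)} (1 : Space → ℝ)) :=
    measurable_one.indicator (measurableSet_singleton 0)
  have h0b (ξ : Space) : |Set.indicator {(0 : Space)} (1 : Space → ℝ) ξ| ≤ 1 := by
    by_cases h : ξ = 0 <;> simp [h]
  have hm : IsMul (Set.indicator {(0 : Space)} (1 : Space → ℝ)) := ⟨h0, 1, h0b⟩
  have h1 := tendsto_mulCLM_const (l := atTop) (m := hk)
    (m₀ := Set.indicator {(0 : Space)} (1 : Space → ℝ)) (C := 1)
    (Eventually.of_forall measurable_hk) h0
    ((eventually_ge_atTop 0).mono fun t ht => abs_hk_le ht) h0b (fun ξ => ?_) f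
  · have h2 : mulCLM (Set.indicator {(0 : Space)} (1 : Space → ℝ)) f = 0 := by
      refine Lp.ext ?_
      filter_upwards [coeFn_mulCLM hm f, Lp.coeFn_zero Vec 2 (volume : Measure Space),
        ae_ne_zero] with ξ e1 e2 e3
      rw [e1, e2]
      simp [e3]
    rwa [h2] at h1
  · by_cases h : ξ = 0
    · subst h
      simp [hk, symA]
    · rw [Set.indicator_of_notMem (by simpa using h)]
      have h3 : 0 < symA ξ ^ 2 := by have := symA_pos h; positivity
      have h4 : Tendsto (fun t : ℝ => -t * symA ξ ^ 2) atTop atBot := by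
        simp only [neg_mul]
        exact tendsto_neg_atTop_atBot.comp (tendsto_id.atTop_mul_const h3)
      exact Real.tendsto_exp_atBot.comp h4

/-- For fixed s the heat flow over t - s sends F(s) to 0, and ‖F(s)‖ dominates; extending the
integrand by zero past t gives a fixed domain. -/
theorem tendsto_duh_zero {F : ℝ → VecL2} (hF : ContinuousOn F (Set.Ioi 0))
    (hi : IntegrableOn F (Set.Ioi 0) volume) : Tendsto (duh F) atTop (𝓝 0) := by
  have hle (t s : ℝ) (hs : s ∈ Set.Ioc 0 t) : ‖mulCLM (hk (t - s)) (F s)‖ ≤ ‖F s‖ := by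
    simpa using norm_mulCLM_apply_le (measurable_hk (t - s)) (abs_hk_le (sub_nonneg.2 hs.2)) (F s)
  have key : Tendsto (fun t => ∫ s in Set.Ioi (0 : ℝ),
      Set.indicator (Set.Ioc 0 t) (fun s => mulCLM (hk (t - s)) (F s)) s) atTop
      (𝓝 (∫ s in Set.Ioi (0 : ℝ), (0 : VecL2))) := by
    refine tendsto_integral_filter_of_dominated_convergence (fun s => ‖F s‖) ?_ ?_ hi.norm ?_
    · refine Eventually.of_forall fun t => ?_
      refine AEStronglyMeasurable.restrict ((aestronglyMeasurable_indicator_iff measurableSet_Ioc).2 ?_)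
      exact (continuousOn_duh_integrand (hF.mono fun s hs => hs.1)).aestronglyMeasurable
        measurableSet_Ioc
    · refine Eventually.of_forall fun t => ae_of_all _ fun s => ?_
      by_cases hs : s ∈ Set.Ioc 0 t
      · rw [Set.indicator_of_mem hs]
        exact hle t s hs
      · rw [Set.indicator_of_notMem hs, norm_zero]
        exact norm_nonneg _
    · filter_upwards [ae_restrict_mem measurableSet_Ioi] with s hs
      have h1 : Tendsto (fun t => mulCLM (hk (t - s)) (F s)) atTop (𝓝 0) :=
        (tendsto_mulCLM_hk (F s)).comp (tendsto_atTop_add_const_right _ (-s) tendsto_id)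
      refine h1.congr' ?_
      filter_upwards [eventually_ge_atTop s] with t ht
      rw [Set.indicator_of_mem (show s ∈ Set.Ioc 0 t from ⟨hs, ht⟩)]
  rw [integral_zero] at key
  refine key.congr' ?_
  filter_upwards [eventually_ge_atTop 0] with t ht
  rw [duh, intervalIntegral.integral_of_le ht, setIntegral_indicator measurableSet_Ioc,
    Set.inter_eq_self_of_subset_right fun s hs => hs.1]

/-- The assumed rates make the forcing O(t^{-3/8} t^{-7/8}) = O(t^{-5/4}) in L², integrable at
infinity; near 0 it is O(t^{-3/4}). So the forcing is integrable in time, and both the free flow and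
the Duhamel term tend to 0. -/
theorem Regular.tendsto_J_zero (hP : IsFiberedProjection P) {u₀ : VecDist} {X : ℝ → VecDist}
    {l N : ℝ} (h : Regular P M u₀ X l N) (hu : InDom 0 0 u₀)
    (h1 : J (3 / 4) X =O[atTop] fun t : ℝ => t ^ (-(3 / 4) : ℝ))
    (h2 : J (7 / 4) X =O[atTop] fun t : ℝ => t ^ (-(7 / 4) : ℝ)) :
    Tendsto (J 0 X) atTop (𝓝 0) := by
  have hroot {r p : ℝ} (hr : J r X =O[atTop] fun t : ℝ => t ^ (-p)) :
      ∃ C, 0 ≤ C ∧ ∀ᶠ t in atTop, ‖expA 0 r (X t)‖ ≤ C * t ^ (-(p / 2)) := by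
    obtain ⟨C, hC0, hC⟩ := hr.exists_nonneg
    refine ⟨Real.sqrt C, Real.sqrt_nonneg C, ?_⟩
    filter_upwards [hC.bound, eventually_gt_atTop 0] with t ht ht0
    have h3 : 0 ≤ t ^ (-(p / 2)) := Real.rpow_nonneg ht0.le _
    refine le_of_sq_le_sq ?_ (mul_nonneg (Real.sqrt_nonneg C) h3)
    rw [mul_pow, Real.sq_sqrt hC0, ← Real.rpow_mul_natCast ht0.le]
    have h4 : J r X t ≤ C * t ^ (-p) := by
      rw [Real.norm_of_nonneg (Real.rpow_nonneg ht0.le _)] at ht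
      exact (le_abs_self _).trans ht
    refine h4.trans (le_of_eq ?_)
    congr 2
    push_cast
    ring
  obtain ⟨C₁, hC₁, hb₁⟩ := hroot h1
  obtain ⟨C₂, hC₂, hb₂⟩ := hroot h2
  obtain ⟨C, hC, hF⟩ := eLpNorm_forc_le hP M (α := 3 / 4) (β := 3 / 4) (by norm_num) (by norm_num)
    (by norm_num)
  obtain ⟨t₀, ht₀⟩ := eventually_atTop.1 ((hb₁.and hb₂).and (eventually_gt_atTop 0))
  have ht₀0 : 0 < t₀ := (ht₀ t₀ le_rfl).2
  have hbd (t : ℝ) (ht : t₀ ≤ t) : ‖forc P M (X t) (X t)‖ ≤ C * C₁ * C₂ * t ^ (-(5 / 4) : ℝ) := by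
    obtain ⟨⟨e1, e2⟩, e3⟩ := ht₀ t ht
    have hl : 0 ≤ l * Real.sqrt t := mul_nonneg h.l_nonneg (Real.sqrt_nonneg t)
    have d1 := (h.inDom_half hP (r := 3 / 4) (by norm_num) (by norm_num) e3 le_rfl hl).1
    have d2 := (h.inDom_half hP (r := 7 / 4) (by norm_num) (by norm_num) e3 le_rfl hl).1
    have h3 := hF 0 le_rfl (X t) (X t) (h.hdot t e3) (h.hdot t e3)
    rw [show (1 + 3 / 4 : ℝ) = 7 / 4 by norm_num, eLpNorm_weighted d1, eLpNorm_weighted d2,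
      ← ENNReal.ofReal_mul (norm_nonneg _), ← ENNReal.ofReal_mul hC] at h3
    refine (norm_le_of_wt le_rfl (by positivity) h3).trans ?_
    have h4 : 0 ≤ t ^ (-(3 / 4 / 2) : ℝ) := Real.rpow_nonneg e3.le _
    calc C * (‖expA 0 (3 / 4) (X t)‖ * ‖expA 0 (7 / 4) (X t)‖)
        ≤ C * ((C₁ * t ^ (-(3 / 4 / 2) : ℝ)) * (C₂ * t ^ (-(7 / 4 / 2) : ℝ))) := by gcongr
      _ = C * C₁ * C₂ * (t ^ (-(3 / 4 / 2) : ℝ) * t ^ (-(7 / 4 / 2) : ℝ)) := by ring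
      _ = _ := by rw [← Real.rpow_add e3]; norm_num
  have hint : IntegrableOn (fun s => forc P M (X s) (X s)) (Set.Ioi 0) volume := by
    rw [← Set.Ioc_union_Ioi_eq_Ioi ht₀0.le]
    refine IntegrableOn.union ?_ ?_
    · exact (intervalIntegrable_iff_integrableOn_Ioc_of_le ht₀0.le).1
        (intervalIntegrable_of_bound ht₀0.le (h.cont.mono fun s hs => hs.1)
          fun s hs => h.norm_forc_le hs.1)
    · refine Integrable.mono' ((integrableOn_Ioi_rpow_of_lt (a := -(5 / 4)) (by norm_num)
        ht₀0).const_mul (C * C₁ * C₂)) ?_ ?_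
      · exact (h.cont.mono (Set.Ioi_subset_Ioi ht₀0.le)).aestronglyMeasurable measurableSet_Ioi
      · filter_upwards [ae_restrict_mem measurableSet_Ioi] with s hs using hbd s (le_of_lt hs)
  have h5 := (tendsto_mulCLM_hk (hatW 0 0 u₀)).sub (tendsto_duh_zero h.cont hint)
  rw [sub_zero] at h5
  have h6 := (h5.norm.pow 2)
  rw [norm_zero, zero_pow two_ne_zero] at h6
  refine h6.congr' ?_
  filter_upwards [eventually_gt_atTop 0] with t ht
  have hl : 0 ≤ l * Real.sqrt t := mul_nonneg h.l_nonneg (Real.sqrt_nonneg t)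
  have hd := (h.inDom hP le_rfl le_rfl (by norm_num) hu ht le_rfl hl).1
  rw [J, norm_expA_eq]
  congr 2
  refine Lp.ext ?_
  filter_upwards [hd.coeFn_hatW, h.hat_eq hP ht, hu.coeFn_hatW, coeFn_mulCLM (isMul_hk ht.le)
    (hatW 0 0 u₀), Lp.coeFn_sub (mulCLM (hk t) (hatW 0 0 u₀))
      (duh (fun s => forc P M (X s) (X s)) t)] with ξ e1 e2 e3 e4 e5
  rw [e1, e2, e5, Pi.sub_apply, e4, e3]
  simp [wt]

end NavierStokes

/-! ### Assembly: uniform constants and propagation of decay. -/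

namespace NavierStokes

variable {P : Space → Matrix (Fin 3) (Fin 3) ℂ} {M : Matrix (Fin 3) (Fin 3) ℝ} {C₁ C₃ : ℝ}

/-- The differential inequalities, with a constant independent of the solution. -/
theorem exists_diffIneq (hP : IsFiberedProjection P) (hC₁ : 0 < C₁) (hC₃ : 0 < C₃)
    (hD : DataBound C₁) (hB : BilinearBound P M C₃) {κ k : ℝ} (hκ : 0 < κ) (hk : 0 ≤ k) :
    ∃ K : ℝ, 0 < K ∧ ∀ u₀ X lamBar r, Setting P M C₁ C₃ u₀ X lamBar k → 0 ≤ r → r ≤ 1 / 2 →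
      InDom 0 r u₀ → DiffIneq κ K (G k r X) (J r X) := by
  obtain ⟨N, hN⟩ := NavierStokes.exists_regular hP hC₁ hC₃ hD hB hk
  obtain ⟨K, hK, h⟩ := exists_deriv_bound hP M (k := k) hκ.le N
  refine ⟨K, hK, fun u₀ X lamBar r hS hr hr2 hu => ?_⟩
  obtain ⟨l, hkl, hl⟩ := hS.exists_gt
  obtain ⟨N', hN'⟩ := hl.exists_regular hP hC₁ hC₃ hD hB
  have hR := hN u₀ X hS.data hS.solution (hS.small_at hC₁ hC₃)
  exact hR.diffIneq hP hN' hkl hr hr2 hu hκ hK (h u₀ X l N' r hR hN' hkl hr hr2 hu)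

variable {u₀ : VecDist} {X : ℝ → VecDist} {lamBar : EReal} {lam0 : ℝ}

theorem Setting.inDom (hP : IsFiberedProjection P) (hC₁ : 0 < C₁) (hC₃ : 0 < C₃)
    (hD : DataBound C₁) (hB : BilinearBound P M C₃) (h : Setting P M C₁ C₃ u₀ X lamBar lam0)
    {a r t : ℝ} (ha : 0 ≤ a) (ha2 : a < 2) (har : a ≤ r) (hu : InDom 0 a u₀) (ht : 0 < t) :
    InDom 0 r (X t) ∧ InDom (lam0 * Real.sqrt t) r (X t) := by
  obtain ⟨l, hl, hS⟩ := h.exists_gt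
  obtain ⟨N, hN⟩ := hS.exists_regular hP hC₁ hC₃ hD hB
  obtain ⟨h1, h2, -⟩ := hN.gap hP h.pos.le hl ha ha2 har hu ht
  exact ⟨h1, h2⟩

/-- The differential inequality is applied with a weight l > λ₀. The surplus (l-λ₀)√t then buys r -
a more derivatives, each of which gains t^{-1} in the squared norm. -/
theorem Setting.isBigO (hP : IsFiberedProjection P) (hC₁ : 0 < C₁) (hC₃ : 0 < C₃)
    (hD : DataBound C₁) (hB : BilinearBound P M C₃) (h : Setting P M C₁ C₃ u₀ X lamBar lam0)
    {a r s : ℝ} (ha : 0 ≤ a) (ha2 : a ≤ 1 / 2) (har : a ≤ r) (hu : InDom 0 a u₀)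
    (hJ : J a X =O[atTop] fun t : ℝ => t ^ (-s)) :
    J r X =O[atTop] (fun t : ℝ => t ^ (-s - (r - a))) ∧
      G lam0 r X =O[atTop] fun t : ℝ => t ^ (-s - (r - a)) := by
  obtain ⟨l, hl, hS⟩ := h.exists_gt
  obtain ⟨N, hN⟩ := hS.exists_regular hP hC₁ hC₃ hD hB
  -- Any positive κ larger than s would do.
  obtain ⟨K, hK, hd⟩ := exists_diffIneq hP hC₁ hC₃ hD hB (κ := |s| + 1) (by positivity) hS.pos.le
  have h1 : G l a X =O[atTop] fun t : ℝ => t ^ (-s) :=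
    (hd u₀ X lamBar a hS ha ha2 hu).isBigO hK ((le_abs_self s).trans_lt (lt_add_one _))
      (fun t => sq_nonneg _) hJ
  have hg := fun {t : ℝ} (ht : 0 < t) => hN.gap hP h.pos.le hl ha (by linarith) har hu ht
  have h2 : G lam0 r X =O[atTop] fun t : ℝ => t ^ (-(r - a)) * G l a X t := by
    refine IsBigO.of_bound (((r - a) ^ (r - a) * (l - lam0) ^ (-(r - a))) ^ 2) ?_
    filter_upwards [eventually_gt_atTop 0] with t ht
    have h3 : 0 ≤ t ^ (-(r - a)) * G l a X t :=
      mul_nonneg (Real.rpow_nonneg ht.le _) (sq_nonneg _)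
    rw [Real.norm_of_nonneg h3, Real.norm_of_nonneg (show 0 ≤ G lam0 r X t from sq_nonneg _), ← mul_assoc]
    exact (hg ht).2.2.2
  have h4 : G lam0 r X =O[atTop] fun t : ℝ => t ^ (-s - (r - a)) := by
    refine (h2.trans ((isBigO_refl _ _).mul h1)).congr' EventuallyEq.rfl ?_
    filter_upwards [eventually_gt_atTop 0] with t ht
    rw [← Real.rpow_add ht]
    ring_nf
  refine ⟨(IsBigO.of_bound 1 ?_).trans h4, h4⟩
  filter_upwards [eventually_gt_atTop 0] with t ht
  rw [one_mul, Real.norm_of_nonneg (show 0 ≤ J r X t from sq_nonneg _),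
    Real.norm_of_nonneg (show 0 ≤ G lam0 r X t from sq_nonneg _)]
  exact (hg ht).2.2.1

/-- Boundedness of J₀ is decay of order 0, so `Setting.isBigO` yields the rates of the norms with r
= 3/4 and r = 7/4. These make J₀ tend to 0, and the inequality with κ = 1 carries this over to G₀.
-/
theorem Setting.tendsto_G_zero (hP : IsFiberedProjection P) (hC₁ : 0 < C₁) (hC₃ : 0 < C₃)
    (hD : DataBound C₁) (hB : BilinearBound P M C₃) (h : Setting P M C₁ C₃ u₀ X lamBar lam0)
    (hu : InDom 0 0 u₀) (hJ : J 0 X =O[atTop] fun _ : ℝ => (1 : ℝ)) :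
    Tendsto (G lam0 0 X) atTop (𝓝 0) := by
  obtain ⟨N, hN⟩ := h.exists_regular hP hC₁ hC₃ hD hB
  obtain ⟨K, hK, hd⟩ := exists_diffIneq hP hC₁ hC₃ hD hB one_pos h.pos.le
  have hJ' : J 0 X =O[atTop] fun t : ℝ => t ^ (-0 : ℝ) := by simpa using hJ
  have hr {r : ℝ} (hr : 0 ≤ r) : J r X =O[atTop] fun t : ℝ => t ^ (-r) := by
    simpa using (h.isBigO hP hC₁ hC₃ hD hB le_rfl (by norm_num) hr hu hJ').1
  exact (hd u₀ X lamBar 0 h le_rfl (by norm_num) hu).tendsto_zero hK (fun t => sq_nonneg _)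
    (hN.tendsto_J_zero hP hu (hr (by norm_num)) (hr (by norm_num)))

end NavierStokes

end

theorem mainTheorem6 (P : NavierStokes.Space → Matrix (Fin 3) (Fin 3) ℂ)
    (hP : NavierStokes.IsFiberedProjection P) (M : Matrix (Fin 3) (Fin 3) ℝ) :
    (∃ C₁ C₃ : ℝ, 0 < C₁ ∧ 0 < C₃ ∧ NavierStokes.DataBound C₁ ∧
      NavierStokes.BilinearBound P M C₃) ∧
    ∀ C₁ C₃ : ℝ, 0 < C₁ → 0 < C₃ → NavierStokes.DataBound C₁ →
      NavierStokes.BilinearBound P M C₃ →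
      -- the differential inequalities, with a constant depending on `κ` and `λ₀` only
      (∀ κ lam0 : ℝ, 0 < κ → 0 < lam0 → ∃ K : ℝ, 0 < K ∧
        ∀ (u₀ : NavierStokes.VecDist) (X : ℝ → NavierStokes.VecDist) (lamBar : EReal),
          NavierStokes.Setting P M C₁ C₃ u₀ X lamBar lam0 →
          NavierStokes.DiffIneq κ K (NavierStokes.G lam0 (1 / 2) X) (NavierStokes.J (1 / 2) X) ∧
          (NavierStokes.MemL2 u₀ →
            NavierStokes.DiffIneq κ K (NavierStokes.G lam0 0 X) (NavierStokes.J 0 X))) ∧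
      -- finiteness of `G_r`, `J_r`, and propagation of decay
      (∀ (u₀ : NavierStokes.VecDist) (X : ℝ → NavierStokes.VecDist) (lamBar : EReal) (lam0 : ℝ),
        NavierStokes.Setting P M C₁ C₃ u₀ X lamBar lam0 →
        (∀ r t : ℝ, 1 / 2 ≤ r → 0 < t → NavierStokes.InDom 0 r (X t) ∧
          NavierStokes.InDom (lam0 * Real.sqrt t) r (X t)) ∧
        (∀ σ : ℝ, -(1 / 2) < σ →
          NavierStokes.J (1 / 2) X =O[atTop] (fun t : ℝ => t ^ (-σ - 1 / 2)) →
          ∀ r : ℝ, 1 / 2 ≤ r →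
            NavierStokes.J r X =O[atTop] (fun t : ℝ => t ^ (-σ - r)) ∧
            NavierStokes.G lam0 r X =O[atTop] (fun t : ℝ => t ^ (-σ - r))) ∧
        (NavierStokes.MemL2 u₀ →
          (∀ r t : ℝ, 0 ≤ r → 0 < t → NavierStokes.InDom 0 r (X t) ∧
            NavierStokes.InDom (lam0 * Real.sqrt t) r (X t)) ∧
          (∀ σ : ℝ, -(1 / 2) < σ →
            NavierStokes.J 0 X =O[atTop] (fun t : ℝ => t ^ (-σ)) →
            ∀ r : ℝ, 0 ≤ r →
              NavierStokes.J r X =O[atTop] (fun t : ℝ => t ^ (-σ - r)) ∧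
              NavierStokes.G lam0 r X =O[atTop] (fun t : ℝ => t ^ (-σ - r))) ∧
          (NavierStokes.J 0 X =O[atTop] (fun _ : ℝ => (1 : ℝ)) →
            NavierStokes.G lam0 0 X =o[atTop] (fun _ : ℝ => (1 : ℝ))))) := by
  refine ⟨?_, fun C₁ C₃ hC₁ hC₃ hD hB => ⟨fun κ lam0 hκ hlam => ?_, fun u₀ X lamBar lam0 h => ?_⟩⟩
  · obtain ⟨C₃, hC₃, h⟩ := NavierStokes.exists_bilinearBound hP M
    exact ⟨_, C₃, Real.exp_pos _, hC₃, NavierStokes.dataBound_exp, h⟩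
  · obtain ⟨K, hK, h⟩ := NavierStokes.exists_diffIneq hP hC₁ hC₃ hD hB hκ hlam.le
    exact ⟨K, hK, fun u₀ X lamBar hS => ⟨h u₀ X lamBar _ hS (by norm_num) le_rfl hS.data,
      fun hu => h u₀ X lamBar _ hS le_rfl (by norm_num) hu.inDom⟩⟩
  refine ⟨fun r t hr ht => h.inDom hP hC₁ hC₃ hD hB (by norm_num) (by norm_num) hr h.data ht,
    fun σ _ hJ r hr => ?_,
    fun hu => ⟨fun r t hr ht => h.inDom hP hC₁ hC₃ hD hB le_rfl two_pos hr hu.inDom ht,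
      fun σ _ hJ r hr => ?_, fun hJ => (isLittleO_one_iff ℝ).2
        (h.tendsto_G_zero hP hC₁ hC₃ hD hB hu.inDom hJ)⟩⟩
  · have h1 : (fun t : ℝ => t ^ (-σ - r)) = fun t : ℝ => t ^ (-(σ + 1 / 2) - (r - 1 / 2)) := by
      ext t
      ring_nf
    rw [neg_sub_left, add_comm] at hJ
    rw [h1]
    exact h.isBigO hP hC₁ hC₃ hD hB (by norm_num) le_rfl hr h.data hJ
  · simpa using h.isBigO hP hC₁ hC₃ hD hB le_rfl (by norm_num) hr hu.inDom hJ
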